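/- Let $n>3$ be even. Let $\mathrm{Imb}(S^1,\mathbb R^n)\subset \mathrm{Imm}(S^1,\mathbb R^n)$ be the spaces of smooth imbeddings and immersions of $S^1=\mathbb R/\mathbb Z$ into $\mathbb R^n$, let $\mathcal L S^{n-1}$ be the space of smooth free loops in the unit sphere $S^{n-1}\subset\mathbb R^n$, and let $D:\mathrm{Imm}(S^1,\mathbb R^n)\to\mathcal L S^{n-1}$, $D\psi=\psi'/\|\psi'\|$, be the normalized derivative. A differential form on one of these spaces is a compatible family of smooth forms, one on the parameter space of each finite-dimensional smooth family of loops; $d$, $\wedge$ and pull-backs are defined accordingly. Let $v$ be a smooth $(n-1)$-form on $S^{n-1}$ with $\int_{S^{n-1}}v=1$ (for either orientation of $S^{n-1}$). Let $P_1(v)=\int_{[0,1]}\Phi^*v\in\Omega^{n-2}(\mathcal L S^{n-1})$, where $\Phi:[0,1]\times\mathcal L S^{n-1}\to S^{n-1}$, $\Phi(t,\gamma)=\gamma(t)$, and let $vP_1(v)=(\mathrm{ev}_0^*v)\wedge P_1(v)\in\Omega^{2n-3}(\mathcal L S^{n-1})$, where $\mathrm{ev}_0(\gamma)=\gamma(0)$.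 Let $\omega$ be the restriction of $D^*[vP_1(v)]$ to $\mathrm{Imb}(S^1,\mathbb R^n)$. Then $\omega$ is a form of degree $2n-3$ on $\mathrm{Imb}(S^1,\mathbb R^n)$ that is closed and not exact, so it represents a nontrivial class in $H^{2n-3}(\mathrm{Imb}(S^1,\mathbb R^n);\mathbb R)$. More precisely, let $V_{n,2}$ be the Stiefel manifold of pairs $(\mathbf x,\mathbf y)$ of orthonormal vectors in $\mathbb R^n$, let $c:V_{n,2}\to\mathrm{Imb}(S^1,\mathbb R^n)$ send $(\mathbf x,\mathbf y)$ to the imbedding $t\mapsto (1-\cos 2\pi t)\,\mathbf x+\sin 2\pi t\;\mathbf y$, and let $$f:S^1\times V_{n,2}\to S^{n-1}\times S^{n-1},\qquad f(\theta,\mathbf x,\mathbf y)=(\mathbf y,\ \sin\theta\;\mathbf x+\cos\theta\;\mathbf y),$$ where here $S^1$ is the unit circle with angle $\theta$. There is an orientation of $V_{n,2}$, given by a volume form $\sigma$, such that $f$ has degree $1+(-1)^n=2$ when $S^1\times V_{n,2}$ is oriented by $\sigma\wedge d\theta$ and $S^{n-1}\times S^{n-1}$ by the product orientation (the same orientation on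 both factors), and such that $$\int_{V_{n,2}}c^*\omega=2=\deg f .$$ -/

import Mathlib

open Diffeology
open scoped ContDiff Topology

namespace ImbCoh

/-- Euclidean space `ℝ^m`. -/
abbrev RR (m : ℕ) : Type := EuclideanSpace ℝ (Fin m)

noncomputable section

theorem finiteDimensional_alt (m k : ℕ) : FiniteDimensional ℝ (RR m [⋀^Fin k]→L[ℝ] ℝ) := by
  let F : (RR m [⋀^Fin k]→L[ℝ] ℝ) →ₗ[ℝ] MultilinearMap ℝ (fun _ : Fin k => RR m) ℝ :=
    { toFun := fun f => f.toMultilinearMap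
      map_add' := fun _ _ => rfl
      map_smul' := fun _ _ => rfl }
  refine FiniteDimensional.of_injective F ?_
  intro f g h
  ext v
  exact congrArg (fun a : MultilinearMap ℝ (fun _ : Fin k => RR m) ℝ => a v) h

/-- A map into the alternating forms on `ℝ^m` is smooth as soon as its values on all tuples are. -/
theorem contDiff_alt {m k : ℕ} {E : Type} [NormedAddCommGroup E] [NormedSpace ℝ E]
    {f : E → (RR m [⋀^Fin k]→L[ℝ] ℝ)} (h : ∀ w, ContDiff ℝ ∞ fun x => f x w) :
    ContDiff ℝ ∞ f := by
  have := finiteDimensional_alt m k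
  let b := EuclideanSpace.basisFun (Fin m) ℝ
  let F : (RR m [⋀^Fin k]→L[ℝ] ℝ) →ₗ[ℝ] ((Fin k → Fin m) → ℝ) :=
    { toFun := fun f r => f (fun i => b (r i))
      map_add' := fun _ _ => rfl
      map_smul' := fun _ _ => rfl }
  have hF : Function.Injective F := by
    intro f g hfg
    have : f.toMultilinearMap = g.toMultilinearMap := by
      refine Module.Basis.ext_multilinear (fun _ => b.toBasis) ?_
      intro r
      simpa [F] using congrFun hfg r
    ext v
    exact congrArg (fun a : MultilinearMap ℝ (fun _ : Fin k => RR m) ℝ => a v) this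
  obtain ⟨G, hG⟩ := F.exists_leftInverse_of_injective (LinearMap.ker_eq_bot.2 hF)
  have h1 : ContDiff ℝ ∞ fun x => F (f x) := contDiff_pi.2 fun r => h _
  have h2 : ContDiff ℝ ∞ fun x => G.toContinuousLinearMap (F (f x)) :=
    G.toContinuousLinearMap.contDiff.comp h1
  have : (fun x => G.toContinuousLinearMap (F (f x))) = f := by
    funext x
    exact congrArg (fun a : (RR m [⋀^Fin k]→L[ℝ] ℝ) →ₗ[ℝ] _ => a (f x)) hG
  rwa [this] at h2

/-- Integrals of smooth functions over a parameter in `[0,1]` are smooth. -/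
theorem contDiff_integral_param {m : ℕ} (j : ℕ) :
    ∀ {F : Type} [NormedAddCommGroup F] [NormedSpace ℝ F] [CompleteSpace F] {f : RR m × ℝ → F},
      ContDiff ℝ ∞ f → ContDiff ℝ j fun x : RR m => ∫ t in (0 : ℝ)..1, f (x, t) := by
  have key : ∀ {F : Type} [NormedAddCommGroup F] [NormedSpace ℝ F] [CompleteSpace F]
      {f : RR m × ℝ → F}, ContDiff ℝ ∞ f → ∀ x₀ : RR m,
      HasFDerivAt (fun x : RR m => ∫ t in (0 : ℝ)..1, f (x, t))
        (∫ t in (0 : ℝ)..1, (fderiv ℝ f (x₀, t)).comp (ContinuousLinearMap.inl ℝ (RR m) ℝ)) x₀ := by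
    intro F _ _ _ f hf x₀
    have hfd : ContDiff ℝ ∞ (fderiv ℝ f) := hf.fderiv_right (by simp)
    have hg : Continuous fun z : RR m × ℝ =>
        (fderiv ℝ f z).comp (ContinuousLinearMap.inl ℝ (RR m) ℝ) :=
      hfd.continuous.clm_comp continuous_const
    obtain ⟨C, hC⟩ := ((isCompact_closedBall x₀ 1).prod
      (isCompact_Icc (a := (0 : ℝ)) (b := 1))).exists_bound_of_continuousOn hg.continuousOn
    refine intervalIntegral.hasFDerivAt_integral_of_dominated_of_fderiv_le
      (s := Metric.ball x₀ 1) (bound := fun _ => C) (Metric.ball_mem_nhds _ one_pos)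
      (F := fun x t => f (x, t))
      (F' := fun x t => (fderiv ℝ f (x, t)).comp (ContinuousLinearMap.inl ℝ (RR m) ℝ))
      ?_ ?_ ?_ ?_ ?_ ?_
    · exact Filter.Eventually.of_forall fun x =>
        (hf.continuous.comp (by fun_prop : Continuous fun t : ℝ => (x, t))).aestronglyMeasurable
    · exact (hf.continuous.comp
        (by fun_prop : Continuous fun t : ℝ => (x₀, t))).intervalIntegrable _ _
    · exact (hg.comp (by fun_prop : Continuous fun t : ℝ => (x₀, t))).aestronglyMeasurable
    · refine Filter.Eventually.of_forall fun t ht x hx => hC (x, t) ⟨Metric.ball_subset_closedBall hx, ?_⟩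
      rw [Set.uIoc_of_le zero_le_one] at ht
      exact ⟨ht.1.le, ht.2⟩
    · exact intervalIntegrable_const
    · refine Filter.Eventually.of_forall fun t _ x _ => ?_
      have h1 : HasFDerivAt f (fderiv ℝ f (x, t)) (x, t) :=
        (hf.differentiable (by simp)).differentiableAt.hasFDerivAt
      exact h1.comp x (hasFDerivAt_prodMk_left x t)
  induction j with
  | zero =>
    intro F _ _ _ f hf
    rw [Nat.cast_zero, contDiff_zero]
    exact continuous_iff_continuousAt.2 fun x => (key hf x).continuousAt
  | succ j ih =>
    intro F _ _ _ f hf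
    rw [Nat.cast_succ, contDiff_succ_iff_hasFDerivAt]
    refine ⟨_, ih (f := fun z => (fderiv ℝ f z).comp (ContinuousLinearMap.inl ℝ (RR m) ℝ)) ?_,
      fun x => key hf x⟩
    exact (hf.fderiv_right (by simp)).clm_comp contDiff_const

/-! ### Diffeologies -/

/-- The subspace diffeology: plots are the maps that are plots of the ambient space. -/
instance subtypeDiffeology {X : Type} [DiffeologicalSpace X] (P : X → Prop) :
    DiffeologicalSpace (Subtype P) where
  plots m := {p | IsPlot fun u => (p u : X)}
  constant_plots _ := isPlot_const
  plot_reparam hp hf := isPlot_reparam hp hf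
  locality h := DiffeologicalSpace.locality h

/-- The product diffeology: plots are the pairs of plots. -/
instance prodDiffeology {X Y : Type} [DiffeologicalSpace X] [DiffeologicalSpace Y] :
    DiffeologicalSpace (X × Y) where
  plots m := {p | IsPlot (fun u => (p u).1) ∧ IsPlot (fun u => (p u).2)}
  constant_plots _ := ⟨isPlot_const, isPlot_const⟩
  plot_reparam hp hf := ⟨isPlot_reparam hp.1 hf, isPlot_reparam hp.2 hf⟩
  locality h := ⟨DiffeologicalSpace.locality fun x => by
      obtain ⟨u, hu, hx, h'⟩ := h x
      exact ⟨u, hu, hx, fun hf hf' => (h' hf hf').1⟩,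
    DiffeologicalSpace.locality fun x => by
      obtain ⟨u, hu, hx, h'⟩ := h x
      exact ⟨u, hu, hx, fun hf hf' => (h' hf hf').2⟩⟩

/-- The point `(t, u) ∈ ℝ × ℝ^m = ℝ^(m+1)`. -/
def pt {m : ℕ} (t : ℝ) (u : RR m) : RR (m + 1) := WithLp.toLp 2 (Fin.cons t fun i => u i)

/-- The projection `ℝ^(m+1) = ℝ × ℝ^m → ℝ^m`. -/
def tl {m : ℕ} (z : RR (m + 1)) : RR m := WithLp.toLp 2 fun i => z i.succ

@[simp] theorem pt_zero {m : ℕ} (t : ℝ) (u : RR m) : pt t u 0 = t := rfl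
@[simp] theorem pt_succ {m : ℕ} (t : ℝ) (u : RR m) (i : Fin m) : pt t u i.succ = u i := rfl
@[simp] theorem tl_pt {m : ℕ} (t : ℝ) (u : RR m) : tl (pt t u) = u := rfl
@[simp] theorem pt_tl {m : ℕ} (z : RR (m + 1)) : pt (z 0) (tl z) = z := by
  ext i
  refine Fin.cases ?_ (fun i => ?_) i <;> rfl

theorem contDiff_pt {m : ℕ} : ContDiff ℝ ∞ fun z : RR m × ℝ => pt z.2 z.1 := by
  rw [contDiff_euclidean]
  intro i
  refine Fin.cases ?_ (fun i => ?_) i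
  · simpa using contDiff_snd
  · simp only [pt_succ]
    fun_prop

theorem contDiff_tl {m : ℕ} : ContDiff ℝ ∞ (tl : RR (m + 1) → RR m) := by
  rw [contDiff_euclidean]
  intro i
  simp only [tl]
  fun_prop

/-- The inclusion `ℝ^m → ℝ × ℝ^m = ℝ^(m+1)`, `w ↦ (0, w)`. -/
def incl (m : ℕ) : RR m →L[ℝ] RR (m + 1) :=
  LinearMap.toContinuousLinearMap
    { toFun := fun w => pt 0 w
      map_add' := fun x y => by
        ext i
        refine Fin.cases ?_ (fun i => ?_) i <;> simp
      map_smul' := fun c x => by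
        ext i
        refine Fin.cases ?_ (fun i => ?_) i <;> simp }

@[simp] theorem incl_apply {m : ℕ} (w : RR m) : incl m w = pt 0 w := rfl

theorem two_le_infty : (2 : WithTop ℕ∞) ≤ ∞ := 
  WithTop.coe_le_coe.2 (le_top : (2 : ℕ∞) ≤ ⊤)

/-! ### Differential forms -/

/-- A differential `k`-form on a diffeological space `X`: a smooth `k`-form on `ℝ^m` for every plot
`p : ℝ^m → X`, to be thought of as the pull-back along `p`, compatible with smooth changes of the
parameters. On (finite-dimensional) manifolds these are the usual differential forms. -/
@[ext] structure DForm (X : Type) [DiffeologicalSpace X] (k : ℕ) where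
  val : ∀ {m : ℕ} (p : RR m → X), IsPlot p → RR m → (RR m [⋀^Fin k]→L[ℝ] ℝ)
  smooth : ∀ {m : ℕ} (p : RR m → X) (hp : IsPlot p), ContDiff ℝ ∞ (val p hp)
  compat : ∀ {m l : ℕ} (p : RR m → X) (hp : IsPlot p) (g : RR l → RR m) (hg : ContDiff ℝ ∞ g)
    (u : RR l), val (p ∘ g) (isPlot_reparam hp hg) u =
      (val p hp (g u)).compContinuousLinearMap (fderiv ℝ g u)

namespace DForm

variable {X Y : Type} [DiffeologicalSpace X] [DiffeologicalSpace Y]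

/-- The pull-back `f^* α` of a form along a smooth map. -/
def pullback (f : X → Y) (hf : DSmooth f) {k : ℕ} (α : DForm Y k) : DForm X k where
  val p hp := α.val (f ∘ p) (hf _ p hp)
  smooth _ _ := α.smooth _ _
  compat p hp g hg u := α.compat (f ∘ p) (hf _ p hp) g hg u

/-- The exterior derivative. -/
def d {k : ℕ} (α : DForm X k) : DForm X (k + 1) where
  val p hp := extDeriv (α.val p hp)
  smooth p hp := by
    have h : ContDiff ℝ ∞ (fderiv ℝ (α.val p hp)) := (α.smooth p hp).fderiv_right (by simp)
    exact (ContinuousAlternatingMap.alternatizeUncurryFinCLM ℝ _ ℝ).contDiff.comp h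
  compat p hp g hg u := by
    have h : α.val (p ∘ g) (isPlot_reparam hp hg) = fun u =>
        (α.val p hp (g u)).compContinuousLinearMap (fderiv ℝ g u) :=
      funext fun u => α.compat p hp g hg u
    rw [h]
    exact extDeriv_pullback ((α.smooth p hp).differentiable (by simp)).differentiableAt
      hg.contDiffAt (by simpa using two_le_infty)

/-- The wedge product of alternating forms on `ℝ^m`: the signed sum over all `(j,l)`-shuffles,
without any further normalization. -/
def wedgeAlg {m j l k : ℕ} (h : j + l = k) (a : RR m [⋀^Fin j]→L[ℝ] ℝ)
    (b : RR m [⋀^Fin l]→L[ℝ] ℝ) : RR m [⋀^Fin k]→ₗ[ℝ] ℝ :=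
  ((LinearMap.mul' ℝ ℝ).compAlternatingMap
    (a.toAlternatingMap.domCoprod b.toAlternatingMap)).domDomCongr
      (finSumFinEquiv.trans (finCongr h))

theorem wedgeAlg_apply {m j l k : ℕ} (h : j + l = k) (a : RR m [⋀^Fin j]→L[ℝ] ℝ)
    (b : RR m [⋀^Fin l]→L[ℝ] ℝ) (w : Fin k → RR m) :
    wedgeAlg h a b w = ∑ c : Equiv.Perm.ModSumCongr (Fin j) (Fin l),
      ((Equiv.Perm.sign c.out : ℤ) : ℝ) *
        (a (fun i => w (Fin.cast h (finSumFinEquiv (c.out (Sum.inl i))))) *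
          b (fun i => w (Fin.cast h (finSumFinEquiv (c.out (Sum.inr i)))))) := by
  simp only [wedgeAlg, AlternatingMap.domDomCongr_apply, LinearMap.compAlternatingMap_apply,
    AlternatingMap.domCoprod_apply, _root_.sum_apply, map_sum]
  refine Finset.sum_congr rfl fun c _ => ?_
  conv_lhs => rw [← Quotient.out_eq' c]
  rw [AlternatingMap.domCoprod.summand_mk'']
  rw [_root_.smul_apply, Units.smul_def, map_zsmul, zsmul_eq_mul]
  rfl

/-- The wedge product of alternating forms on `ℝ^m`. -/
def wedgeAlt {m j l k : ℕ} (h : j + l = k) (a : RR m [⋀^Fin j]→L[ℝ] ℝ)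
    (b : RR m [⋀^Fin l]→L[ℝ] ℝ) : RR m [⋀^Fin k]→L[ℝ] ℝ :=
  { wedgeAlg h a b with
    cont := by
      change Continuous fun w => wedgeAlg h a b w
      simp only [wedgeAlg_apply]
      refine continuous_finsetSum _ fun c _ => continuous_const.mul (Continuous.mul ?_ ?_)
      · exact a.cont.comp (by fun_prop)
      · exact b.cont.comp (by fun_prop) }

theorem wedgeAlt_apply {m j l k : ℕ} (h : j + l = k) (a : RR m [⋀^Fin j]→L[ℝ] ℝ)
    (b : RR m [⋀^Fin l]→L[ℝ] ℝ) (w : Fin k → RR m) :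
    wedgeAlt h a b w = ∑ c : Equiv.Perm.ModSumCongr (Fin j) (Fin l),
      ((Equiv.Perm.sign c.out : ℤ) : ℝ) *
        (a (fun i => w (Fin.cast h (finSumFinEquiv (c.out (Sum.inl i))))) *
          b (fun i => w (Fin.cast h (finSumFinEquiv (c.out (Sum.inr i)))))) :=
  wedgeAlg_apply h a b w

/-- The wedge product of differential forms. -/
def wedge {j l k : ℕ} (h : j + l = k) (α : DForm X j) (β : DForm X l) : DForm X k where
  val p hp u := wedgeAlt h (α.val p hp u) (β.val p hp u)
  smooth p hp := by
    refine contDiff_alt fun w => ?_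
    simp only [wedgeAlt_apply]
    refine ContDiff.sum fun c _ => contDiff_const.mul (ContDiff.mul ?_ ?_)
    · exact (ContinuousAlternatingMap.apply ℝ (RR _) ℝ _).contDiff.comp (α.smooth p hp)
    · exact (ContinuousAlternatingMap.apply ℝ (RR _) ℝ _).contDiff.comp (β.smooth p hp)
  compat p hp g hg u := by
    ext w
    simp only [wedgeAlt_apply, α.compat p hp g hg u, β.compat p hp g hg u,
      ContinuousAlternatingMap.compContinuousLinearMap_apply]
    rfl

/-- A form is closed if its exterior derivative vanishes. -/
def IsClosed {k : ℕ} (α : DForm X k) : Prop :=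
  ∀ {m : ℕ} (p : RR m → X) (hp : IsPlot p) (u : RR m), α.d.val p hp u = 0

/-- A form `α` of degree `k > 0` is exact if `α = dη` for some form `η` of degree `k - 1`. -/
def IsExact {k : ℕ} (α : DForm X k) : Prop :=
  ∃ (j : ℕ) (h : j + 1 = k) (η : DForm X j), ∀ {m : ℕ} (p : RR m → X) (hp : IsPlot p) (u : RR m)
    (w : Fin k → RR m), α.val p hp u w = η.d.val p hp u (fun i => w (Fin.cast h i))

end DForm

/-! ### Orientation, integration and degree -/

section Integration

variable {M N : Type} [DiffeologicalSpace M] [DiffeologicalSpace N]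

/-- A (inverse) chart of `M`: a diffeomorphism from `ℝ^k` onto a D-open subset of `M`. -/
structure IsChart {k : ℕ} (φ : RR k → M) : Prop where
  isPlot : IsPlot φ
  injective : Function.Injective φ
  isOpen_range : IsOpen[dTopology] (Set.range φ)
  exists_lift : ∀ {m : ℕ} (p : RR m → M), IsPlot p → Set.range p ⊆ Set.range φ →
    ∃ g : RR m → RR k, ContDiff ℝ ∞ g ∧ p = φ ∘ g

/-- The coefficient of a form of degree `k` in a plot defined on `ℝ^k`. -/
def coeff {k : ℕ} (α : DForm M k) (φ : RR k → M) (hφ : IsPlot φ) (u : RR k) : ℝ :=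
  α.val φ hφ u fun i => EuclideanSpace.single i 1

/-- `τ` is a volume form on the `k`-dimensional manifold `M`: around every point there is a chart
in which `τ` vanishes nowhere. Such a form orients `M`. -/
def IsVolumeForm {k : ℕ} (τ : DForm M k) : Prop :=
  ∀ x : M, ∃ (φ : RR k → M) (hφ : IsChart φ), x ∈ Set.range φ ∧ ∀ u, coeff τ φ hφ.isPlot u ≠ 0

/-- The integral over the compact `k`-dimensional manifold `M`, oriented by the volume form `τ`, of
the `k`-form `α` is `I`: there are finitely many positively oriented charts `φ i` and a smooth
partition of unity `ρ`, with `ρ i` supported in a compact subset of the image of `φ i`, such that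
`I` is the sum of the integrals of `ρ i • α` computed in the charts. -/
def HasIntegral {k : ℕ} (τ α : DForm M k) (I : ℝ) : Prop :=
  ∃ (r : ℕ) (φ : Fin r → RR k → M) (hφ : ∀ i, IsChart (φ i)) (ρ : Fin r → M → ℝ),
    (∀ i u, 0 < coeff τ (φ i) (hφ i).isPlot u) ∧
    (∀ i, DSmooth (ρ i)) ∧
    (∀ i, ∃ K : Set (RR k), IsCompact K ∧ ∀ x, ρ i x ≠ 0 → x ∈ φ i '' K) ∧
    (∀ x, ∑ i, ρ i x = 1) ∧
    I = ∑ i, ∫ u, ρ i (φ i u) * coeff α (φ i) (hφ i).isPlot u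

/-- The smooth map `f : M → N` between compact `k`-dimensional manifolds oriented by `σ`
and `τ` has degree `e`: `∫_M f^*β = e ∫_N β` for all `k`-forms `β` on `N`. -/
def HasDegree {k : ℕ} (σ : DForm M k) (τ : DForm N k) (f : M → N) (hf : DSmooth f) (e : ℤ) :
    Prop :=
  ∀ (β : DForm N k) (I : ℝ), HasIntegral τ β I → HasIntegral σ (β.pullback f hf) (e * I)

end Integration

/-! ### Loop spaces -/

/-- Smooth loops `S¹ = ℝ/ℤ → X`, as smooth `1`-periodic maps. -/
@[ext] structure Loop (X : Type) [DiffeologicalSpace X] where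
  toFun : ℝ → X
  smooth : DSmooth toFun
  periodic : Function.Periodic toFun 1

section LoopSpace

variable {X : Type} [DiffeologicalSpace X]

/-- The map on the circle `ℝ/ℤ` given by a loop. -/
def Loop.onCircle (γ : Loop X) : UnitAddCircle → X := γ.periodic.lift

/-- The functional diffeology: `p` is a plot iff `(t, u) ↦ p u t` is smooth. -/
instance loopDiffeology : DiffeologicalSpace (Loop X) where
  plots m := {p | IsPlot fun z : RR (m + 1) => (p (tl z)).toFun (z 0)}
  constant_plots {m} γ := by
    have h : IsPlot fun z : RR (m + 1) => z 0 := ContDiff.isPlot (by fun_prop)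
    exact γ.smooth _ _ h
  plot_reparam {n m p f} hp hf := by
    have h : ContDiff ℝ ∞ fun z : RR (n + 1) => pt (z 0) (f (tl z)) :=
      contDiff_pt.comp ((hf.comp contDiff_tl).prodMk (by fun_prop))
    exact isPlot_reparam hp h
  locality {m p} h := by
    refine DiffeologicalSpace.locality fun z => ?_
    obtain ⟨u, hu, hz, h'⟩ := h (tl z)
    refine ⟨tl ⁻¹' u, hu.preimage contDiff_tl.continuous, hz, fun {l g} hg hg' => ?_⟩
    have h1 : IsPlot fun z : RR (l + 1) => (p (tl (g (tl z)))).toFun (z 0) := h' (f := fun y => tl (g y)) (fun y => hg y) (contDiff_tl.comp hg')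
    have h2 : ContDiff ℝ ∞ fun y : RR l => pt ((g y) 0) y :=
      contDiff_pt.comp (contDiff_id.prodMk (by fun_prop))
    have h3 : IsPlot ((fun z : RR (l + 1) => (p (tl (g (tl z)))).toFun (z 0)) ∘
        fun y : RR l => pt ((g y) 0) y) := isPlot_reparam h1 h2
    exact h3

/-- The smooth map `ℝ × ℝ^m → X`, `(t, u) ↦ p u t`, given by a plot `p` of the loop space. -/
def total {m : ℕ} (p : RR m → Loop X) (z : RR (m + 1)) : X := (p (tl z)).toFun (z 0)

theorem isPlot_total {m : ℕ} {p : RR m → Loop X} (hp : IsPlot p) : IsPlot (total p) := hp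

/-- The evaluation of loops at the initial point. -/
def ev0 (γ : Loop X) : X := γ.toFun 0

theorem dSmooth_ev0 : DSmooth (ev0 : Loop X → X) := fun m p hp => by
  have h2 : ContDiff ℝ ∞ fun y : RR m => pt 0 y :=
    contDiff_pt.comp (contDiff_id.prodMk contDiff_const)
  exact isPlot_reparam (isPlot_total hp) h2

/-- Contraction of an alternating form on `ℝ × ℝ^m` with the unit vector `∂_t` of the first factor
(inserted in the first slot), restricted to `ℝ^m`. -/
def contract {m j k : ℕ} (h : j + 1 = k) (a : RR (m + 1) [⋀^Fin k]→L[ℝ] ℝ) :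
    RR m [⋀^Fin j]→L[ℝ] ℝ :=
  ContinuousAlternatingMap.compContinuousLinearMap
    (ContinuousAlternatingMap.curryLeft (h ▸ a : RR (m + 1) [⋀^Fin (j + 1)]→L[ℝ] ℝ) (pt 1 0))
    (incl m)

theorem contract_apply {m j k : ℕ} (h : j + 1 = k) (a : RR (m + 1) [⋀^Fin k]→L[ℝ] ℝ)
    (w : Fin j → RR m) : contract h a w =
      a (fun i => (Fin.cons (pt 1 0) (fun i => pt 0 (w i)) : Fin (j + 1) → RR (m + 1))
        (Fin.cast h.symm i)) := by
  subst h
  rfl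

theorem contDiff_total {m j k : ℕ} (h : j + 1 = k) (v : DForm X k) (p : RR m → Loop X)
    (hp : IsPlot p) : ContDiff ℝ ∞ fun z : RR m × ℝ =>
      contract h (v.val (total p) (isPlot_total hp) (pt z.2 z.1)) := by
  refine contDiff_alt fun w => ?_
  simp only [contract_apply]
  exact (ContinuousAlternatingMap.apply ℝ (RR _) ℝ _).contDiff.comp
    ((v.smooth _ (isPlot_total hp)).comp contDiff_pt)

/-- The iterated integral `P₁(v) = ∫_{t ∈ [0,1]} Φ^* v`, where `Φ (t, γ) = γ t`: pull back to
`[0,1] × (loop space)` and integrate over the fibre `[0,1]`. -/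
def P1 {j k : ℕ} (h : j + 1 = k) (v : DForm X k) : DForm (Loop X) j where
  val p hp u := ∫ t in (0 : ℝ)..1, contract h (v.val (total p) (isPlot_total hp) (pt t u))
  smooth p hp := contDiff_infty.2 fun i => contDiff_integral_param i (contDiff_total h v p hp)
  compat {m l} p hp g hg u := by
    subst h
    have hG : ContDiff ℝ ∞ fun z : RR (l + 1) => pt (z 0) (g (tl z)) :=
      contDiff_pt.comp ((hg.comp contDiff_tl).prodMk (by fun_prop))
    have hint : IntervalIntegrable (fun t : ℝ =>
        contract rfl (v.val (total p) (isPlot_total hp) (pt t (g u)))) MeasureTheory.volume 0 1 :=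
      ((contDiff_total rfl v p hp).continuous.comp
        (by fun_prop : Continuous fun t : ℝ => (g u, t))).intervalIntegrable _ _
    change _ = (ContinuousAlternatingMap.compContinuousLinearMapCLM (fderiv ℝ g u)) _
    rw [← ContinuousLinearMap.intervalIntegral_comp_comm _ hint]
    refine intervalIntegral.integral_congr fun t _ => ?_
    have hc := v.compat (total p) (isPlot_total hp) _ hG (pt t u)
    have hD : ∀ s w, fderiv ℝ (fun z : RR (l + 1) => pt (z 0) (g (tl z))) (pt t u) (pt s w) =
        pt s (fderiv ℝ g u w) := by
      intro s w
      have h1 : HasFDerivAt (fun z : RR (l + 1) => pt (z 0) (g (tl z)))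
          (fderiv ℝ (fun z : RR (l + 1) => pt (z 0) (g (tl z))) (pt t u)) (pt t u) :=
        (hG.differentiable (by simp)).differentiableAt.hasFDerivAt
      have hline : HasDerivAt (fun r : ℝ => pt t u + r • pt s w) (pt s w) 0 := by
        simpa using ((hasDerivAt_id (0 : ℝ)).smul_const (pt s w)).const_add (pt t u)
      have h2 : HasDerivAt (fun r : ℝ => pt (t + r * s) (g (u + r • w)))
          (fderiv ℝ (fun z : RR (l + 1) => pt (z 0) (g (tl z))) (pt t u) (pt s w)) 0 := by
        have h3 := HasFDerivAt.comp_hasDerivAt_of_eq (0 : ℝ) h1 hline (by simp)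
        exact h3
      have hg1 : HasDerivAt (fun r : ℝ => g (u + r • w)) (fderiv ℝ g u w) 0 := by
        have hl : HasDerivAt (fun r : ℝ => u + r • w) w 0 := by
          simpa using ((hasDerivAt_id (0 : ℝ)).smul_const w).const_add u
        exact HasFDerivAt.comp_hasDerivAt_of_eq (0 : ℝ)
          (hg.differentiable (by simp)).differentiableAt.hasFDerivAt hl (by simp)
      ext i
      have hi := ((EuclideanSpace.proj (𝕜 := ℝ) i).hasFDerivAt.comp_hasDerivAt (0 : ℝ) h2)
      refine hi.unique ?_
      refine Fin.cases ?_ (fun i => ?_) i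
      · simpa [Function.comp_def] using ((hasDerivAt_id (0 : ℝ)).mul_const s).const_add t
      · exact (EuclideanSpace.proj (𝕜 := ℝ) i).hasFDerivAt.comp_hasDerivAt (0 : ℝ) hg1
    ext w
    refine (congrArg (fun a => contract rfl a w) hc).trans ?_
    simp only [contract_apply, ContinuousAlternatingMap.compContinuousLinearMap_apply,
      ContinuousAlternatingMap.compContinuousLinearMapCLM_apply]
    change v.val (total p) _ (pt t (g u)) _ = _
    congr 1
    funext i
    change fderiv ℝ (fun z : RR (l + 1) => pt (z 0) (g (tl z))) (pt t u)
      ((Fin.cons (pt 1 0) (fun i => pt 0 (w i)) : Fin (j + 1) → RR (l + 1)) i) =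
        (Fin.cons (pt 1 0) (fun i => pt 0 (fderiv ℝ g u (w i))) : Fin (j + 1) → RR (m + 1)) i
    refine Fin.cases ?_ (fun i => ?_) i
    · simpa using hD 1 0
    · exact hD 0 (w i)

end LoopSpace

/-! ### Immersions and imbeddings of the circle -/

/-- The unit sphere `S^(n-1)` of `ℝ^n`. -/
abbrev Sphere (n : ℕ) : Type := {x : RR n // ‖x‖ = 1}

/-- The space of smooth immersions `S¹ → ℝ^n`. -/
abbrev Imm (n : ℕ) : Type := {γ : Loop (RR n) // ∀ t : ℝ, deriv γ.toFun t ≠ 0}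

/-- The space of smooth imbeddings `S¹ → ℝ^n`: immersions that are topological embeddings. -/
abbrev Imb (n : ℕ) : Type := {γ : Imm n // Topology.IsEmbedding γ.1.onCircle}

/-- The inclusion of the imbeddings into the immersions. -/
def inclImb {n : ℕ} (γ : Imb n) : Imm n := γ.1

theorem dSmooth_inclImb {n : ℕ} : DSmooth (inclImb : Imb n → Imm n) := fun _ _ hp => hp

theorem dSmooth_subtype {X : Type} [DiffeologicalSpace X] {P : X → Prop} {Y : Type}
    [DiffeologicalSpace Y] {f : Y → Subtype P} (h : DSmooth fun y => (f y : X)) : DSmooth f :=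
  fun m p hp => h m p hp

/-- The normalized derivative `D : Imm(S¹, ℝ^n) → L S^(n-1)`. -/
def normDeriv {n : ℕ} (γ : Imm n) : Loop (Sphere n) where
  toFun t := ⟨‖deriv γ.1.toFun t‖⁻¹ • deriv γ.1.toFun t, by
    rw [norm_smul, norm_inv, norm_norm, inv_mul_cancel₀ (norm_ne_zero_iff.2 (γ.2 t))]⟩
  smooth := by
    have h : ContDiff ℝ ∞ (deriv γ.1.toFun) := by
      have := γ.1.smooth.contDiff
      exact (contDiff_infty_iff_deriv.1 this).2
    exact dSmooth_subtype (ContDiff.dSmooth ((h.norm ℝ γ.2).inv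
      (fun t => norm_ne_zero_iff.2 (γ.2 t)) |>.smul h))
  periodic t := by
    have h : deriv γ.1.toFun (t + 1) = deriv γ.1.toFun t := by
      rw [← deriv_comp_add_const]
      exact congrArg (fun f => deriv f t) (funext γ.1.periodic)
    simp only [h]

theorem dSmooth_normDeriv {n : ℕ} : DSmooth (normDeriv : Imm n → Loop (Sphere n)) := by
  intro m p hp
  have h0 : ContDiff ℝ ∞ (total fun u => (p u).1) := (isPlot_total hp).contDiff
  have h1 : ContDiff ℝ ∞ fun z : RR (m + 1) => deriv (p (tl z)).1.toFun (z 0) := by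
    have : (fun z : RR (m + 1) => deriv (p (tl z)).1.toFun (z 0)) =
        fun z => fderiv ℝ (total fun u => (p u).1) z (pt 1 0) := by
      funext z
      have h1 : HasFDerivAt (total fun u => (p u).1)
          (fderiv ℝ (total fun u => (p u).1) z) z :=
        (h0.differentiable (by simp)).differentiableAt.hasFDerivAt
      have hl : HasDerivAt (fun r : ℝ => pt r (tl z)) (pt 1 0) (z 0) := by
        have h2 : HasDerivAt (fun r : ℝ => pt 0 (tl z) + r • (pt 1 0 : RR (m + 1))) (pt 1 0)
            (z 0) := by
          simpa using ((hasDerivAt_id (z 0)).smul_const (pt 1 0)).const_add (pt 0 (tl z))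
        refine h2.congr_of_eventuallyEq (Filter.Eventually.of_forall fun r => ?_)
        ext i
        refine Fin.cases ?_ (fun i => ?_) i <;> simp
      exact (HasFDerivAt.comp_hasDerivAt_of_eq (z 0) h1 hl (by simp)).deriv
    rw [this]
    exact (h0.fderiv_right (by simp)).clm_apply contDiff_const
  have h2 : ∀ z : RR (m + 1), deriv (p (tl z)).1.toFun (z 0) ≠ 0 := fun z => (p (tl z)).2 _
  have h3 : ContDiff ℝ ∞ fun z : RR (m + 1) =>
      ‖deriv (p (tl z)).1.toFun (z 0)‖⁻¹ • deriv (p (tl z)).1.toFun (z 0) :=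
    ((h1.norm ℝ h2).inv fun z => norm_ne_zero_iff.2 (h2 z)).smul h1
  exact h3.isPlot

/-- The form `v P₁(v)` on the free loop space `L S^(n-1)`: the wedge product of `ev₀^* v` and
`P₁(v)`. -/
def vP1 {n : ℕ} (hn : 3 < n) (v : DForm (Sphere n) (n - 1)) :
    DForm (Loop (Sphere n)) (2 * n - 3) :=
  DForm.wedge (j := n - 1) (l := n - 2) (by omega) (v.pullback ev0 dSmooth_ev0)
    (P1 (by omega) v)

/-- The restriction of `D^*(v P₁(v))` to the space of imbeddings. -/
def imbForm {n : ℕ} (hn : 3 < n) (v : DForm (Sphere n) (n - 1)) : DForm (Imb n) (2 * n - 3) :=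
  ((vP1 hn v).pullback normDeriv dSmooth_normDeriv).pullback inclImb dSmooth_inclImb

/-! ### The Stiefel manifold -/

/-- The Stiefel manifold `V_{n,2}` of pairs of orthonormal vectors in `ℝ^n`. -/
abbrev Stiefel (n : ℕ) : Type :=
  {z : RR n × RR n // ‖z.1‖ = 1 ∧ ‖z.2‖ = 1 ∧ inner ℝ z.1 z.2 = 0}

/-- The imbedded circle `t ↦ (1 - cos t) x + sin t y` (with the angle `t` replaced by `2πt`). -/
def circleMap {n : ℕ} (z : Stiefel n) (t : ℝ) : RR n :=
  (1 - Real.cos (2 * Real.pi * t)) • z.1.1 + Real.sin (2 * Real.pi * t) • z.1.2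

theorem contDiff_circleMap {n : ℕ} (z : Stiefel n) : ContDiff ℝ ∞ (circleMap z) := by
  unfold circleMap
  fun_prop

theorem deriv_circleMap {n : ℕ} (z : Stiefel n) (t : ℝ) : deriv (circleMap z) t =
    (2 * Real.pi) • (Real.sin (2 * Real.pi * t) • z.1.1 + Real.cos (2 * Real.pi * t) • z.1.2) := by
  have hl : HasDerivAt (fun t : ℝ => 2 * Real.pi * t) (2 * Real.pi) t := by
    simpa using (hasDerivAt_id t).const_mul (2 * Real.pi)
  have h := ((hl.cos.const_sub 1).smul_const z.1.1).add (hl.sin.smul_const z.1.2)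
  refine h.deriv.trans ?_
  rw [smul_add, smul_smul, smul_smul]
  congr 2 <;> ring

theorem norm_frame {n : ℕ} (z : Stiefel n) {a b : ℝ} (h : a ^ 2 + b ^ 2 = 1) :
    ‖a • z.1.1 + b • z.1.2‖ = 1 := by
  have h0 : inner ℝ (a • z.1.1) (b • z.1.2) = 0 := by
    rw [inner_smul_left, inner_smul_right, z.2.2.2]
    simp
  have h1 := norm_add_sq_eq_norm_sq_add_norm_sq_of_inner_eq_zero _ _ h0
  rw [norm_smul, norm_smul, z.2.1, z.2.2.1, mul_one, mul_one, Real.norm_eq_abs, Real.norm_eq_abs,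
    abs_mul_abs_self, abs_mul_abs_self] at h1
  nlinarith [norm_nonneg (a • z.1.1 + b • z.1.2)]

/-- The loop `circleMap z`. -/
def circleLoop {n : ℕ} (z : Stiefel n) : Loop (RR n) where
  toFun := circleMap z
  smooth := (contDiff_circleMap z).dSmooth
  periodic t := by
    simp only [circleMap, mul_add, mul_one, Real.cos_add_two_pi, Real.sin_add_two_pi]

theorem isEmbedding_circleLoop {n : ℕ} (z : Stiefel n) : Topology.IsEmbedding (circleLoop z).onCircle := by
  have hc : Continuous (circleLoop z).onCircle :=
    (contDiff_circleMap z).continuous.quotient_lift _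
  refine (hc.isClosedEmbedding ?_).isEmbedding
  intro a b
  induction a using QuotientAddGroup.induction_on with | _ s
  induction b using QuotientAddGroup.induction_on with | _ t
  intro hst
  have hst' : circleMap z s = circleMap z t := hst
  have hx : ∀ r, inner ℝ z.1.1 (circleMap z r) = 1 - Real.cos (2 * Real.pi * r) := by
    intro r
    simp [circleMap, inner_add_right, inner_smul_right, z.2.1, z.2.2.2]
  have hy : ∀ r, inner ℝ z.1.2 (circleMap z r) = Real.sin (2 * Real.pi * r) := by
    intro r
    have h0 : inner ℝ z.1.2 z.1.1 = 0 := by rw [real_inner_comm]; exact z.2.2.2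
    simp [circleMap, inner_add_right, inner_smul_right, z.2.2.1, h0]
  have hcos : Real.cos (2 * Real.pi * s) = Real.cos (2 * Real.pi * t) := by
    have := (hx s).symm.trans ((congrArg _ hst').trans (hx t))
    linarith
  have hsin : Real.sin (2 * Real.pi * s) = Real.sin (2 * Real.pi * t) :=
    (hy s).symm.trans ((congrArg _ hst').trans (hy t))
  obtain ⟨k, hk⟩ := Real.Angle.angle_eq_iff_two_pi_dvd_sub.1
    (Real.Angle.cos_sin_inj hcos hsin)
  have hk' : s - t = k := by
    have : (2 * Real.pi) * (s - t) = (2 * Real.pi) * k := by linarith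
    exact mul_left_cancel₀ (by positivity) this
  refine (QuotientAddGroup.eq_iff_sub_mem).2 ?_
  rw [hk']
  exact AddSubgroup.mem_zmultiples_iff.2 ⟨k, by simp⟩

/-- The map `V_{n,2} → Imb(S¹, ℝ^n)` sending `(x, y)` to the circle
`t ↦ (1 - cos t) x + sin t y`. -/
def stiefelCycle {n : ℕ} (z : Stiefel n) : Imb n :=
  ⟨⟨circleLoop z, fun t => by
    change deriv (circleMap z) t ≠ 0
    rw [deriv_circleMap]
    refine smul_ne_zero (by positivity) (norm_ne_zero_iff.1 ?_)
    rw [norm_frame z (Real.sin_sq_add_cos_sq _)]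
    exact one_ne_zero⟩, isEmbedding_circleLoop z⟩

theorem dSmooth_stiefelCycle {n : ℕ} : DSmooth (stiefelCycle : Stiefel n → Imb n) := by
  intro m p hp
  have hp1 : ContDiff ℝ ∞ fun u => (p u).1.1 := IsPlot.contDiff hp.1
  have hp2 : ContDiff ℝ ∞ fun u => (p u).1.2 := IsPlot.contDiff hp.2
  have h1 : ContDiff ℝ ∞ fun z : RR (m + 1) => (p (tl z)).1.1 := hp1.comp contDiff_tl
  have h2 : ContDiff ℝ ∞ fun z : RR (m + 1) => (p (tl z)).1.2 := hp2.comp contDiff_tl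
  have h : ContDiff ℝ ∞ fun z : RR (m + 1) => circleMap (p (tl z)) (z 0) := by
    unfold circleMap
    have h3 : ContDiff ℝ ∞ fun z : RR (m + 1) => 1 - Real.cos (2 * Real.pi * z 0) := by fun_prop
    have h4 : ContDiff ℝ ∞ fun z : RR (m + 1) => Real.sin (2 * Real.pi * z 0) := by fun_prop
    exact (h3.smul h1).add (h4.smul h2)
  exact h.isPlot

/-- The form `dθ = x dy - y dx` on the unit circle in `ℝ²`. -/
def dTheta : DForm (Sphere 2) 1 where
  val p _ u := ContinuousAlternatingMap.ofSubsingleton ℝ _ ℝ 0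
    ((p u).1 0 • fderiv ℝ (fun u => (p u).1 1) u - (p u).1 1 • fderiv ℝ (fun u => (p u).1 0) u)
  smooth {m} p hp := by
    have h : ContDiff ℝ ∞ fun u => (p u).1 := IsPlot.contDiff hp
    have hi : ∀ i, ContDiff ℝ ∞ fun u => (p u).1 i := fun i => contDiff_euclidean.1 h i
    have h' : ∀ i, ContDiff ℝ ∞ (fderiv ℝ fun u => (p u).1 i) :=
      fun i => (hi i).fderiv_right (by simp)
    refine contDiff_alt fun w => ?_
    exact (((hi 0).smul (h' 1)).sub ((hi 1).smul (h' 0))).clm_apply contDiff_const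
  compat {m l} p hp g hg u := by
    have h : ContDiff ℝ ∞ fun u => (p u).1 := IsPlot.contDiff hp
    have h' : ∀ i, fderiv ℝ (fun u => (p (g u)).1 i) u =
        (fderiv ℝ (fun u => (p u).1 i) (g u)).comp (fderiv ℝ g u) := fun i =>
      fderiv_comp u (((contDiff_euclidean.1 h i).differentiable (by simp)).differentiableAt)
        (hg.differentiable (by simp)).differentiableAt
    ext w
    simp [h']

/-- The map `f : S¹ × V_{n,2} → S^(n-1) × S^(n-1)`,
`f(t, x, y) = (y, sin t x + cos t y)`, where `S¹` is the unit circle of points `(cos t, sin t)`. -/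
def gaussMap {n : ℕ} (z : Sphere 2 × Stiefel n) : Sphere n × Sphere n :=
  (⟨z.2.1.2, z.2.2.2.1⟩, ⟨(z.1.1 1) • z.2.1.1 + (z.1.1 0) • z.2.1.2, norm_frame z.2 (by
    have h := EuclideanSpace.real_norm_sq_eq z.1.1
    rw [z.1.2, Fin.sum_univ_two] at h
    linarith)⟩)

theorem dSmooth_gaussMap {n : ℕ} :
    DSmooth (gaussMap : Sphere 2 × Stiefel n → Sphere n × Sphere n) := by
  intro m p hp
  have h0 : ContDiff ℝ ∞ fun u => (p u).1.1 := IsPlot.contDiff hp.1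
  have h1 : ContDiff ℝ ∞ fun u => (p u).2.1.1 := IsPlot.contDiff hp.2.1
  have h2 : ContDiff ℝ ∞ fun u => (p u).2.1.2 := IsPlot.contDiff hp.2.2
  have h3 : ContDiff ℝ ∞ fun u => ((p u).1.1 1) • (p u).2.1.1 + ((p u).1.1 0) • (p u).2.1.2 :=
    ((contDiff_euclidean.1 h0 1).smul h1).add ((contDiff_euclidean.1 h0 0).smul h2)
  exact ⟨h2.isPlot, h3.isPlot⟩

theorem dSmooth_fst {X Y : Type} [DiffeologicalSpace X] [DiffeologicalSpace Y] :
    DSmooth (Prod.fst : X × Y → X) := fun _ _ hp => hp.1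

theorem dSmooth_snd {X Y : Type} [DiffeologicalSpace X] [DiffeologicalSpace Y] :
    DSmooth (Prod.snd : X × Y → Y) := fun _ _ hp => hp.2

/-- The product `pr₁^*τ ∧ pr₂^*τ` of a volume form with itself, orienting `S^(n-1) × S^(n-1)`. -/
def orientSpheres {n : ℕ} (hn : 3 < n) (τ : DForm (Sphere n) (n - 1)) :
    DForm (Sphere n × Sphere n) (2 * n - 2) :=
  DForm.wedge (by omega) (τ.pullback Prod.fst dSmooth_fst) (τ.pullback Prod.snd dSmooth_snd)

/-- The orientation `σ ∧ dθ` of `S¹ × V_{n,2}`, for a volume form `σ` on `V_{n,2}`. -/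
def orientCircleStiefel {n : ℕ} (hn : 3 < n) (σ : DForm (Stiefel n) (2 * n - 3)) :
    DForm (Sphere 2 × Stiefel n) (2 * n - 2) :=
  DForm.wedge (by omega) (σ.pullback Prod.snd dSmooth_snd) (dTheta.pullback Prod.fst dSmooth_fst)

end
end ImbCoh

open ImbCoh

/-!
The maps `Φ (t, γ) = γ t` and `ev₀` combine to `F (t, γ) = (γ 0, γ t)`, a map from the cylinder over
the loop space of the sphere to `S^(n-1) × S^(n-1)`. Contracting the shuffle formula for the wedge
product with `∂_t` shows that `v P₁(v)` is, up to the sign `(-1)^(n-1)`, the integral of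
`F^*(v × v)` over the fibre `[0,1]` (`val_wedge_P1`), where `v × v = pr₁^*v ∧ pr₂^*v`.

*Closedness.* `v × v` is a form of top degree, hence closed. The derivative of a fibre integral of a
closed form is the difference of the restrictions to both ends
(`extDeriv_integral_contract_eq_zero`), and these agree since `F (0, γ) = F (1, γ)` for a loop.

*The integral.* Along the cycle `c`, the map `F` becomes the map `f` of the cylinder over the
Stiefel manifold `V` (`endPair_circle`), so that by Fubini the integral of `c^*ω` over `V` is the
integral of `f^*(v × v)` over `S¹ × V` (`integral_circleForm`), which is `deg f` times
`(∫ v)² = 1` (`integral_sqForm`).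

*The degree.* The volume form `σ` on `V` is the contraction of `f^*(τ × τ)` with `-∂_t` at the
quarter turn, where `f` is an immersion. Away from the zeros of `sin` the map `f` is an immersion
(`injective_fderiv_gauss`), injective over each of the two open halves of the circle and onto up to
sets of smaller dimension (`gauss_injOn`, `thin_compl_gauss`). On the first half it preserves
orientations by connectedness. Passing from `t` to `t + 1/2` changes the second component of `f`
into its antipode; since `n` is even, the antipodal map is joined to the identity by a path of
linear isometries, so that the sign is the same on the second half (`sign_coeff_gauss_add_half`).
Both halves contribute the full integral, so the degree is `2` (`hasDegree_gaussMap`).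

*Non-exactness.* If `ω` were `dη`, then `c^*ω = d(c^*η)` would have integral `0` by the theorem of
Stokes (`OrientedPartition.integral_d_eq_zero`).

Integrals are defined by means of positively oriented charts and a partition of unity. The lemma
`OrientedPartition.integral_eq` computes them instead in any single plot that is injective on an
open set and covers the manifold up to a null set. Such plots come from stereographic projections;
the exceptional sets are covered by plots of smaller dimension (`Thin`) and hence are null.
-/

namespace ImbCoh
open MeasureTheory Set

noncomputable section

/-! ### Charts and changes of variables -/

section Charts

variable {M : Type} [DiffeologicalSpace M]

theorem IsChart.invFun_apply {k : ℕ} {φ : RR k → M} (hφ : IsChart φ) (u : RR k) :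
    Function.invFun φ (φ u) = u :=
  Function.leftInverse_invFun hφ.injective u

theorem IsChart.isOpen_preimage {k m : ℕ} {φ : RR k → M} (hφ : IsChart φ) {ψ : RR m → M}
    (hψ : IsPlot ψ) : IsOpen (ψ ⁻¹' range φ) :=
  isOpen_iff_preimages_plots.1 hφ.isOpen_range m ψ hψ

/-- Near a point that is mapped into the image of a chart `φ`, a plot factors smoothly through `φ`,
and forms in the plot are pull-backs along `φ⁻¹ ∘ ψ` of forms in the chart. -/
theorem IsChart.contDiffAt_and_val_eq {k m : ℕ} {φ : RR k → M} (hφ : IsChart φ) {ψ : RR m → M}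
    (hψ : IsPlot ψ) {u : RR m} (hu : ψ u ∈ range φ) :
    ContDiffAt ℝ ∞ (Function.invFun φ ∘ ψ) u ∧ ∀ {j : ℕ} (α : DForm M j), α.val ψ hψ u =
      (α.val φ hφ.isPlot (Function.invFun φ (ψ u))).compContinuousLinearMap
        (fderiv ℝ (Function.invFun φ ∘ ψ) u) := by
  -- plots are defined on all of `ℝ^m`, so a ball around `u` is reparametrised by `ℝ^m`
  obtain ⟨r, hr, hball⟩ := Metric.isOpen_iff.1 (hφ.isOpen_preimage hψ) u hu
  set b := OpenPartialHomeomorph.univBall u r with hb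
  have hbs : ContDiff ℝ ∞ b := OpenPartialHomeomorph.contDiff_univBall
  have htarget : b.target = Metric.ball u r := OpenPartialHomeomorph.univBall_target u hr
  have hsource : b.source = univ := OpenPartialHomeomorph.univBall_source u r
  have hmem : ∀ y, b y ∈ Metric.ball u r := fun y => by
    rw [← htarget]
    exact b.map_source (by rw [hsource]; trivial)
  obtain ⟨g, hg, hgφ⟩ := hφ.exists_lift (ψ ∘ b) (isPlot_reparam hψ hbs) (by
    rintro _ ⟨y, rfl⟩
    exact hball (hmem y))
  have hnhds : Metric.ball u r ∈ 𝓝 u := Metric.ball_mem_nhds u hr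
  have hright : ∀ y ∈ Metric.ball u r, b (b.symm y) = y := fun y hy =>
    b.right_inv (by rwa [htarget])
  have heq : Function.invFun φ ∘ ψ =ᶠ[𝓝 u] g ∘ b.symm := by
    filter_upwards [hnhds] with y hy
    have h1 : ψ y = φ (g (b.symm y)) := by
      rw [← Function.comp_apply (f := φ), ← hgφ, Function.comp_apply, hright y hy]
    simp only [Function.comp_apply, h1, hφ.invFun_apply]
  have hsymm : ContDiffAt ℝ ∞ b.symm u :=
    (OpenPartialHomeomorph.contDiffOn_univBall_symm (c := u) (r := r)).contDiffAt hnhds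
  have hu0 : b (b.symm u) = u := hright u (Metric.mem_ball_self hr)
  refine ⟨((hg.contDiffAt.comp u hsymm).congr_of_eventuallyEq heq), fun {j} α => ?_⟩
  have hsd : DifferentiableAt ℝ b.symm u := hsymm.differentiableAt (by simp)
  have hbd : DifferentiableAt ℝ b (b.symm u) := (hbs.differentiable (by simp)).differentiableAt
  have hgd : DifferentiableAt ℝ g (b.symm u) := (hg.differentiable (by simp)).differentiableAt
  have hid : (fderiv ℝ b (b.symm u)).comp (fderiv ℝ b.symm u) = ContinuousLinearMap.id ℝ _ := by
    rw [← fderiv_comp u hbd hsd]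
    have : b ∘ b.symm =ᶠ[𝓝 u] id := by
      filter_upwards [hnhds] with y hy using hright y hy
    rw [this.fderiv_eq, fderiv_id]
  have hval : ∀ (p q : RR m → M) (hp : IsPlot p) (hq : IsPlot q), p = q →
      α.val p hp = α.val q hq := by
    rintro p q hp hq rfl
    rfl
  have h1 := α.compat ψ hψ b hbs (b.symm u)
  have h2 := α.compat φ hφ.isPlot g hg (b.symm u)
  rw [hval _ _ _ (isPlot_reparam hφ.isPlot hg) hgφ, h2, hu0] at h1
  have hgu : Function.invFun φ (ψ u) = g (b.symm u) := heq.eq_of_nhds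
  rw [heq.fderiv_eq, hgu, fderiv_comp u hgd hsd]
  have h3 := congrArg (fun A : RR m [⋀^Fin j]→L[ℝ] ℝ =>
    A.compContinuousLinearMap (fderiv ℝ b.symm u)) h1
  ext w
  have h4 := congrArg (fun A : RR m [⋀^Fin j]→L[ℝ] ℝ => A w) h3
  simp only [ContinuousAlternatingMap.compContinuousLinearMap_apply] at h4 ⊢
  have h5 : ∀ x, fderiv ℝ b (b.symm u) (fderiv ℝ b.symm u x) = x := fun x =>
    congrArg (fun A : RR m →L[ℝ] RR m => A x) hid
  simp only [Function.comp_def, h5] at h4 ⊢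
  exact h4.symm

/-- A form of top degree is multiplied by the determinant under a linear substitution. -/
theorem alternating_comp_top {k : ℕ} (A : RR k [⋀^Fin k]→L[ℝ] ℝ) (T : RR k →L[ℝ] RR k) :
    A (fun i => T (EuclideanSpace.single i 1)) =
      T.det * A (fun i => EuclideanSpace.single i 1) := by
  have h := A.toAlternatingMap.eq_smul_basis_det (EuclideanSpace.basisFun (Fin k) ℝ).toBasis
  have hA : ∀ w, A w = A.toAlternatingMap w := fun w => rfl
  rw [hA, hA, h]
  have h1 := Module.Basis.det_comp (EuclideanSpace.basisFun (Fin k) ℝ).toBasis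
    (T : RR k →ₗ[ℝ] RR k) (fun i => EuclideanSpace.single i 1)
  have h2 : (T : RR k →ₗ[ℝ] RR k) ∘ (fun i => EuclideanSpace.single i (1 : ℝ)) =
    fun i => T (EuclideanSpace.single i 1) := rfl
  rw [h2] at h1
  simp only [AlternatingMap.smul_apply, smul_eq_mul, h1]
  rw [ContinuousLinearMap.det]
  ring

theorem IsChart.coeff_eq {k : ℕ} {φ : RR k → M} (hφ : IsChart φ) {ψ : RR k → M}
    (hψ : IsPlot ψ) {u : RR k} (hu : ψ u ∈ range φ) (α : DForm M k) :
    coeff α ψ hψ u = (fderiv ℝ (Function.invFun φ ∘ ψ) u).det *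
      coeff α φ hφ.isPlot (Function.invFun φ (ψ u)) := by
  rw [coeff, (hφ.contDiffAt_and_val_eq hψ hu).2 α]
  exact alternating_comp_top _ _

theorem contDiff_coeff {k : ℕ} (α : DForm M k) (φ : RR k → M) (hφ : IsPlot φ) :
    ContDiff ℝ ∞ (coeff α φ hφ) :=
  (ContinuousAlternatingMap.apply ℝ (RR k) ℝ fun i => EuclideanSpace.single i 1).contDiff.comp
    (α.smooth φ hφ)

/-- Positively oriented charts together with a smooth partition of unity subordinate to them: the
data in terms of which `HasIntegral` computes an integral. -/
structure OrientedPartition {k : ℕ} (τ : DForm M k) where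
  r : ℕ
  φ : Fin r → RR k → M
  isChart : ∀ i, IsChart (φ i)
  ρ : Fin r → M → ℝ
  pos : ∀ i u, 0 < coeff τ (φ i) (isChart i).isPlot u
  smooth : ∀ i, DSmooth (ρ i)
  supp : ∀ i, ∃ K : Set (RR k), IsCompact K ∧ ∀ x, ρ i x ≠ 0 → x ∈ φ i '' K
  sum_eq_one : ∀ x, ∑ i, ρ i x = 1

/-- The integral computed with a given oriented partition. -/
def OrientedPartition.integral {k : ℕ} {τ : DForm M k} (P : OrientedPartition τ) (α : DForm M k) :
    ℝ :=
  ∑ i, ∫ u, P.ρ i (P.φ i u) * coeff α (P.φ i) (P.isChart i).isPlot u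

theorem hasIntegral_iff {k : ℕ} {τ α : DForm M k} {I : ℝ} :
    HasIntegral τ α I ↔ ∃ P : OrientedPartition τ, I = P.integral α := by
  constructor
  · rintro ⟨r, φ, hφ, ρ, h1, h2, h3, h4, h5⟩
    exact ⟨⟨r, φ, hφ, ρ, h1, h2, h3, h4⟩, h5⟩
  · rintro ⟨P, h⟩
    exact ⟨P.r, P.φ, P.isChart, P.ρ, P.pos, P.smooth, P.supp, P.sum_eq_one, h⟩

theorem OrientedPartition.integrable {k : ℕ} {τ : DForm M k} (P : OrientedPartition τ)
    (α : DForm M k) (i : Fin P.r) :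
    Integrable fun u => P.ρ i (P.φ i u) * coeff α (P.φ i) (P.isChart i).isPlot u := by
  obtain ⟨K, hK, hsupp⟩ := P.supp i
  refine Continuous.integrable_of_hasCompactSupport ?_ (HasCompactSupport.intro hK fun u hu => ?_)
  · have h : ContDiff ℝ ∞ fun u => P.ρ i (P.φ i u) :=
      IsPlot.contDiff ((P.isChart i).isPlot.dSmooth_comp (P.smooth i))
    exact h.continuous.mul (contDiff_coeff α _ _).continuous
  · by_contra hne
    obtain ⟨u', hu', h⟩ := hsupp _ (left_ne_zero_of_mul hne)
    exact hu ((P.isChart i).injective h ▸ hu')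

/-- The integral over `M` of a form `α` can be computed with any plot `ψ` of full dimension that is
injective on an open set `s` whose image contains the support of `α` up to a null set; no
orientation of `ψ` is needed, as the sign is corrected by the volume form. -/
theorem OrientedPartition.integral_eq {k : ℕ} {τ : DForm M k} (P : OrientedPartition τ)
    (α : DForm M k) {s : Set (RR k)} (hs : IsOpen s) {ψ : RR k → M} (hψ : IsPlot ψ)
    (hinj : InjOn ψ s)
    (hnull : ∀ i, ∀ᵐ u, P.φ i u ∉ ψ '' s → coeff α (P.φ i) (P.isChart i).isPlot u = 0) :
    IntegrableOn (fun u => (SignType.sign (coeff τ ψ hψ u) : ℝ) * coeff α ψ hψ u) s ∧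
      P.integral α = ∫ u in s, (SignType.sign (coeff τ ψ hψ u) : ℝ) * coeff α ψ hψ u := by
  set F : RR k → ℝ := fun u => (SignType.sign (coeff τ ψ hψ u) : ℝ) * coeff α ψ hψ u with hF
  have key : ∀ i, IntegrableOn (fun u => P.ρ i (ψ u) * F u) s ∧
      ∫ u, P.ρ i (P.φ i u) * coeff α (P.φ i) (P.isChart i).isPlot u =
        ∫ u in s, P.ρ i (ψ u) * F u := by
    intro i
    set φ := P.φ i with hφdef
    have hφ : IsChart φ := P.isChart i
    -- on `t`, the two parametrisations are related by the transition map `g = φ⁻¹ ∘ ψ`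
    set t := s ∩ ψ ⁻¹' range φ with ht
    have hto : IsOpen t := hs.inter (hφ.isOpen_preimage hψ)
    set g := Function.invFun φ ∘ ψ with hg
    have hφg : ∀ u ∈ t, φ (g u) = ψ u := by
      rintro u ⟨-, v, hv⟩
      rw [hg, Function.comp_apply, ← hv, hφ.invFun_apply]
    have hderiv : ∀ u ∈ t, HasFDerivWithinAt g (fderiv ℝ g u) t u := fun u hu =>
      (((hφ.contDiffAt_and_val_eq hψ hu.2).1).differentiableAt
        (by simp)).hasFDerivAt.hasFDerivWithinAt
    have hginj : InjOn g t := fun u hu v hv h =>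
      hinj hu.1 hv.1 (by rw [← hφg u hu, ← hφg v hv, h])
    have himage : g '' t = φ ⁻¹' (ψ '' s) := by
      ext v
      constructor
      · rintro ⟨u, hu, rfl⟩
        exact ⟨u, hu.1, (hφg u hu).symm⟩
      · rintro ⟨u, hu, huv⟩
        refine ⟨u, ⟨hu, ⟨v, huv.symm⟩⟩, ?_⟩
        rw [hg, Function.comp_apply, huv, hφ.invFun_apply]
    have hpt : ∀ u ∈ t, |(fderiv ℝ g u).det| • (P.ρ i (φ (g u)) * coeff α φ hφ.isPlot (g u)) =
        P.ρ i (ψ u) * F u := by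
      intro u hu
      have h1 := hφ.coeff_eq hψ hu.2 α
      have h2 := hφ.coeff_eq hψ hu.2 τ
      -- `φ` is positively oriented, so the sign of `τ` in `ψ` is that of the Jacobian
      have h3 : SignType.sign (coeff τ ψ hψ u) = SignType.sign (fderiv ℝ g u).det := by
        rw [h2, sign_mul, sign_pos (P.pos i _), mul_one]
      rw [hφg u hu, hF]
      simp only [h3, h1, smul_eq_mul]
      rw [← sign_mul_self (fderiv ℝ g u).det]
      simp only [hg, Function.comp_apply]
      ring
    have hzero : ∀ u ∈ s \ t, P.ρ i (ψ u) * F u = 0 := by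
      rintro u ⟨hus, hut⟩
      obtain ⟨K, -, hK⟩ := P.supp i
      have : P.ρ i (ψ u) = 0 := by
        by_contra hne
        exact hut ⟨hus, image_subset_range _ _ (hK _ hne)⟩
      rw [this, zero_mul]
    have hint := P.integrable α i
    have hint1 : IntegrableOn (fun u => P.ρ i (ψ u) * F u) t := by
      have := (integrableOn_image_iff_integrableOn_abs_det_fderiv_smul volume hto.measurableSet
        hderiv hginj (fun v => P.ρ i (φ v) * coeff α φ hφ.isPlot v)).1 hint.integrableOn
      exact this.congr_fun hpt hto.measurableSet
    refine ⟨(hint1.of_forall_sdiff_eq_zero hs.measurableSet hzero), ?_⟩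
    rw [setIntegral_eq_of_subset_of_forall_sdiff_eq_zero hs.measurableSet inter_subset_left hzero,
      ← setIntegral_congr_fun hto.measurableSet hpt,
      ← integral_image_eq_integral_abs_det_fderiv_smul volume hto.measurableSet hderiv hginj
        (fun v => P.ρ i (φ v) * coeff α φ hφ.isPlot v), himage]
    refine (setIntegral_eq_integral_of_ae_compl_eq_zero ?_).symm
    filter_upwards [hnull i] with u hu hu'
    rw [hu hu', mul_zero]
  have hsum : ∀ u, ∑ i, P.ρ i (ψ u) * F u = F u := fun u => by
    rw [← Finset.sum_mul, P.sum_eq_one, one_mul]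
  have hint : IntegrableOn (fun u => ∑ i, P.ρ i (ψ u) * F u) s :=
    integrable_finsetSum _ fun i _ => (key i).1
  refine ⟨by simpa only [hsum] using hint, ?_⟩
  rw [OrientedPartition.integral, Finset.sum_congr rfl fun i _ => (key i).2,
    ← integral_finsetSum _ fun i _ => (key i).1]
  simp only [hsum]

end Charts

/-! ### Existence of oriented partitions -/

section Existence

variable {M N : Type} [DiffeologicalSpace M] [DiffeologicalSpace N]

/-- Plots are continuous for some Hausdorff topology on `M`. This is all that is needed for
functions with compact support in a chart to remain smooth when extended by zero. -/
def PlotSeparated (M : Type) [DiffeologicalSpace M] : Prop :=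
  ∃ (E : Type) (_ : TopologicalSpace E) (_ : T2Space E) (e : M → E), Function.Injective e ∧
    ∀ (m : ℕ) (p : RR m → M), IsPlot p → Continuous (e ∘ p)

theorem PlotSeparated.prod (hM : PlotSeparated M) (hN : PlotSeparated N) :
    PlotSeparated (M × N) := by
  obtain ⟨E, _, _, e, he, hc⟩ := hM
  obtain ⟨E', _, _, e', he', hc'⟩ := hN
  exact ⟨E × E', inferInstance, inferInstance, Prod.map e e', he.prodMap he', fun m p hp =>
    (hc m _ hp.1).prodMk (hc' m _ hp.2)⟩

theorem PlotSeparated.isClosed_preimage_image (hM : PlotSeparated M) {k m : ℕ} {φ : RR k → M}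
    (hφ : IsPlot φ) {K : Set (RR k)} (hK : IsCompact K) {p : RR m → M} (hp : IsPlot p) :
    IsClosed (p ⁻¹' (φ '' K)) := by
  obtain ⟨E, _, _, e, he, hc⟩ := hM
  have h : p ⁻¹' (φ '' K) = (e ∘ p) ⁻¹' ((e ∘ φ) '' K) := by
    ext u
    simp only [mem_preimage, mem_image, Function.comp_apply, he.eq_iff]
  rw [h]
  exact ((hK.image (hc k φ hφ)).isClosed).preimage (hc m p hp)

/-- `M` is the union of the images of a compact set under finitely many plots: the form in which
compactness of `M` is used. -/
def CompactlyCovered (M : Type) [DiffeologicalSpace M] : Prop :=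
  ∃ (l : ℕ) (Q : Set (RR l → M)) (K : Set (RR l)), Q.Finite ∧ IsCompact K ∧ (∀ q ∈ Q, IsPlot q) ∧
    ∀ x, ∃ q ∈ Q, ∃ u ∈ K, q u = x

/-- Finitely many of the sets on which given smooth functions are positive cover `M`. -/
theorem CompactlyCovered.exists_finset (hM : CompactlyCovered M) (f : M → M → ℝ)
    (hf : ∀ x, DSmooth (f x)) (hpos : ∀ x, 0 < f x x) :
    ∃ T : Finset M, ∀ y, ∃ x ∈ T, 0 < f x y := by
  classical
  obtain ⟨l, Q, K, hQ, hK, hplot, hcov⟩ := hM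
  have h : ∀ q : RR l → M, ∃ T : Finset M, q ∈ Q → ∀ u ∈ K, ∃ x ∈ T, 0 < f x (q u) := by
    intro q
    by_cases hq : q ∈ Q
    · have hc : ∀ x, Continuous fun u => f x (q u) := fun x =>
        (IsPlot.contDiff ((hplot q hq).dSmooth_comp (hf x))).continuous
      obtain ⟨T, hT⟩ := hK.elim_finite_subcover (fun x => {u | 0 < f x (q u)})
        (fun x => isOpen_lt continuous_const (hc x))
        (fun u _ => mem_iUnion.2 ⟨q u, hpos _⟩)
      refine ⟨T, fun _ u hu => ?_⟩
      simpa using hT hu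
    · exact ⟨∅, fun h => absurd h hq⟩
  choose T hT using h
  refine ⟨hQ.toFinset.biUnion T, fun y => ?_⟩
  obtain ⟨q, hq, u, hu, rfl⟩ := hcov y
  obtain ⟨x, hx, hpos⟩ := hT q hq u hu
  exact ⟨x, Finset.mem_biUnion.2 ⟨q, hQ.mem_toFinset.2 hq, hx⟩, hpos⟩

open Classical in
/-- A bump function in a chart, extended by zero. -/
def chartBump {M : Type} {k : ℕ} (φ : RR k → M) {c : RR k} (b : ContDiffBump c) (x : M) : ℝ :=
  if x ∈ range φ then b (Function.invFun φ x) else 0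

theorem chartBump_nonneg {M : Type} {k : ℕ} (φ : RR k → M) {c : RR k} (b : ContDiffBump c) (x : M) :
    0 ≤ chartBump φ b x := by
  unfold chartBump
  split_ifs
  · exact b.nonneg
  · exact le_rfl

theorem IsChart.mem_of_chartBump_ne_zero {k : ℕ} {φ : RR k → M} (hφ : IsChart φ) {c : RR k}
    (b : ContDiffBump c) {x : M} (hx : chartBump φ b x ≠ 0) : x ∈ φ '' tsupport b := by
  unfold chartBump at hx
  split_ifs at hx with h
  · obtain ⟨u, rfl⟩ := h
    rw [hφ.invFun_apply] at hx
    exact ⟨u, subset_tsupport _ hx, rfl⟩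
  · exact absurd rfl hx

theorem IsChart.chartBump_center_pos {k : ℕ} {φ : RR k → M} (hφ : IsChart φ) {c : RR k}
    (b : ContDiffBump c) : 0 < chartBump φ b (φ c) := by
  rw [chartBump, if_pos ⟨c, rfl⟩, hφ.invFun_apply]
  exact b.pos_of_mem_ball (Metric.mem_ball_self b.rOut_pos)

theorem IsChart.dSmooth_chartBump (hM : PlotSeparated M) {k : ℕ} {φ : RR k → M} (hφ : IsChart φ)
    {c : RR k} (b : ContDiffBump c) : DSmooth (chartBump φ b) := by
  intro m p hp
  refine ContDiff.isPlot (contDiff_iff_contDiffAt.2 fun u => ?_)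
  by_cases hu : p u ∈ range φ
  · have h : chartBump φ b ∘ p =ᶠ[𝓝 u] b ∘ (Function.invFun φ ∘ p) := by
      filter_upwards [(hφ.isOpen_preimage hp).mem_nhds hu] with y hy
      simp only [Function.comp_apply, chartBump]
      rw [if_pos (show p y ∈ range φ from hy)]
    exact (b.contDiff.contDiffAt.comp u (hφ.contDiffAt_and_val_eq hp hu).1).congr_of_eventuallyEq h
  · have hcl := hM.isClosed_preimage_image hφ.isPlot b.hasCompactSupport.isCompact hp
    have hmem : (p ⁻¹' (φ '' tsupport b))ᶜ ∈ 𝓝 u :=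
      hcl.isOpen_compl.mem_nhds fun h => hu (image_subset_range _ _ h)
    have h : chartBump φ b ∘ p =ᶠ[𝓝 u] fun _ => 0 := by
      filter_upwards [hmem] with y hy
      by_contra hne
      exact hy (hφ.mem_of_chartBump_ne_zero b hne)
    exact contDiffAt_const.congr_of_eventuallyEq h

theorem IsChart.comp_equiv {k : ℕ} {φ : RR k → M} (hφ : IsChart φ) {l : ℕ}
    (T : RR l ≃L[ℝ] RR k) : IsChart (φ ∘ T) where
  isPlot := isPlot_reparam hφ.isPlot T.contDiff
  injective := hφ.injective.comp T.injective
  isOpen_range := by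
    rw [T.surjective.range_comp]
    exact hφ.isOpen_range
  exists_lift p hp hr := by
    rw [T.surjective.range_comp] at hr
    obtain ⟨g, hg, rfl⟩ := hφ.exists_lift p hp hr
    refine ⟨T.symm ∘ g, T.symm.contDiff.comp hg, ?_⟩
    funext u
    simp

/-- The reflection of `ℝ^(k+1)` in the first coordinate. -/
def reflectZero (k : ℕ) : RR (k + 1) ≃L[ℝ] RR (k + 1) :=
  LinearEquiv.toContinuousLinearEquiv
    { toFun := fun u => pt (-u 0) (tl u)
      invFun := fun u => pt (-u 0) (tl u)
      map_add' := fun x y => by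
        ext i
        refine Fin.cases ?_ (fun i => ?_) i
        · simp [add_comm]
        · simp [tl]
      map_smul' := fun c x => by
        ext i
        refine Fin.cases ?_ (fun i => ?_) i <;> simp [tl]
      left_inv := fun x => by simp
      right_inv := fun x => by simp }

theorem coeff_comp_reflectZero {k : ℕ} (α : DForm M (k + 1)) {φ : RR (k + 1) → M} (hφ : IsPlot φ)
    (u : RR (k + 1)) : coeff α (φ ∘ reflectZero k) (isPlot_reparam hφ (reflectZero k).contDiff) u =
      -coeff α φ hφ (reflectZero k u) := by
  rw [coeff, α.compat φ hφ _ (reflectZero k).contDiff, (reflectZero k).fderiv, coeff]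
  rw [ContinuousAlternatingMap.compContinuousLinearMap_apply]
  have h : (fun i => reflectZero k (EuclideanSpace.single i 1)) =
      Function.update (fun i => EuclideanSpace.single i (1 : ℝ)) 0
        (-EuclideanSpace.single 0 1) := by
    funext i
    change pt _ _ = _
    refine Fin.cases ?_ (fun i => ?_) i
    · ext j
      refine Fin.cases ?_ (fun j => ?_) j <;> simp [tl]
    · ext j
      refine Fin.cases ?_ (fun j => ?_) j <;> simp [tl]
  have h2 := (α.val φ hφ (reflectZero k u)).toAlternatingMap.map_update_neg
    (fun i => EuclideanSpace.single i (1 : ℝ)) 0 (EuclideanSpace.single 0 1)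
  rw [Function.update_eq_self] at h2
  refine Eq.trans ?_ h2
  exact congrArg (α.val φ hφ (reflectZero k u)) h

theorem forall_pos_or_forall_neg {k : ℕ} {f : RR k → ℝ} (hf : Continuous f) (h : ∀ u, f u ≠ 0) :
    (∀ u, 0 < f u) ∨ ∀ u, f u < 0 := by
  by_contra hcon
  push Not at hcon
  obtain ⟨⟨a, ha⟩, b, hb⟩ := hcon
  obtain ⟨c, -, hc⟩ := (isPreconnected_univ (α := RR k)).intermediate_value (mem_univ a)
    (mem_univ b) hf.continuousOn ⟨ha, hb⟩
  exact h c hc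

/-- A manifold oriented by a volume form has positively oriented charts around every point. -/
theorem IsVolumeForm.exists_pos_chart {k : ℕ} {τ : DForm M (k + 1)} (hτ : IsVolumeForm τ) (x : M) :
    ∃ (φ : RR (k + 1) → M) (hφ : IsChart φ), x ∈ range φ ∧ ∀ u, 0 < coeff τ φ hφ.isPlot u := by
  obtain ⟨φ, hφ, hx, hne⟩ := hτ x
  rcases forall_pos_or_forall_neg (contDiff_coeff τ φ hφ.isPlot).continuous hne with h | h
  · exact ⟨φ, hφ, hx, h⟩
  · refine ⟨φ ∘ reflectZero k, hφ.comp_equiv _, ?_, fun u => ?_⟩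
    · rwa [(reflectZero k).surjective.range_comp]
    · rw [coeff_comp_reflectZero _ hφ.isPlot]
      exact neg_pos.2 (h _)

theorem DSmooth.isPlot_comp_real {f : M → ℝ} (hf : DSmooth f) {m : ℕ} {p : RR m → M}
    (hp : IsPlot p) : ContDiff ℝ ∞ fun u => f (p u) :=
  IsPlot.contDiff (hp.dSmooth_comp hf)

/-- A compact manifold oriented by a volume form has an oriented partition, obtained by normalising
finitely many bump functions. -/
theorem IsVolumeForm.exists_orientedPartition {k : ℕ} {τ : DForm M (k + 1)} (hτ : IsVolumeForm τ)
    (hM : PlotSeparated M) (hc : CompactlyCovered M) : Nonempty (OrientedPartition τ) := by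
  choose φ hφ hx hpos using hτ.exists_pos_chart
  choose c hcx using hx
  let b : ∀ x, ContDiffBump (c x) := fun x => ⟨1, 2, one_pos, one_lt_two⟩
  let f : M → M → ℝ := fun x => chartBump (φ x) (b x)
  have hf : ∀ x, DSmooth (f x) := fun x => (hφ x).dSmooth_chartBump hM (b x)
  have hf0 : ∀ x y, 0 ≤ f x y := fun x y => chartBump_nonneg _ _ _
  obtain ⟨T, hT⟩ := hc.exists_finset f hf fun x => by
    have := (hφ x).chartBump_center_pos (b x)
    rwa [hcx] at this
  let S : M → ℝ := fun y => ∑ i : Fin T.card, f (T.equivFin.symm i) y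
  have hS : ∀ y, 0 < S y := by
    intro y
    obtain ⟨x, hxT, hxy⟩ := hT y
    refine Finset.sum_pos' (fun i _ => hf0 _ _) ⟨T.equivFin ⟨x, hxT⟩, Finset.mem_univ _, ?_⟩
    simpa using hxy
  have hSs : ∀ {m : ℕ} {p : RR m → M}, IsPlot p → ContDiff ℝ ∞ fun u => S (p u) := fun hp =>
    ContDiff.sum fun i _ => DSmooth.isPlot_comp_real (hf _) hp
  refine ⟨⟨T.card, fun i => φ (T.equivFin.symm i), fun i => hφ _,
    fun i y => f (T.equivFin.symm i) y / S y, fun i => hpos _, fun i m p hp => ?_, fun i => ?_,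
    fun y => ?_⟩⟩
  · exact ((DSmooth.isPlot_comp_real (hf _) hp).div (hSs hp) fun u => (hS _).ne').isPlot
  · refine ⟨_, (b (T.equivFin.symm i)).hasCompactSupport.isCompact, fun y hy => ?_⟩
    exact (hφ _).mem_of_chartBump_ne_zero _ (left_ne_zero_of_mul hy)
  · rw [← Finset.sum_div]
    exact div_self (hS y).ne'

/-- Forms of degree equal to the dimension are closed. -/
theorem DForm.isClosed_of_top {k : ℕ} (h : ∀ x : M, ∃ φ : RR k → M, IsChart φ ∧ x ∈ range φ)
    (α : DForm M k) : α.IsClosed := by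
  intro m p hp u
  obtain ⟨φ, hφ, hx⟩ := h (p u)
  rw [(hφ.contDiffAt_and_val_eq hp hx).2 α.d]
  ext w
  rw [ContinuousAlternatingMap.compContinuousLinearMap_apply]
  refine AlternatingMap.map_linearDependent
    (α.d.val φ hφ.isPlot (Function.invFun φ (p u))).toAlternatingMap _ fun hli => ?_
  have := hli.fintype_card_le_finrank
  simp at this

end Existence

/-! ### Stokes' theorem on closed manifolds -/

section Stokes

variable {M : Type} [DiffeologicalSpace M]

theorem integral_fderiv_eq_zero {k : ℕ} {f : RR k → ℝ} (hf : ContDiff ℝ ∞ f)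
    (hc : HasCompactSupport f) (w : RR k) : ∫ u, fderiv ℝ f u w = 0 := by
  have hint : Integrable fun u => fderiv ℝ f u w := by
    refine Continuous.integrable_of_hasCompactSupport ?_ (hc.fderiv_apply ℝ w)
    exact ((hf.fderiv_right (m := ∞) (by simp)).clm_apply contDiff_const).continuous
  have h := integral_mul_fderiv_eq_neg_fderiv_mul_of_integrable (μ := volume)
    (f := fun _ : RR k => (1 : ℝ)) (g := f) (v := w) (by simp) (by simpa using hint)
    (by simpa using hf.continuous.integrable_of_hasCompactSupport hc)
    (fun _ _ => differentiableAt_const _)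
    (fun _ _ => (hf.differentiable (by simp)).differentiableAt)
  simpa using h

theorem integral_extDeriv_eq_zero {j : ℕ} {η : RR (j + 1) → (RR (j + 1) [⋀^Fin j]→L[ℝ] ℝ)}
    (hη : ContDiff ℝ ∞ η) (hc : HasCompactSupport η) (w : Fin (j + 1) → RR (j + 1)) :
    ∫ u, extDeriv η u w = 0 := by
  have happ : ∀ w', ContDiff ℝ ∞ fun u => η u w' := fun w' =>
    (ContinuousAlternatingMap.apply ℝ (RR (j + 1)) ℝ w').contDiff.comp hη
  have hcs : ∀ w', HasCompactSupport fun u => η u w' := fun w' =>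
    hc.comp_left (g := fun A : RR (j + 1) [⋀^Fin j]→L[ℝ] ℝ => A w') rfl
  have h : ∀ u, extDeriv η u w =
      ∑ i, (-1) ^ i.val • fderiv ℝ (fun u => η u (i.removeNth w)) u (w i) := fun u =>
    extDeriv_apply (hη.differentiable (by simp)).differentiableAt w
  simp only [h, zsmul_eq_mul]
  rw [integral_finsetSum]
  · refine Finset.sum_eq_zero fun i _ => ?_
    rw [integral_const_mul, integral_fderiv_eq_zero (happ _) (hcs _), mul_zero]
  · intro i _
    refine Integrable.const_mul (Continuous.integrable_of_hasCompactSupport ?_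
      ((hcs _).fderiv_apply ℝ (w i))) _
    exact (((happ _).fderiv_right (m := ∞) (by simp)).clm_apply contDiff_const).continuous

/-- The product of a smooth function and a form. -/
def DForm.smul {k : ℕ} (f : M → ℝ) (hf : DSmooth f) (α : DForm M k) : DForm M k where
  val p hp u := f (p u) • α.val p hp u
  smooth p hp := (DSmooth.isPlot_comp_real hf hp).smul (α.smooth p hp)
  compat p hp g hg u := by
    simp only [α.compat p hp g hg u]
    rfl

/-- `dβ = ∑ d(ρᵢ β)` for a partition of unity `ρ`. -/
theorem OrientedPartition.val_d_eq_sum {k j : ℕ} {τ : DForm M k} (P : OrientedPartition τ)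
    (β : DForm M j) {m : ℕ} (p : RR m → M) (hp : IsPlot p) (u : RR m) :
    β.d.val p hp u = ∑ i, (β.smul (P.ρ i) (P.smooth i)).d.val p hp u := by
  have h : β.val p hp = fun u => ∑ i, (β.smul (P.ρ i) (P.smooth i)).val p hp u := by
    funext u
    simp only [DForm.smul]
    rw [← Finset.sum_smul, P.sum_eq_one, one_smul]
  change extDeriv (β.val p hp) u = ∑ i, extDeriv ((β.smul (P.ρ i) (P.smooth i)).val p hp) u
  rw [h]
  simp only [extDeriv]
  rw [fderiv_fun_sum fun i _ =>
    (((β.smul (P.ρ i) (P.smooth i)).smooth p hp).differentiable (by simp)).differentiableAt]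
  exact map_sum (ContinuousAlternatingMap.alternatizeUncurryFinCLM ℝ (RR m) ℝ) _ _

/-- **Stokes' theorem**: the integral of an exact form over a closed manifold vanishes. -/
theorem OrientedPartition.integral_d_eq_zero (hM : PlotSeparated M) {j : ℕ} {τ : DForm M (j + 1)}
    (P : OrientedPartition τ) (β : DForm M j) : P.integral β.d = 0 := by
  have hsum : P.integral β.d = ∑ i, P.integral (β.smul (P.ρ i) (P.smooth i)).d := by
    simp only [OrientedPartition.integral]
    rw [Finset.sum_comm]
    refine Finset.sum_congr rfl fun i _ => ?_
    rw [← integral_finsetSum _ fun l _ => P.integrable _ i]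
    refine integral_congr_ae (Filter.Eventually.of_forall fun u => ?_)
    simp only [coeff]
    rw [P.val_d_eq_sum, ← Finset.mul_sum]
    exact congrArg _ (map_sum (ContinuousAlternatingMap.apply ℝ (RR (j + 1)) ℝ
      fun i => EuclideanSpace.single i 1) _ _)
  rw [hsum]
  refine Finset.sum_eq_zero fun i _ => ?_
  obtain ⟨K, hK, hsupp⟩ := P.supp i
  set β' := β.smul (P.ρ i) (P.smooth i) with hβ'
  -- the form `ρ i • β` vanishes wherever a plot leaves the compact set `φ i '' K`
  have hzero : ∀ {m : ℕ} (p : RR m → M) (hp : IsPlot p) (u : RR m), p u ∉ P.φ i '' K →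
      β'.val p hp =ᶠ[𝓝 u] 0 := by
    intro m p hp u hu
    filter_upwards [(hM.isClosed_preimage_image (P.isChart i).isPlot hK hp).isOpen_compl.mem_nhds
      hu] with y hy
    have : P.ρ i (p y) = 0 := by
      by_contra hne
      exact hy (hsupp _ hne)
    simp [hβ', DForm.smul, this]
  have hdzero : ∀ {m : ℕ} (p : RR m → M) (hp : IsPlot p) (u : RR m), p u ∉ P.φ i '' K →
      β'.d.val p hp u = 0 := by
    intro m p hp u hu
    change extDeriv _ u = 0
    rw [(hzero p hp u hu).extDeriv_eq]
    have : (0 : RR m → (RR m [⋀^Fin j]→L[ℝ] ℝ)) = fun _ => 0 := rfl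
    simp only [extDeriv, this]
    rw [fderiv_fun_const]
    exact map_zero (ContinuousAlternatingMap.alternatizeUncurryFinCLM ℝ (RR m) ℝ)
  rw [(P.integral_eq β'.d isOpen_univ (P.isChart i).isPlot (P.isChart i).injective.injOn
    fun l => Filter.Eventually.of_forall fun u hu => ?_).2]
  · simp only [sign_pos (P.pos i _), SignType.coe_one, one_mul, Measure.restrict_univ]
    refine integral_extDeriv_eq_zero (β'.smooth _ _) (HasCompactSupport.intro hK fun u hu => ?_) _
    refine (hzero _ _ u ?_).eq_of_nhds
    rintro ⟨v, hv, hvu⟩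
    exact hu ((P.isChart i).injective hvu ▸ hv)
  · rw [coeff, hdzero _ _ u fun h => hu ?_]
    · rfl
    · rw [image_univ]
      exact image_subset_range _ _ h

end Stokes

/-! ### Integration along the fibre `[0,1]` -/

section Fibre

theorem hasFDerivAt_integral_unitInterval {m : ℕ} {F : Type} [NormedAddCommGroup F]
    [NormedSpace ℝ F] [CompleteSpace F] {f : RR m × ℝ → F} (hf : ContDiff ℝ ∞ f) (x₀ : RR m) :
    HasFDerivAt (fun x : RR m => ∫ t in (0 : ℝ)..1, f (x, t))
      (∫ t in (0 : ℝ)..1, (fderiv ℝ f (x₀, t)).comp (ContinuousLinearMap.inl ℝ (RR m) ℝ)) x₀ := by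
  have hg : Continuous fun z : RR m × ℝ =>
      (fderiv ℝ f z).comp (ContinuousLinearMap.inl ℝ (RR m) ℝ) :=
    (hf.fderiv_right (m := ∞) (by simp)).continuous.clm_comp continuous_const
  obtain ⟨C, hC⟩ := ((isCompact_closedBall x₀ 1).prod
    (isCompact_Icc (a := (0 : ℝ)) (b := 1))).exists_bound_of_continuousOn hg.continuousOn
  refine intervalIntegral.hasFDerivAt_integral_of_dominated_of_fderiv_le
    (s := Metric.ball x₀ 1) (bound := fun _ => C) (Metric.ball_mem_nhds _ one_pos)
    (F := fun x t => f (x, t))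
    (F' := fun x t => (fderiv ℝ f (x, t)).comp (ContinuousLinearMap.inl ℝ (RR m) ℝ))
    ?_ ?_ ?_ ?_ ?_ ?_
  · exact Filter.Eventually.of_forall fun x =>
      (hf.continuous.comp (by fun_prop : Continuous fun t : ℝ => (x, t))).aestronglyMeasurable
  · exact (hf.continuous.comp
      (by fun_prop : Continuous fun t : ℝ => (x₀, t))).intervalIntegrable _ _
  · exact (hg.comp (by fun_prop : Continuous fun t : ℝ => (x₀, t))).aestronglyMeasurable
  · refine Filter.Eventually.of_forall fun t ht x hx => hC (x, t)
      ⟨Metric.ball_subset_closedBall hx, ?_⟩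
    rw [Set.uIoc_of_le zero_le_one] at ht
    exact ⟨ht.1.le, ht.2⟩
  · exact intervalIntegrable_const
  · refine Filter.Eventually.of_forall fun t _ x _ => ?_
    exact ((hf.differentiable (by simp)).differentiableAt.hasFDerivAt).comp x
      (hasFDerivAt_prodMk_left x t)

theorem hasFDerivAt_pt {m : ℕ} (t : ℝ) (u : RR m) : HasFDerivAt (pt t) (incl m) u := by
  have h : pt t = fun w : RR m => pt t 0 + incl m w := by
    funext w
    ext i
    refine Fin.cases ?_ (fun i => ?_) i <;> simp
  rw [h]
  exact (incl m).hasFDerivAt.const_add _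

theorem hasDerivAt_pt {m : ℕ} (t : ℝ) (u : RR m) :
    HasDerivAt (fun s => pt s u) (pt 1 0) t := by
  have h : (fun s => pt s u) = fun s : ℝ => pt 0 u + s • (pt 1 0 : RR (m + 1)) := by
    funext s
    ext i
    refine Fin.cases ?_ (fun i => ?_) i <;> simp
  rw [h]
  simpa using ((hasDerivAt_id t).smul_const (pt 1 0 : RR (m + 1))).const_add (pt 0 u)

/-- Integration along the fibre `[0,1]` sends closed forms to closed forms, provided that the
restrictions of the form to the two ends of the interval agree. -/
theorem extDeriv_integral_contract_eq_zero {m j : ℕ}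
    {A : RR (m + 1) → (RR (m + 1) [⋀^Fin (j + 1)]→L[ℝ] ℝ)} (hA : ContDiff ℝ ∞ A)
    (hd : ∀ z, extDeriv A z = 0)
    (hends : ∀ (u : RR m) (w : Fin (j + 1) → RR m),
      A (pt 1 u) (fun i => pt 0 (w i)) = A (pt 0 u) (fun i => pt 0 (w i)))
    (u : RR m) :
    extDeriv (fun u => ∫ t in (0 : ℝ)..1, contract rfl (A (pt t u))) u = 0 := by
  have hsm : ContDiff ℝ ∞ fun z : RR m × ℝ => contract rfl (A (pt z.2 z.1)) := by
    refine contDiff_alt fun w => ?_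
    simp only [contract_apply]
    exact (ContinuousAlternatingMap.apply ℝ (RR _) ℝ _).contDiff.comp (hA.comp contDiff_pt)
  have hAw : ∀ w, ContDiff ℝ ∞ fun z => A z w := fun w =>
    (ContinuousAlternatingMap.apply ℝ (RR (m + 1)) ℝ w).contDiff.comp hA
  have hBd : DifferentiableAt ℝ (fun u => ∫ t in (0 : ℝ)..1, contract rfl (A (pt t u))) u :=
    (hasFDerivAt_integral_unitInterval hsm u).differentiableAt
  ext w
  rw [extDeriv_apply hBd]
  -- the integrals of the coefficients and of their derivatives
  have hint : ∀ (w' : Fin j → RR m) (u : RR m),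
      (∫ t in (0 : ℝ)..1, contract rfl (A (pt t u))) w' =
        ∫ t in (0 : ℝ)..1, A (pt t u) (Fin.cons (pt 1 0) fun i => pt 0 (w' i)) := by
    intro w' u
    have h1 : IntervalIntegrable (fun t : ℝ => contract rfl (A (pt t u))) volume 0 1 :=
      (hsm.continuous.comp (by fun_prop : Continuous fun t : ℝ => (u, t))).intervalIntegrable _ _
    have h2 := ContinuousLinearMap.intervalIntegral_comp_comm
      (ContinuousAlternatingMap.apply ℝ (RR m) ℝ w') h1
    refine h2.symm.trans ?_
    refine intervalIntegral.integral_congr fun t _ => ?_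
    exact contract_apply rfl (A (pt t u)) w'
  have hderiv : ∀ (W : Fin (j + 1) → RR (m + 1)) (x : RR m),
      fderiv ℝ (fun u => ∫ t in (0 : ℝ)..1, A (pt t u) W) u x =
        ∫ t in (0 : ℝ)..1, fderiv ℝ (fun z => A z W) (pt t u) (pt 0 x) := by
    intro W x
    have hs : ContDiff ℝ ∞ fun z : RR m × ℝ => A (pt z.2 z.1) W := (hAw W).comp contDiff_pt
    rw [(hasFDerivAt_integral_unitInterval hs u).fderiv]
    have hc : Continuous fun t : ℝ => (fderiv ℝ (fun z : RR m × ℝ => A (pt z.2 z.1) W) (u, t)).comp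
        (ContinuousLinearMap.inl ℝ (RR m) ℝ) :=
      ((hs.fderiv_right (m := ∞) (by simp)).continuous.comp (by fun_prop)).clm_comp
        continuous_const
    refine (ContinuousLinearMap.intervalIntegral_comp_comm (ContinuousLinearMap.apply ℝ ℝ x)
      (hc.intervalIntegrable (μ := volume) 0 1)).symm.trans ?_
    refine intervalIntegral.integral_congr fun t _ => ?_
    change fderiv ℝ (fun z : RR m × ℝ => A (pt z.2 z.1) W) (u, t)
      (ContinuousLinearMap.inl ℝ (RR m) ℝ x) = _
    have h1 : HasFDerivAt (fun z : RR m × ℝ => A (pt z.2 z.1) W)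
      (fderiv ℝ (fun z : RR m × ℝ => A (pt z.2 z.1) W) (u, t)) (u, t) :=
      (hs.differentiable (by simp)).differentiableAt.hasFDerivAt
    have h2 := HasFDerivAt.comp (𝕜 := ℝ) (f := fun e : RR m => (e, t)) u h1
      (hasFDerivAt_prodMk_left u t)
    have h3 : HasFDerivAt (fun z => A z W) (fderiv ℝ (fun z => A z W) (pt t u)) (pt t u) :=
      ((hAw W).differentiable (by simp)).differentiableAt.hasFDerivAt
    have h4 := h3.comp u (hasFDerivAt_pt t u)
    exact congrArg (fun T : RR m →L[ℝ] ℝ => T x) (h2.unique h4)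
  simp only [hint, hderiv]
  -- closedness expresses the integrand through the derivative in the direction of the fibre
  have hclosed : ∀ t : ℝ, ∑ i : Fin (j + 1), (-1) ^ i.val •
      fderiv ℝ (fun z => A z (Fin.cons (pt 1 0) fun l => pt 0 (i.removeNth w l))) (pt t u)
        (pt 0 (w i)) = fderiv ℝ (fun z => A z fun i => pt 0 (w i)) (pt t u) (pt 1 0) := by
    intro t
    have h1 := extDeriv_apply (hA.differentiable (by simp)).differentiableAt (x := pt t u)
      (Fin.cons (pt 1 0) fun i => pt 0 (w i))
    rw [hd, Fin.sum_univ_succ] at h1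
    simp only [Fin.val_zero, pow_zero, one_smul, Fin.cons_zero, Fin.cons_succ, Fin.val_succ,
      pow_succ, mul_neg, mul_one, neg_smul, Finset.sum_neg_distrib] at h1
    have h2 : (0 : Fin (j + 2)).removeNth (Fin.cons (pt 1 0) fun i => pt 0 (w i) :
        Fin (j + 2) → RR (m + 1)) = fun i => pt 0 (w i) := rfl
    have h3 : ∀ i : Fin (j + 1), i.succ.removeNth (Fin.cons (pt 1 0) fun i => pt 0 (w i) :
        Fin (j + 2) → RR (m + 1)) = Fin.cons (pt 1 0) fun l => pt 0 (i.removeNth w l) := by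
      intro i
      funext l
      refine Fin.cases rfl (fun l => ?_) l
      simp [Fin.removeNth]
    simp only [h2, h3] at h1
    have h4 : (0 : RR (m + 1) [⋀^Fin (j + 1 + 1)]→L[ℝ] ℝ)
      (Fin.cons (pt 1 0) fun i => pt 0 (w i)) = 0 := rfl
    rw [h4] at h1
    linarith
  have hcont : ∀ (W : Fin (j + 1) → RR (m + 1)) (x : RR (m + 1)),
      Continuous fun t : ℝ => fderiv ℝ (fun z => A z W) (pt t u) x := fun W x =>
    (((hAw W).fderiv_right (m := ∞) (by simp)).continuous.comp
      (contDiff_pt.continuous.comp (by fun_prop : Continuous fun t : ℝ => (u, t)))).clm_apply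
      continuous_const
  calc ∑ i : Fin (j + 1), (-1) ^ i.val • ∫ t in (0 : ℝ)..1,
        fderiv ℝ (fun z => A z (Fin.cons (pt 1 0) fun l => pt 0 (i.removeNth w l))) (pt t u)
          (pt 0 (w i))
      = ∫ t in (0 : ℝ)..1, fderiv ℝ (fun z => A z fun i => pt 0 (w i)) (pt t u) (pt 1 0) := by
        simp only [← hclosed, zsmul_eq_mul]
        have h : ∀ i : Fin (j + 1), IntervalIntegrable (fun t : ℝ => (((-1) ^ i.val : ℤ) : ℝ) *
            fderiv ℝ (fun z => A z (Fin.cons (pt 1 0) fun l => pt 0 (i.removeNth w l))) (pt t u)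
              (pt 0 (w i))) volume 0 1 := fun i =>
          (continuous_const.mul (hcont _ _)).intervalIntegrable _ _
        rw [intervalIntegral.integral_finsetSum fun i _ => h i]
        simp only [intervalIntegral.integral_const_mul]
    _ = A (pt 1 u) (fun i => pt 0 (w i)) - A (pt 0 u) (fun i => pt 0 (w i)) := by
        refine intervalIntegral.integral_eq_sub_of_hasDerivAt
          (f := fun t => A (pt t u) fun i => pt 0 (w i)) (fun t _ => ?_)
          ((hcont _ _).intervalIntegrable _ _)
        exact (((hAw _).differentiable (by simp)).differentiableAt.hasFDerivAt).comp_hasDerivAt t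
          (hasDerivAt_pt t u)
    _ = 0 := by rw [hends, sub_self]

end Fibre

/-! ### Evaluating wedge products -/

section Wedge

/-- A wedge product of forms evaluated on a tuple whose second block is annihilated by the first
factor: only the trivial shuffle contributes. -/
theorem wedgeAlt_eq_mul {m j l k : ℕ} (h : j + l = k) (a : RR m [⋀^Fin j]→L[ℝ] ℝ)
    (b : RR m [⋀^Fin l]→L[ℝ] ℝ) (w : Fin k → RR m)
    (ha : ∀ x : Fin j → RR m,
      (∃ i r, x i = w (Fin.cast h (finSumFinEquiv (Sum.inr r : Fin j ⊕ Fin l)))) → a x = 0) :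
    DForm.wedgeAlt h a b w =
      a (fun i => w (Fin.cast h (finSumFinEquiv (Sum.inl i : Fin j ⊕ Fin l)))) *
        b (fun i => w (Fin.cast h (finSumFinEquiv (Sum.inr i : Fin j ⊕ Fin l)))) := by
  let W : Fin j ⊕ Fin l → RR m := fun s => w (Fin.cast h (finSumFinEquiv s))
  have hsum : DForm.wedgeAlt h a b w = ∑ c : Equiv.Perm.ModSumCongr (Fin j) (Fin l),
      (LinearMap.mul' ℝ ℝ) (AlternatingMap.domCoprod.summand a.toAlternatingMap b.toAlternatingMap
        c W) := by
    change DForm.wedgeAlg h a b w = _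
    simp only [DForm.wedgeAlg, AlternatingMap.domDomCongr_apply,
      LinearMap.compAlternatingMap_apply, AlternatingMap.domCoprod_apply, _root_.sum_apply,
      map_sum]
    rfl
  have hmk : ∀ σ : Equiv.Perm (Fin j ⊕ Fin l), (LinearMap.mul' ℝ ℝ)
      (AlternatingMap.domCoprod.summand a.toAlternatingMap b.toAlternatingMap
        (Quotient.mk'' σ) W) = ((Equiv.Perm.sign σ : ℤ) : ℝ) *
          (a (fun i => W (σ (Sum.inl i))) * b (fun i => W (σ (Sum.inr i)))) := by
    intro σ
    rw [AlternatingMap.domCoprod.summand_mk'', _root_.smul_apply, Units.smul_def, map_zsmul,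
      zsmul_eq_mul]
    rfl
  rw [hsum]
  refine (Finset.sum_eq_single
    (Quotient.mk'' 1 : Equiv.Perm.ModSumCongr (Fin j) (Fin l)) ?_ ?_).trans ?_
  · intro c _ hc
    induction c using Quotient.inductionOn' with | _ σ
    rw [hmk]
    by_cases hσ : MapsTo σ (range (Sum.inl : Fin j → Fin j ⊕ Fin l)) (range Sum.inl)
    · refine absurd ?_ hc
      obtain ⟨⟨sl, sr⟩, hs⟩ := Equiv.Perm.mem_sumCongrHom_range_of_perm_mapsTo_inl hσ
      refine Quotient.sound' (QuotientGroup.leftRel_apply.2 ?_)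
      rw [mul_one]
      exact Subgroup.inv_mem _ ⟨⟨sl, sr⟩, hs⟩
    · have : ∃ i r, σ (Sum.inl i) = Sum.inr r := by
        by_contra hcon
        push Not at hcon
        refine hσ ?_
        rintro _ ⟨i, rfl⟩
        rcases hi : σ (Sum.inl i) with i' | r
        · exact ⟨i', rfl⟩
        · exact absurd hi (hcon i r)
      obtain ⟨i, r, hir⟩ := this
      rw [ha (fun i => W (σ (Sum.inl i))) ⟨i, r, by simp only [W, hir]⟩, zero_mul, mul_zero]
  · exact fun hn => absurd (Finset.mem_univ _) hn
  · rw [hmk]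
    simp [W]

/-- The wedge product as a sum over all permutations instead of shuffles. -/
theorem factorial_mul_wedgeAlt {m j l k : ℕ} (h : j + l = k) (a : RR m [⋀^Fin j]→L[ℝ] ℝ)
    (b : RR m [⋀^Fin l]→L[ℝ] ℝ) (w : Fin k → RR m) :
    ((j.factorial * l.factorial : ℕ) : ℝ) * DForm.wedgeAlt h a b w =
      ∑ σ : Equiv.Perm (Fin j ⊕ Fin l), ((Equiv.Perm.sign σ : ℤ) : ℝ) *
        (a (fun i => w (Fin.cast h (finSumFinEquiv (σ (Sum.inl i))))) *
          b (fun i => w (Fin.cast h (finSumFinEquiv (σ (Sum.inr i)))))) := by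
  have h1 := MultilinearMap.domCoprod_alternization_eq a.toAlternatingMap b.toAlternatingMap
  have h2 := congrArg (fun A : RR m [⋀^Fin j ⊕ Fin l]→ₗ[ℝ] TensorProduct ℝ ℝ ℝ =>
    LinearMap.mul' ℝ ℝ (A fun s => w (Fin.cast h (finSumFinEquiv s)))) h1
  simp only [Fintype.card_fin] at h2
  rw [MultilinearMap.alternatization_apply, map_sum] at h2
  have h3 : LinearMap.mul' ℝ ℝ (((j.factorial * l.factorial) •
      a.toAlternatingMap.domCoprod b.toAlternatingMap)
        fun s => w (Fin.cast h (finSumFinEquiv s))) =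
      ((j.factorial * l.factorial : ℕ) : ℝ) * DForm.wedgeAlt h a b w := by
    rw [AlternatingMap.smul_apply, map_nsmul, nsmul_eq_mul]
    rfl
  rw [h3] at h2
  rw [← h2]
  refine Finset.sum_congr rfl fun σ _ => ?_
  rw [Units.smul_def, map_zsmul, zsmul_eq_mul]
  rfl

/-- Antisymmetrised sums with one marked argument that is annihilated by the first factor: by
alternation of the second factor, the marked argument may be put into its first slot. -/
theorem sum_perm_option {E : Type} [AddCommGroup E] [Module ℝ E] {ιa ιb : Type} [Fintype ιa]
    [Fintype ιb] [DecidableEq ιa] [DecidableEq ιb] (a : E [⋀^ιa]→ₗ[ℝ] ℝ)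
    (b : E [⋀^Option ιb]→ₗ[ℝ] ℝ) (W : Option (ιa ⊕ ιb) → E)
    (ha : ∀ x : ιa → E, (∃ i, x i = W none) → a x = 0) :
    ∑ σ : Equiv.Perm (Option (ιa ⊕ ιb)), ((Equiv.Perm.sign σ : ℤ) : ℝ) *
        (a (fun i => W (σ (some (Sum.inl i)))) * b (fun r => W (σ (r.map Sum.inr)))) =
      (Fintype.card ιb + 1) * ∑ σ : Equiv.Perm (ιa ⊕ ιb), ((Equiv.Perm.sign σ : ℤ) : ℝ) *
        (a (fun i => W (some (σ (Sum.inl i)))) *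
          b (fun r => W (r.map fun r => σ (Sum.inr r)))) := by
  set T : Equiv.Perm (ιa ⊕ ιb) → ℝ := fun σ => ((Equiv.Perm.sign σ : ℤ) : ℝ) *
        (a (fun i => W (some (σ (Sum.inl i)))) *
          b (fun r => W (r.map fun r => σ (Sum.inr r)))) with hT
  set f : Equiv.Perm (Option (ιa ⊕ ιb)) → ℝ := fun σ => ((Equiv.Perm.sign σ : ℤ) : ℝ) *
        (a (fun i => W (σ (some (Sum.inl i)))) * b (fun r => W (σ (r.map Sum.inr)))) with hf
  have hg : ∀ (i : Option (ιa ⊕ ιb)) (σ : Equiv.Perm (ιa ⊕ ιb)),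
      f ((Equiv.Perm.decomposeOption.symm (i, σ⁻¹))⁻¹) =
        match i with
        | none => T σ
        | some (Sum.inl _) => 0
        | some (Sum.inr _) => T σ := by
    intro i σ
    have hσ : (Equiv.Perm.decomposeOption.symm (i, σ⁻¹))⁻¹ =
        Equiv.optionCongr σ * Equiv.swap none i := by
      rw [Equiv.Perm.decomposeOption_symm_apply, mul_inv_rev, Equiv.swap_inv]
      rfl
    rw [hσ]
    let O : Equiv.Perm (Option (ιa ⊕ ιb)) := Equiv.optionCongr σ
    change f (O * Equiv.swap none i) = _
    have hO : Equiv.Perm.sign O = Equiv.Perm.sign σ := Equiv.optionCongr_sign σ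
    have hOs : ∀ s, O (some s) = some (σ s) := fun s => rfl
    have hOn : O none = none := rfl
    rcases i with _ | i | r
    · simp only [hf, hT, Equiv.swap_self, Equiv.Perm.sign_mul, hO]
      have h1 : Equiv.Perm.sign (Equiv.refl (Option (ιa ⊕ ιb))) = 1 := Equiv.Perm.sign_refl
      rw [h1, mul_one]
      congr 2
      refine congrArg b (funext fun r => ?_)
      rcases r with _ | r <;> rfl
    · simp only [hf]
      rw [ha, zero_mul, mul_zero]
      exact ⟨i, by simp [hOn]⟩
    · simp only [hf, hT, Equiv.Perm.sign_mul, hO]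
      rw [Equiv.Perm.sign_swap (by simp)]
      have h1 : (fun i => W ((O * Equiv.swap none (some (Sum.inr r)) :
            Equiv.Perm (Option (ιa ⊕ ιb)))
          (some (Sum.inl i)))) = fun i => W (some (σ (Sum.inl i))) := by
        funext i
        rw [Equiv.Perm.mul_apply, Equiv.swap_apply_of_ne_of_ne (by simp) (by simp)]
        rfl
      have h2 : (fun s : Option ιb => W ((O *
          Equiv.swap none (some (Sum.inr r)) : Equiv.Perm (Option (ιa ⊕ ιb))) (s.map Sum.inr))) =
          (fun s : Option ιb => W (s.map fun r => σ (Sum.inr r))) ∘ Equiv.swap none (some r) := by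
        funext s
        rw [Equiv.Perm.mul_apply, Function.comp_apply]
        rcases s with _ | s
        · simp [hOs]
        · by_cases hs : s = r
          · subst hs
            simp [hOn]
          · rw [Option.map_some, Equiv.swap_apply_of_ne_of_ne (by simp) (by simpa using hs),
              Equiv.swap_apply_of_ne_of_ne (by simp) (by simpa using hs)]
            rfl
      rw [h1, h2, b.map_swap _ (by simp)]
      push_cast
      ring
  -- a permutation is decomposed into the preimage `i` of `none` and a permutation of the rest: the
  -- terms vanish if `i` is in the first block, and do not depend on `i` otherwise
  rw [← Equiv.sum_comp (Equiv.inv (Equiv.Perm (Option (ιa ⊕ ιb)))),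
    ← Equiv.sum_comp Equiv.Perm.decomposeOption.symm, Fintype.sum_prod_type, Finset.sum_comm,
    ← Equiv.sum_comp (Equiv.inv (Equiv.Perm (ιa ⊕ ιb)))]
  rw [Finset.mul_sum]
  refine Finset.sum_congr rfl fun σ _ => ?_
  have h1 := fun i => hg i σ
  simp only [Equiv.inv_apply]
  change ∑ i, f ((Equiv.Perm.decomposeOption.symm (i, σ⁻¹))⁻¹) = (Fintype.card ιb + 1) * T σ
  rw [Fintype.sum_option, Fintype.sum_sum_type]
  simp only [h1, Finset.sum_const_zero, Finset.sum_const, Finset.card_univ, nsmul_eq_mul]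
  ring

/-- The projection `ℝ × ℝ^m → ℝ^m` as a continuous linear map. -/
def tlL (m : ℕ) : RR (m + 1) →L[ℝ] RR m :=
  LinearMap.toContinuousLinearMap
    { toFun := tl
      map_add' := fun _ _ => rfl
      map_smul' := fun _ _ => rfl }

@[simp] theorem tlL_apply {m : ℕ} (z : RR (m + 1)) : tlL m z = tl z := rfl

/-- Contraction with `∂_t` of the wedge product of a form pulled back from the second factor of
`ℝ × ℝ^m` with an arbitrary form. -/
theorem contract_wedgeAlt {m j l k : ℕ} (h : j + l = k) (h' : j + (l + 1) = k + 1)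
    (a : RR m [⋀^Fin j]→L[ℝ] ℝ) (b : RR (m + 1) [⋀^Fin (l + 1)]→L[ℝ] ℝ) :
    contract rfl (DForm.wedgeAlt h' (a.compContinuousLinearMap (tlL m)) b) =
      ((-1) ^ j : ℝ) • DForm.wedgeAlt h a (contract rfl b) := by
  ext w
  set v : Fin k → RR (m + 1) := fun i => pt 0 (w i) with hv
  set A := a.compContinuousLinearMap (tlL m) with hA
  have hp : j < k + 1 := by omega
  have h0 : contract rfl (DForm.wedgeAlt h' A b) w =
      DForm.wedgeAlt h' A b (Matrix.vecCons (pt 1 0) v) := contract_apply rfl _ _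
  -- moving `∂_t` from the first slot to the slot `j`, the first of the second block, gives the sign
  have h1 := AlternatingMap.map_insertNth (DForm.wedgeAlt h' A b).toAlternatingMap ⟨j, hp⟩
    (pt 1 0) v
  have h2 : DForm.wedgeAlt h' A b (Fin.insertNth (α := fun _ => RR (m + 1)) ⟨j, hp⟩ (pt 1 0) v) =
      (-1) ^ j * DForm.wedgeAlt h' A b (Matrix.vecCons (pt 1 0) v) := by
    refine h1.trans ?_
    rw [zsmul_eq_mul]
    push_cast
    rfl
  have h3 : DForm.wedgeAlt h' A b (Matrix.vecCons (pt 1 0) v) =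
      (-1) ^ j * DForm.wedgeAlt h' A b
        (Fin.insertNth (α := fun _ => RR (m + 1)) ⟨j, hp⟩ (pt 1 0) v) := by
    rw [h2, ← mul_assoc, ← pow_add, Even.neg_one_pow ⟨j, rfl⟩, one_mul]
  rw [h0, h3]
  change _ = (-1 : ℝ) ^ j * DForm.wedgeAlt h a (contract rfl b) w
  congr 1
  -- the arguments are indexed by `none`, which stands for `∂_t`, and the two remaining blocks
  let W : Option (Fin j ⊕ Fin l) → RR (m + 1) := fun s =>
    s.elim (pt 1 0) fun s => v (Fin.cast h (finSumFinEquiv s))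
  let e : Fin j ⊕ Fin (l + 1) ≃ Option (Fin j ⊕ Fin l) :=
    (Equiv.sumCongr (Equiv.refl _) (finSuccEquiv l)).trans
      { toFun := Sum.elim (fun i => some (Sum.inl i)) (fun r => r.map Sum.inr)
        invFun := fun s => s.elim (Sum.inr none) (Sum.elim Sum.inl fun r => Sum.inr (some r))
        left_inv := by rintro (i | _ | r) <;> rfl
        right_inv := by rintro (_ | i | r) <;> rfl }
  have hel : ∀ i, e (Sum.inl i) = some (Sum.inl i) := fun i => rfl
  have her : ∀ r, e (Sum.inr ((finSuccEquiv l).symm r)) = r.map Sum.inr := fun r => by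
    simp only [e, Equiv.trans_apply, Equiv.sumCongr_apply, Sum.map_inr, Equiv.apply_symm_apply]
    rfl
  have hW : ∀ s : Fin j ⊕ Fin (l + 1),
      (Fin.insertNth (α := fun _ => RR (m + 1)) ⟨j, hp⟩ (pt 1 0) v : Fin (k + 1) → RR (m + 1))
        (Fin.cast h' (finSumFinEquiv s)) = W (e s) := by
    rintro (i | r)
    · have hi : Fin.cast h' (finSumFinEquiv (Sum.inl i : Fin j ⊕ Fin (l + 1))) =
          (⟨j, hp⟩ : Fin (k + 1)).succAbove (Fin.cast h (finSumFinEquiv (Sum.inl i))) := by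
        rw [Fin.succAbove_of_castSucc_lt]
        · ext
          simp
        · rw [Fin.lt_def]
          simp
      rw [hi, Fin.insertNth_apply_succAbove]
      rfl
    · obtain ⟨s, rfl⟩ := (finSuccEquiv l).symm.surjective r
      rw [her]
      rcases s with _ | r
      · have hi : Fin.cast h' (finSumFinEquiv (Sum.inr ((finSuccEquiv l).symm none) :
            Fin j ⊕ Fin (l + 1))) = (⟨j, hp⟩ : Fin (k + 1)) := by
          ext
          simp
        rw [hi, Fin.insertNth_apply_same]
        rfl
      · have hi : Fin.cast h' (finSumFinEquiv (Sum.inr ((finSuccEquiv l).symm (some r)) :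
            Fin j ⊕ Fin (l + 1))) =
            (⟨j, hp⟩ : Fin (k + 1)).succAbove (Fin.cast h (finSumFinEquiv (Sum.inr r))) := by
          rw [Fin.succAbove_of_le_castSucc]
          · ext
            simp
            omega
          · rw [Fin.le_def]
            simp
        rw [hi, Fin.insertNth_apply_succAbove]
        rfl
  have hann : ∀ x : Fin j → RR (m + 1), (∃ i, x i = W none) → A.toAlternatingMap x = 0 := by
    rintro x ⟨i, hi⟩
    refine a.toAlternatingMap.map_coord_zero i ?_
    change tl (x i) = 0
    rw [hi]
    rfl
  have hfac : (((j.factorial * (l + 1).factorial : ℕ) : ℝ)) ≠ 0 := by positivity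
  refine mul_left_cancel₀ hfac ?_
  rw [factorial_mul_wedgeAlt, Nat.factorial_succ]
  have hsplit : ((j.factorial * ((l + 1) * l.factorial) : ℕ) : ℝ) =
      (Fintype.card (Fin l) + 1) * ((j.factorial * l.factorial : ℕ) : ℝ) := by
    push_cast [Fintype.card_fin]
    ring
  rw [hsplit, mul_assoc, factorial_mul_wedgeAlt]
  have key := sum_perm_option A.toAlternatingMap
    (b.toAlternatingMap.domDomCongr (finSuccEquiv l)) W hann
  have hL : ∀ σ : Equiv.Perm (Fin j ⊕ Fin l), (fun i => W (some (σ (Sum.inl i)))) =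
      fun i => v (Fin.cast h (finSumFinEquiv (σ (Sum.inl i)))) := fun σ => rfl
  rw [← Equiv.sum_comp e.permCongr] at key
  refine Eq.trans ?_ (key.trans ?_)
  · refine Finset.sum_congr rfl fun σ _ => ?_
    rw [Equiv.Perm.sign_permCongr]
    congr 2
    · refine congrArg A (funext fun i => ?_)
      rw [hW, Equiv.permCongr_apply, ← hel, Equiv.symm_apply_apply]
    · rw [AlternatingMap.domDomCongr_apply]
      refine congrArg b (funext fun r => ?_)
      rw [Function.comp_apply, hW, Equiv.permCongr_apply, ← her, Equiv.symm_apply_apply,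
        Equiv.symm_apply_apply]
  · congr 1
    refine Finset.sum_congr rfl fun σ _ => ?_
    congr 2
    rw [contract_apply, AlternatingMap.domDomCongr_apply]
    refine congrArg b (funext fun r => ?_)
    refine Fin.cases ?_ (fun r => ?_) r
    · rfl
    · simp only [Function.comp_apply, finSuccEquiv_succ, Option.map_some]
      rfl

end Wedge

/-! ### Products -/

section Products

variable {M N X : Type} [DiffeologicalSpace M] [DiffeologicalSpace N] [DiffeologicalSpace X]

/-- The projection of `ℝ^c = ℝ^a × ℝ^b` to the first factor. -/
def fstL {a b c : ℕ} (h : a + b = c) : RR c →L[ℝ] RR a :=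
  LinearMap.toContinuousLinearMap
    { toFun := fun u => WithLp.toLp 2 fun i =>
        u (Fin.cast h (finSumFinEquiv (Sum.inl i : Fin a ⊕ Fin b)))
      map_add' := fun _ _ => rfl
      map_smul' := fun _ _ => rfl }

/-- The projection of `ℝ^c = ℝ^a × ℝ^b` to the second factor. -/
def sndL {a b c : ℕ} (h : a + b = c) : RR c →L[ℝ] RR b :=
  LinearMap.toContinuousLinearMap
    { toFun := fun u => WithLp.toLp 2 fun i =>
        u (Fin.cast h (finSumFinEquiv (Sum.inr i : Fin a ⊕ Fin b)))
      map_add' := fun _ _ => rfl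
      map_smul' := fun _ _ => rfl }

/-- The point `(x, y)` of `ℝ^a × ℝ^b = ℝ^c`. -/
def joinE {a b c : ℕ} (h : a + b = c) (x : RR a) (y : RR b) : RR c :=
  WithLp.toLp 2 fun i => Sum.elim x y (finSumFinEquiv.symm (Fin.cast h.symm i))

theorem fstL_apply {a b c : ℕ} (h : a + b = c) (u : RR c) (i : Fin a) :
    fstL h u i = u (Fin.cast h (finSumFinEquiv (Sum.inl i : Fin a ⊕ Fin b))) := rfl

theorem sndL_apply {a b c : ℕ} (h : a + b = c) (u : RR c) (i : Fin b) :
    sndL h u i = u (Fin.cast h (finSumFinEquiv (Sum.inr i : Fin a ⊕ Fin b))) := rfl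

@[simp] theorem fstL_joinE {a b c : ℕ} (h : a + b = c) (x : RR a) (y : RR b) :
    fstL h (joinE h x y) = x := by
  ext i
  rw [fstL_apply]
  simp [joinE]

@[simp] theorem sndL_joinE {a b c : ℕ} (h : a + b = c) (x : RR a) (y : RR b) :
    sndL h (joinE h x y) = y := by
  ext i
  rw [sndL_apply]
  simp [joinE]

@[simp] theorem joinE_fstL_sndL {a b c : ℕ} (h : a + b = c) (u : RR c) :
    joinE h (fstL h u) (sndL h u) = u := by
  subst h
  ext i
  obtain ⟨s, rfl⟩ := finSumFinEquiv.surjective i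
  rcases s with i | i
  · simp [joinE, fstL_apply]
  · simp [joinE, sndL_apply]

theorem contDiff_joinE {a b c : ℕ} (h : a + b = c) :
    ContDiff ℝ ∞ fun z : RR a × RR b => joinE h z.1 z.2 := by
  rw [contDiff_euclidean]
  intro i
  simp only [joinE]
  rcases finSumFinEquiv.symm (Fin.cast h.symm i) with i | i
  · simp only [Sum.elim_inl]
    fun_prop
  · simp only [Sum.elim_inr]
    fun_prop

theorem fstL_single_inr {a b c : ℕ} (h : a + b = c) (r : Fin b) :
    fstL h (EuclideanSpace.single (Fin.cast h (finSumFinEquiv (Sum.inr r : Fin a ⊕ Fin b))) 1) =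
      0 := by
  subst h
  ext i
  simp only [fstL_apply, Fin.cast_refl, id, PiLp.single_apply, PiLp.zero_apply]
  rw [if_neg fun h => by simpa using finSumFinEquiv.injective h]

theorem fstL_single_inl {a b c : ℕ} (h : a + b = c) (r : Fin a) :
    fstL h (EuclideanSpace.single (Fin.cast h (finSumFinEquiv (Sum.inl r : Fin a ⊕ Fin b))) 1) =
      EuclideanSpace.single r 1 := by
  subst h
  ext i
  simp only [fstL_apply, Fin.cast_refl, id, PiLp.single_apply,
    finSumFinEquiv.injective.eq_iff, Sum.inl.injEq]

theorem sndL_single_inr {a b c : ℕ} (h : a + b = c) (r : Fin b) :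
    sndL h (EuclideanSpace.single (Fin.cast h (finSumFinEquiv (Sum.inr r : Fin a ⊕ Fin b))) 1) =
      EuclideanSpace.single r 1 := by
  subst h
  ext i
  simp only [sndL_apply, Fin.cast_refl, id, PiLp.single_apply,
    finSumFinEquiv.injective.eq_iff, Sum.inr.injEq]

/-- Charts of the factors give a chart of the product, for any coordinates `(A, B)` identifying
`ℝ^c` with `ℝ^a × ℝ^b`. -/
theorem IsChart.prodMk {a b c : ℕ} {φ : RR a → M} {ψ : RR b → N} (hφ : IsChart φ) (hψ : IsChart ψ)
    (A : RR c →L[ℝ] RR a) (B : RR c →L[ℝ] RR b) (J : RR a × RR b → RR c) (hJ : ContDiff ℝ ∞ J)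
    (hA : ∀ z, A (J z) = z.1) (hB : ∀ z, B (J z) = z.2) (hAB : ∀ u, J (A u, B u) = u) :
    IsChart fun u => (φ (A u), ψ (B u)) where
  isPlot := ⟨isPlot_reparam hφ.isPlot A.contDiff, isPlot_reparam hψ.isPlot B.contDiff⟩
  injective u v huv := by
    rw [Prod.mk.injEq, hφ.injective.eq_iff, hψ.injective.eq_iff] at huv
    rw [← hAB u, ← hAB v, huv.1, huv.2]
  isOpen_range := by
    rw [isOpen_iff_preimages_plots]
    intro m p hp
    have : p ⁻¹' range (fun u => (φ (A u), ψ (B u))) =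
        (fun u => (p u).1) ⁻¹' range φ ∩ (fun u => (p u).2) ⁻¹' range ψ := by
      ext u
      constructor
      · rintro ⟨v, hv⟩
        exact ⟨⟨A v, congrArg Prod.fst hv⟩, ⟨B v, congrArg Prod.snd hv⟩⟩
      · rintro ⟨⟨x, hx⟩, ⟨y, hy⟩⟩
        refine ⟨J (x, y), ?_⟩
        simp only [hA, hB]
        exact Prod.ext hx hy
    rw [this]
    exact (hφ.isOpen_preimage hp.1).inter (hψ.isOpen_preimage hp.2)
  exists_lift p hp hr := by
    obtain ⟨g, hg, hgp⟩ := hφ.exists_lift (fun u => (p u).1) hp.1 (by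
      rintro _ ⟨u, rfl⟩
      obtain ⟨v, hv⟩ := hr ⟨u, rfl⟩
      exact ⟨A v, congrArg Prod.fst hv⟩)
    obtain ⟨g', hg', hgp'⟩ := hψ.exists_lift (fun u => (p u).2) hp.2 (by
      rintro _ ⟨u, rfl⟩
      obtain ⟨v, hv⟩ := hr ⟨u, rfl⟩
      exact ⟨B v, congrArg Prod.snd hv⟩)
    refine ⟨fun u => J (g u, g' u), hJ.comp (hg.prodMk hg'), ?_⟩
    funext u
    simp only [Function.comp_apply, hA, hB]
    exact Prod.ext (congrFun hgp u) (congrFun hgp' u)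

/-- The coefficient of `f^*α ∧ g^*β` in a plot whose composites with `f` and `g` depend on the first
and the second block of coordinates only. -/
theorem coeff_wedge_pullback {a b c : ℕ} (h : a + b = c) (α : DForm M a) (β : DForm N b)
    {f : X → M} (hf : DSmooth f) {g : X → N} (hg : DSmooth g) {P : RR c → X} (hP : IsPlot P)
    {φ : RR a → M} (hφ : IsPlot φ) {ψ : RR b → N} (hψ : IsPlot ψ)
    (hfP : f ∘ P = φ ∘ fstL h) (hgP : g ∘ P = ψ ∘ sndL h) (u : RR c) :
    coeff (DForm.wedge h (α.pullback f hf) (β.pullback g hg)) P hP u =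
      coeff α φ hφ (fstL h u) * coeff β ψ hψ (sndL h u) := by
  have hval : ∀ {k : ℕ} {Y : Type} [DiffeologicalSpace Y] (γ : DForm Y k) (p q : RR c → Y)
      (hp : IsPlot p) (hq : IsPlot q), p = q → γ.val p hp u = γ.val q hq u := by
    intro _ _ _ γ p q hp hq hpq
    subst hpq
    rfl
  have h1 : (α.pullback f hf).val P hP u =
      (α.val φ hφ (fstL h u)).compContinuousLinearMap (fstL h) := by
    change α.val (f ∘ P) _ u = _
    rw [hval α _ _ _ (isPlot_reparam hφ (fstL h).contDiff) hfP, α.compat φ hφ _ (fstL h).contDiff,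
      (fstL h).fderiv]
  have h2 : (β.pullback g hg).val P hP u =
      (β.val ψ hψ (sndL h u)).compContinuousLinearMap (sndL h) := by
    change β.val (g ∘ P) _ u = _
    rw [hval β _ _ _ (isPlot_reparam hψ (sndL h).contDiff) hgP, β.compat ψ hψ _ (sndL h).contDiff,
      (sndL h).fderiv]
  change DForm.wedgeAlt h ((α.pullback f hf).val P hP u) ((β.pullback g hg).val P hP u) _ = _
  rw [h1, h2, wedgeAlt_eq_mul]
  · simp only [ContinuousAlternatingMap.compContinuousLinearMap_apply, coeff]
    congr 1
    · refine congrArg _ (funext fun i => ?_)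
      exact fstL_single_inl h i
    · refine congrArg _ (funext fun i => ?_)
      exact sndL_single_inr h i
  · rintro x ⟨i, r, hx⟩
    rw [ContinuousAlternatingMap.compContinuousLinearMap_apply]
    refine (α.val φ hφ (fstL h u)).toAlternatingMap.map_coord_zero i ?_
    rw [Function.comp_apply, hx, fstL_single_inr]

theorem CompactlyCovered.prod (hM : CompactlyCovered M) (hN : CompactlyCovered N) :
    CompactlyCovered (M × N) := by
  obtain ⟨l, Q, K, hQ, hK, hp, hc⟩ := hM
  obtain ⟨l', Q', K', hQ', hK', hp', hc'⟩ := hN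
  refine ⟨l + l', image2 (fun q q' u => (q (fstL rfl u), q' (sndL rfl u))) Q Q',
    (fun z : RR l × RR l' => joinE rfl z.1 z.2) '' (K ×ˢ K'), hQ.image2 _ hQ',
    (hK.prod hK').image (contDiff_joinE rfl).continuous, ?_, ?_⟩
  · rintro _ ⟨q, hq, q', hq', rfl⟩
    exact ⟨isPlot_reparam (hp q hq) (fstL rfl).contDiff,
      isPlot_reparam (hp' q' hq') (sndL rfl).contDiff⟩
  · rintro ⟨x, y⟩
    obtain ⟨q, hq, u, hu, rfl⟩ := hc x
    obtain ⟨q', hq', u', hu', rfl⟩ := hc' y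
    exact ⟨_, ⟨q, hq, q', hq', rfl⟩, _, ⟨(u, u'), ⟨hu, hu'⟩, rfl⟩, by simp⟩

end Products

/-! ### Thin sets -/

section Thin

variable {M N : Type} [DiffeologicalSpace M] [DiffeologicalSpace N]

/-- A set covered by the images of countably many `l`-dimensional plots. -/
def Thin (l : ℕ) (Z : Set M) : Prop :=
  ∃ Q : Set (RR l → M), Q.Countable ∧ (∀ q ∈ Q, IsPlot q) ∧ ∀ x ∈ Z, ∃ q ∈ Q, x ∈ range q

theorem Thin.mono {l : ℕ} {Z Z' : Set M} (h : Thin l Z) (hZ : Z' ⊆ Z) : Thin l Z' := by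
  obtain ⟨Q, hQ, hp, hc⟩ := h
  exact ⟨Q, hQ, hp, fun x hx => hc x (hZ hx)⟩

theorem Thin.union {l : ℕ} {Z Z' : Set M} (h : Thin l Z) (h' : Thin l Z') : Thin l (Z ∪ Z') := by
  obtain ⟨Q, hQ, hp, hc⟩ := h
  obtain ⟨Q', hQ', hp', hc'⟩ := h'
  refine ⟨Q ∪ Q', hQ.union hQ', ?_, ?_⟩
  · rintro q (hq | hq)
    exacts [hp q hq, hp' q hq]
  · rintro x (hx | hx)
    · obtain ⟨q, hq, hx⟩ := hc x hx
      exact ⟨q, Or.inl hq, hx⟩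
    · obtain ⟨q, hq, hx⟩ := hc' x hx
      exact ⟨q, Or.inr hq, hx⟩

theorem Thin.image {l : ℕ} {Z : Set M} (h : Thin l Z) {f : M → N} (hf : DSmooth f) :
    Thin l (f '' Z) := by
  obtain ⟨Q, hQ, hp, hc⟩ := h
  refine ⟨(fun q => f ∘ q) '' Q, hQ.image _, ?_, ?_⟩
  · rintro _ ⟨q, hq, rfl⟩
    exact (hp q hq).dSmooth_comp hf
  · rintro _ ⟨x, hx, rfl⟩
    obtain ⟨q, hq, u, rfl⟩ := hc x hx
    exact ⟨_, ⟨q, hq, rfl⟩, u, rfl⟩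

theorem Thin.prod {l l' : ℕ} {Z : Set M} {Z' : Set N} (h : Thin l Z) (h' : Thin l' Z') :
    Thin (l + l') (Z ×ˢ Z') := by
  obtain ⟨Q, hQ, hp, hc⟩ := h
  obtain ⟨Q', hQ', hp', hc'⟩ := h'
  refine ⟨image2 (fun q q' u => (q (fstL rfl u), q' (sndL rfl u))) Q Q', hQ.image2 hQ' _, ?_, ?_⟩
  · rintro _ ⟨q, hq, q', hq', rfl⟩
    exact ⟨isPlot_reparam (hp q hq) (fstL rfl).contDiff,
      isPlot_reparam (hp' q' hq') (sndL rfl).contDiff⟩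
  · rintro ⟨x, y⟩ ⟨hx, hy⟩
    obtain ⟨q, hq, u, rfl⟩ := hc x hx
    obtain ⟨q', hq', u', rfl⟩ := hc' y hy
    exact ⟨_, ⟨q, hq, q', hq', rfl⟩, joinE rfl u u', by simp⟩

theorem Thin.of_le {l l' : ℕ} {Z : Set M} (h : Thin l Z) (hl : l ≤ l') : Thin l' Z := by
  obtain ⟨Q, hQ, hp, hc⟩ := h
  obtain ⟨b, rfl⟩ := Nat.exists_eq_add_of_le hl
  refine ⟨(fun q => q ∘ fstL (b := b) rfl) '' Q, hQ.image _, ?_, ?_⟩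
  · rintro _ ⟨q, hq, rfl⟩
    exact isPlot_reparam (hp q hq) (fstL rfl).contDiff
  · intro x hx
    obtain ⟨q, hq, u, rfl⟩ := hc x hx
    exact ⟨_, ⟨q, hq, rfl⟩, joinE rfl u 0, by simp⟩

theorem thin_range {l : ℕ} {q : RR l → M} (hq : IsPlot q) : Thin l (range q) :=
  ⟨{q}, countable_singleton q, by rintro _ rfl; exact hq, fun x hx => ⟨q, rfl, hx⟩⟩

theorem thin_singleton (x : M) : Thin 0 ({x} : Set M) :=
  (thin_range (q := fun _ => x) isPlot_const).mono (by rintro _ rfl; exact ⟨0, rfl⟩)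

/-- Sets covered by plots of lower dimension are null sets in every chart. -/
theorem Thin.volume_preimage_eq_zero {l : ℕ} {Z : Set M} (hZ : Thin l Z) {φ : RR (l + 1) → M}
    (hφ : IsChart φ) : volume (φ ⁻¹' Z) = 0 := by
  obtain ⟨Q, hQ, hp, hc⟩ := hZ
  have hsub : φ ⁻¹' Z ⊆ ⋃ q ∈ Q, φ ⁻¹' range q := by
    intro u hu
    obtain ⟨q, hq, hx⟩ := hc _ hu
    exact mem_biUnion hq hx
  refine measure_mono_null hsub ((measure_biUnion_null_iff hQ).2 fun q hq => ?_)
  -- the range of `q` is that of a plot on `ℝ^(l+1)` that is constant in one direction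
  have hq' : IsPlot (q ∘ tl) := isPlot_reparam (hp q hq) contDiff_tl
  set O : Set (RR (l + 1)) := (q ∘ tl) ⁻¹' range φ
  have himage : φ ⁻¹' range q = (Function.invFun φ ∘ q ∘ tl) '' O := by
    ext v
    constructor
    · rintro ⟨u, hu⟩
      refine ⟨pt 0 u, ⟨v, ?_⟩, ?_⟩
      · simp [hu]
      · simp [hu, hφ.invFun_apply]
    · rintro ⟨z, ⟨v', hv'⟩, rfl⟩
      refine ⟨tl z, ?_⟩
      have h1 : φ v' = q (tl z) := hv'
      simp only [Function.comp_apply, ← h1, hφ.invFun_apply]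
  rw [himage]
  refine addHaar_image_eq_zero_of_det_fderivWithin_eq_zero volume
    (f' := fun z => fderiv ℝ (Function.invFun φ ∘ q ∘ tl) z) (fun z hz => ?_) fun z hz => ?_
  · exact ((hφ.contDiffAt_and_val_eq hq' hz).1.differentiableAt
      (by simp)).hasFDerivAt.hasFDerivWithinAt
  · have hd : DifferentiableAt ℝ (Function.invFun φ ∘ q ∘ tl) z :=
      (hφ.contDiffAt_and_val_eq hq' hz).1.differentiableAt (by simp)
    have hker : fderiv ℝ (Function.invFun φ ∘ q ∘ tl) z (pt 1 0) = 0 := by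
      have h1 : HasDerivAt (fun s : ℝ => (Function.invFun φ ∘ q ∘ tl) (pt s (tl z)))
          (fderiv ℝ (Function.invFun φ ∘ q ∘ tl) z (pt 1 0)) (z 0) :=
        HasFDerivAt.comp_hasDerivAt_of_eq (z 0) hd.hasFDerivAt (hasDerivAt_pt (z 0) (tl z))
          (by simp)
      have h2 : (fun s : ℝ => (Function.invFun φ ∘ q ∘ tl) (pt s (tl z))) =
          fun _ => Function.invFun φ (q (tl z)) := by
        funext s
        simp
      rw [h2] at h1
      exact h1.unique (hasDerivAt_const _ _)
    by_contra hdet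
    have hinj : Function.Injective (fderiv ℝ (Function.invFun φ ∘ q ∘ tl) z) := by
      have h3 := LinearMap.ker_eq_bot.2
        ((LinearEquiv.ofIsUnitDet (v := Module.finBasis ℝ (RR (l + 1)))
          (v' := Module.finBasis ℝ (RR (l + 1)))
          (f := (fderiv ℝ (Function.invFun φ ∘ q ∘ tl) z : RR (l + 1) →ₗ[ℝ] RR (l + 1))) (by
            rw [LinearMap.det_toMatrix]
            exact isUnit_iff_ne_zero.2 hdet)).injective)
      exact LinearMap.ker_eq_bot.1 h3
    have h0 : (pt 1 0 : RR (l + 1)) = 0 := hinj (by rw [hker, map_zero])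
    have h1 := congrArg (fun x : RR (l + 1) => x 0) h0
    simp at h1

end Thin

/-! ### Charts with explicit inverses -/

section ExplicitCharts

variable {M : Type} [DiffeologicalSpace M]

/-- `e` is a smooth map from `M` to a normed space, which need not carry a diffeology. -/
def SmoothTo {E : Type} [NormedAddCommGroup E] [NormedSpace ℝ E] (e : M → E) : Prop :=
  ∀ (m : ℕ) (p : RR m → M), IsPlot p → ContDiff ℝ ∞ (e ∘ p)

theorem SmoothTo.plotSeparated {E : Type} [NormedAddCommGroup E] [NormedSpace ℝ E] {e : M → E}
    (he : SmoothTo e) (hinj : Function.Injective e) : PlotSeparated M :=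
  ⟨E, inferInstance, inferInstance, e, hinj, fun m p hp => (he m p hp).continuous⟩

theorem injective_fderiv_of_leftInverse {k : ℕ} {E : Type} [NormedAddCommGroup E]
    [NormedSpace ℝ E] {f : RR k → E} (hf : ContDiff ℝ ∞ f) {O : Set E} (hO : IsOpen O)
    {G : E → RR k} (hG : ContDiffOn ℝ ∞ G O) (hfO : ∀ u, f u ∈ O) (hGf : ∀ u, G (f u) = u)
    (u : RR k) : Function.Injective (fderiv ℝ f u) := by
  have h1 : DifferentiableAt ℝ G (f u) :=
    (hG.contDiffAt (hO.mem_nhds (hfO u))).differentiableAt (by simp)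
  have h2 : DifferentiableAt ℝ f u := (hf.differentiable (by simp)).differentiableAt
  have h3 : (fderiv ℝ G (f u)).comp (fderiv ℝ f u) = ContinuousLinearMap.id ℝ _ := by
    rw [← fderiv_comp u h1 h2, show G ∘ f = id from funext hGf, fderiv_id]
  intro x y hxy
  have h4 := fun z => congrArg (fun T : RR k →L[ℝ] RR k => T z) h3
  simp only [ContinuousLinearMap.comp_apply, ContinuousLinearMap.id_apply] at h4
  rw [← h4 x, ← h4 y, hxy]

/-- A plot with a smooth left inverse, defined on an open set whose preimage is the image of the
plot, is a chart. -/
theorem isChart_of_leftInverse {k : ℕ} {E : Type} [NormedAddCommGroup E] [NormedSpace ℝ E]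
    {e : M → E} (he : SmoothTo e) {φ : RR k → M} (hφ : IsPlot φ) {O : Set E} (hO : IsOpen O)
    {G : E → RR k} (hG : ContDiffOn ℝ ∞ G O) (hφO : ∀ u, e (φ u) ∈ O) (hGφ : ∀ u, G (e (φ u)) = u)
    (hφG : ∀ x, e x ∈ O → φ (G (e x)) = x) : IsChart φ where
  isPlot := hφ
  injective u v h := by rw [← hGφ u, ← hGφ v, h]
  isOpen_range := by
    rw [isOpen_iff_preimages_plots]
    intro m p hp
    have : p ⁻¹' range φ = (e ∘ p) ⁻¹' O := by
      ext u
      constructor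
      · rintro ⟨v, hv⟩
        change e (p u) ∈ O
        rw [← hv]
        exact hφO v
      · exact fun hu => ⟨G (e (p u)), hφG _ hu⟩
    rw [this]
    exact hO.preimage (he m p hp).continuous
  exists_lift p hp hr := by
    have hmem : ∀ u, e (p u) ∈ O := by
      intro u
      obtain ⟨v, hv⟩ := hr ⟨u, rfl⟩
      rw [← hv]
      exact hφO v
    exact ⟨fun u => G (e (p u)), contDiffOn_univ.1 (hG.comp (he _ p hp).contDiffOn
      fun u _ => hmem u), funext fun u => (hφG _ (hmem u)).symm⟩

theorem det_ne_zero_of_injective {k : ℕ} {T : RR k →L[ℝ] RR k} (hT : Function.Injective T) :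
    T.det ≠ 0 := by
  have h : IsUnit (T : RR k →ₗ[ℝ] RR k) :=
    LinearMap.isUnit_iff_ker_eq_bot _ |>.2 (LinearMap.ker_eq_bot.2 hT)
  exact ((LinearMap.isUnit_iff_isUnit_det _).1 h).ne_zero

/-- A volume form does not vanish on immersions of full dimension. -/
theorem IsVolumeForm.coeff_ne_zero {k : ℕ} {τ : DForm M k} (hτ : IsVolumeForm τ) {E : Type}
    [NormedAddCommGroup E] [NormedSpace ℝ E] {e : M → E} (he : SmoothTo e) {ψ : RR k → M}
    (hψ : IsPlot ψ) {u : RR k} (hinj : Function.Injective (fderiv ℝ (e ∘ ψ) u)) :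
    coeff τ ψ hψ u ≠ 0 := by
  obtain ⟨φ, hφ, hx, hne⟩ := hτ (ψ u)
  rw [hφ.coeff_eq hψ hx]
  refine mul_ne_zero (det_ne_zero_of_injective ?_) (hne _)
  have hg := (hφ.contDiffAt_and_val_eq hψ hx).1
  have heq : e ∘ ψ =ᶠ[𝓝 u] (e ∘ φ) ∘ (Function.invFun φ ∘ ψ) := by
    filter_upwards [(hφ.isOpen_preimage hψ).mem_nhds hx] with y hy
    obtain ⟨v, hv⟩ := hy
    simp only [Function.comp_apply, ← hv, hφ.invFun_apply]
  rw [heq.fderiv_eq, fderiv_comp u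
    ((he k φ hφ.isPlot).differentiable (by simp)).differentiableAt
    (hg.differentiableAt (by simp))] at hinj
  exact fun x y hxy => hinj (by simp only [ContinuousLinearMap.comp_apply, hxy])

end ExplicitCharts

/-! ### Stereographic charts of spheres -/

section Spheres

theorem inner_pt {m : ℕ} (s t : ℝ) (u v : RR m) :
    inner ℝ (pt s u) (pt t v) = s * t + inner ℝ u v := by
  simp [PiLp.inner_apply, Fin.sum_univ_succ, mul_comm]

theorem norm_pt_sq {m : ℕ} (s : ℝ) (u : RR m) : ‖pt s u‖ ^ 2 = s ^ 2 + ‖u‖ ^ 2 := by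
  rw [← real_inner_self_eq_norm_sq, inner_pt, real_inner_self_eq_norm_sq]
  ring

theorem pt_eta {m : ℕ} (x : RR (m + 1)) : x = pt (x 0) (tl x) := (pt_tl x).symm

theorem norm_sq_eq_zero_add_tl {m : ℕ} (x : RR (m + 1)) : ‖x‖ ^ 2 = x 0 ^ 2 + ‖tl x‖ ^ 2 := by
  conv_lhs => rw [pt_eta x]
  exact norm_pt_sq _ _

theorem smoothTo_subtype {n : ℕ} {P : RR n → Prop} :
    SmoothTo (Subtype.val : Subtype P → RR n) := fun _ _ hp => IsPlot.contDiff hp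

/-- The conformal factor of the stereographic projection. -/
def conf {d : ℕ} (a : RR d) : ℝ := 2 / (1 + ‖a‖ ^ 2)

theorem conf_pos {d : ℕ} (a : RR d) : 0 < conf a := by
  unfold conf
  positivity

theorem conf_mul {d : ℕ} (a : RR d) : conf a * (1 + ‖a‖ ^ 2) = 2 := by
  unfold conf
  field_simp

theorem contDiff_conf {d : ℕ} : ContDiff ℝ ∞ (conf : RR d → ℝ) := by
  unfold conf
  exact contDiff_const.div (contDiff_const.add (contDiff_id.norm_sq ℝ)) fun a => by positivity

/-- The inverse of the stereographic projection from the pole `ε e₀`, where `ε = ±1`. -/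
def ster {d : ℕ} {ε : ℝ} (hε : ε ^ 2 = 1) (a : RR d) : Sphere (d + 1) :=
  ⟨pt (ε * (1 - conf a)) (conf a • a), by
    have h1 := norm_pt_sq (ε * (1 - conf a)) (conf a • a)
    rw [norm_smul, Real.norm_of_nonneg (conf_pos a).le] at h1
    have h2 := conf_mul a
    have h3 : ‖pt (ε * (1 - conf a)) (conf a • a)‖ ^ 2 = 1 := by
      rw [h1]
      linear_combination (1 - conf a) ^ 2 * hε + conf a * h2
    nlinarith [norm_nonneg (pt (ε * (1 - conf a)) (conf a • a))]⟩

theorem contDiff_ster {d : ℕ} {ε : ℝ} (hε : ε ^ 2 = 1) :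
    ContDiff ℝ ∞ fun a : RR d => (ster hε a).1 :=
  contDiff_pt.comp ((contDiff_conf.smul contDiff_id).prodMk
    (contDiff_const.mul (contDiff_const.sub contDiff_conf)))

theorem isPlot_ster {d : ℕ} {ε : ℝ} (hε : ε ^ 2 = 1) :
    IsPlot (ster hε : RR d → Sphere (d + 1)) :=
  (contDiff_ster hε).isPlot

theorem one_sub_ster_zero {d : ℕ} {ε : ℝ} (hε : ε ^ 2 = 1) (a : RR d) :
    1 - ε * (ster hε a).1 0 = conf a := by
  change 1 - ε * (ε * (1 - conf a)) = _
  linear_combination (-(1 - conf a)) * hε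

/-- The stereographic projection from the pole `ε e₀`. -/
def sterInv {d : ℕ} (ε : ℝ) (x : RR (d + 1)) : RR d := (1 - ε * x 0)⁻¹ • tl x

theorem isOpen_compl_pole {d : ℕ} (ε : ℝ) : IsOpen {x : RR (d + 1) | 1 - ε * x 0 ≠ 0} :=
  isOpen_ne_fun (by fun_prop) continuous_const

theorem contDiffOn_sterInv {d : ℕ} (ε : ℝ) :
    ContDiffOn ℝ ∞ (sterInv ε : RR (d + 1) → RR d) {x | 1 - ε * x 0 ≠ 0} :=
  (ContDiffOn.inv (by fun_prop) fun _ hx => hx).smul contDiff_tl.contDiffOn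

theorem sterInv_ster {d : ℕ} {ε : ℝ} (hε : ε ^ 2 = 1) (a : RR d) :
    sterInv ε (ster hε a).1 = a := by
  rw [sterInv, one_sub_ster_zero]
  change (conf a)⁻¹ • (conf a • a) = a
  rw [smul_smul, inv_mul_cancel₀ (conf_pos a).ne', one_smul]

theorem norm_sterInv_sq {d : ℕ} {ε : ℝ} (hε : ε ^ 2 = 1) {x : RR (d + 1)} (hx : ‖x‖ = 1)
    (h : 1 - ε * x 0 ≠ 0) : (1 - ε * x 0) * (1 + ‖sterInv ε x‖ ^ 2) = 2 := by
  have h1 := norm_sq_eq_zero_add_tl x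
  rw [hx] at h1
  rw [sterInv, norm_smul, mul_pow, norm_inv, inv_pow, Real.norm_eq_abs, sq_abs]
  field_simp
  linear_combination (-1) * h1 + x 0 ^ 2 * hε

theorem conf_sterInv {d : ℕ} {ε : ℝ} (hε : ε ^ 2 = 1) {x : RR (d + 1)} (hx : ‖x‖ = 1)
    (h : 1 - ε * x 0 ≠ 0) : conf (sterInv ε x) = 1 - ε * x 0 := by
  have h1 := norm_sterInv_sq hε hx h
  have h2 := conf_mul (sterInv ε x)
  have h3 : 1 + ‖sterInv ε x‖ ^ 2 ≠ 0 := by positivity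
  exact mul_right_cancel₀ h3 (h2.trans h1.symm)

theorem ster_sterInv {d : ℕ} {ε : ℝ} (hε : ε ^ 2 = 1) {x : RR (d + 1)} (hx : ‖x‖ = 1)
    (h : 1 - ε * x 0 ≠ 0) : (ster hε (sterInv ε x)).1 = x := by
  conv_rhs => rw [pt_eta x]
  change pt _ _ = _
  rw [conf_sterInv hε hx h, sterInv, smul_smul, mul_inv_cancel₀ h, one_smul]
  congr 1
  linear_combination x 0 * hε

theorem isChart_ster {d : ℕ} {ε : ℝ} (hε : ε ^ 2 = 1) :
    IsChart (ster hε : RR d → Sphere (d + 1)) :=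
  isChart_of_leftInverse (e := Subtype.val) smoothTo_subtype (isPlot_ster hε) (isOpen_compl_pole ε)
    (contDiffOn_sterInv ε)
    (fun a => by
      change 1 - ε * (ster hε a).1 0 ≠ 0
      rw [one_sub_ster_zero]
      exact (conf_pos a).ne')
    (sterInv_ster hε) fun x hx => Subtype.ext (ster_sterInv hε x.2 hx)

theorem injective_fderiv_ster {d : ℕ} {ε : ℝ} (hε : ε ^ 2 = 1) (a : RR d) :
    Function.Injective (fderiv ℝ (fun a => (ster hε a).1) a) :=
  injective_fderiv_of_leftInverse (contDiff_ster hε) (isOpen_compl_pole ε) (contDiffOn_sterInv ε)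
    (fun a => by
      change 1 - ε * (ster hε a).1 0 ≠ 0
      rw [one_sub_ster_zero]
      exact (conf_pos a).ne')
    (sterInv_ster hε) a

theorem mem_range_ster {d : ℕ} {ε : ℝ} (hε : ε ^ 2 = 1) {x : Sphere (d + 1)}
    (h : 1 - ε * x.1 0 ≠ 0) : x ∈ range (ster hε : RR d → Sphere (d + 1)) :=
  ⟨sterInv ε x.1, Subtype.ext (ster_sterInv hε x.2 h)⟩

theorem one_sq : (1 : ℝ) ^ 2 = 1 := one_pow 2

theorem neg_one_sq' : (-1 : ℝ) ^ 2 = 1 := by norm_num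

/-- Every point of the sphere is the image of a point of the unit ball under one of the two
stereographic charts. -/
theorem exists_ster_eq {d : ℕ} {x : RR (d + 1)} (hx : ‖x‖ = 1) :
    ∃ (ε : ℝ) (_ : ε = 1 ∨ ε = -1), 1 - ε * x 0 ≠ 0 ∧ ‖sterInv ε x‖ ≤ 1 := by
  have h : ∀ ε : ℝ, ε ^ 2 = 1 → ε * x 0 ≤ 0 → 1 - ε * x 0 ≠ 0 ∧ ‖sterInv ε x‖ ≤ 1 := by
    intro ε hε h
    have h1 : 1 - ε * x 0 ≠ 0 := by linarith
    refine ⟨h1, ?_⟩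
    have h2 := norm_sterInv_sq hε hx h1
    nlinarith [norm_nonneg (sterInv ε x), sq_nonneg ‖sterInv ε x‖]
  rcases le_total (x 0) 0 with h0 | h0
  · exact ⟨1, Or.inl rfl, h 1 one_sq (by linarith)⟩
  · exact ⟨-1, Or.inr rfl, h (-1) neg_one_sq' (by linarith)⟩

theorem compactlyCovered_sphere (d : ℕ) : CompactlyCovered (Sphere (d + 1)) := by
  refine ⟨d, {ster one_sq, ster neg_one_sq'}, Metric.closedBall 0 1, by simp,
    isCompact_closedBall _ _, ?_, fun x => ?_⟩
  · rintro q (rfl | rfl)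
    exacts [isPlot_ster _, isPlot_ster _]
  · obtain ⟨ε, hε, h1, h2⟩ := exists_ster_eq x.2
    rcases hε with rfl | rfl
    · exact ⟨_, Or.inl rfl, sterInv 1 x.1, by simpa using h2,
        Subtype.ext (ster_sterInv one_sq x.2 h1)⟩
    · exact ⟨_, Or.inr rfl, sterInv (-1) x.1, by simpa using h2,
        Subtype.ext (ster_sterInv neg_one_sq' x.2 h1)⟩

theorem thin_sphere (d : ℕ) : Thin d (univ : Set (Sphere (d + 1))) := by
  refine ((thin_range (isPlot_ster one_sq)).union (thin_range (isPlot_ster neg_one_sq'))).mono ?_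
  intro x _
  obtain ⟨ε, hε, h1, -⟩ := exists_ster_eq x.2
  rcases hε with rfl | rfl
  · exact Or.inl (mem_range_ster one_sq h1)
  · exact Or.inr (mem_range_ster neg_one_sq' h1)

theorem plotSeparated_sphere (n : ℕ) : PlotSeparated (Sphere n) :=
  smoothTo_subtype.plotSeparated Subtype.val_injective

theorem sphere_eq_pole {d : ℕ} {x : RR (d + 1)} (hx : ‖x‖ = 1) (h : 1 - 1 * x 0 = 0) :
    x = pt 1 0 := by
  have h0 : x 0 = 1 := by linarith
  have h1 := norm_sq_eq_zero_add_tl x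
  rw [hx, h0] at h1
  have h2 : tl x = 0 := by
    rw [← norm_eq_zero]
    nlinarith [norm_nonneg (tl x)]
  rw [pt_eta x, h0, h2]

theorem thin_compl_range_ster (d : ℕ) :
    Thin 0 (range (ster one_sq : RR d → Sphere (d + 1)))ᶜ := by
  refine (thin_singleton (⟨pt 1 0, ?_⟩ : Sphere (d + 1))).mono fun x hx => ?_
  · have := norm_pt_sq 1 (0 : RR d)
    rw [norm_zero] at this
    nlinarith [norm_nonneg (pt 1 (0 : RR d))]
  · refine Subtype.ext (sphere_eq_pole x.2 ?_)
    by_contra h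
    exact hx (mem_range_ster one_sq h)

/-- `dθ` is a volume form on the circle. -/
theorem isVolumeForm_dTheta : IsVolumeForm dTheta := by
  have key : ∀ {ε : ℝ} (hε : ε ^ 2 = 1) (u : RR 1),
      coeff dTheta (ster hε) (isChart_ster hε).isPlot u ≠ 0 := by
    intro ε hε u hu
    set p : RR 1 → RR 2 := fun a => (ster hε a).1 with hp
    have hps : ContDiff ℝ ∞ p := contDiff_ster hε
    have hd : ∀ i, DifferentiableAt ℝ (fun a => p a i) u := fun i =>
      ((contDiff_euclidean.1 hps i).differentiable (by simp)).differentiableAt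
    set w : RR 1 := EuclideanSpace.single 0 1 with hw
    set y : Fin 2 → ℝ := fun i => fderiv ℝ (fun a => p a i) u w with hy
    have h1 : p u 0 * y 1 - p u 1 * y 0 = 0 := hu
    have hsq : ∀ a, p a 0 ^ 2 + p a 1 ^ 2 = 1 := by
      intro a
      have h := EuclideanSpace.real_norm_sq_eq (p a)
      rw [(ster hε a).2, Fin.sum_univ_two] at h
      linarith
    have h2 : p u 0 * y 0 + p u 1 * y 1 = 0 := by
      have h3 : HasFDerivAt (fun a => p a 0 ^ 2 + p a 1 ^ 2) _ u :=
        ((hd 0).hasFDerivAt.pow 2).add ((hd 1).hasFDerivAt.pow 2)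
      rw [funext hsq] at h3
      have h4 := congrArg (fun T : RR 1 →L[ℝ] ℝ => T w) (h3.unique (hasFDerivAt_const _ _))
      simp at h4
      simp only [hy]
      linarith
    -- `(y 0, y 1)` is orthogonal both to the unit vector `p u` and to its rotation by a right angle
    have h0 : y 0 = 0 := by linear_combination p u 0 * h2 - p u 1 * h1 - y 0 * hsq u
    have h1' : y 1 = 0 := by linear_combination p u 1 * h2 + p u 0 * h1 - y 1 * hsq u
    have hzero : fderiv ℝ p u w = 0 := by
      ext i
      have h5 : HasFDerivAt p (fderiv ℝ p u) u :=
        (hps.differentiable (by simp)).differentiableAt.hasFDerivAt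
      have h6 := ((EuclideanSpace.proj (𝕜 := ℝ) i).hasFDerivAt.comp u h5).fderiv
      have h7 : (fderiv ℝ p u w) i = y i :=
        (congrArg (fun T : RR 1 →L[ℝ] ℝ => T w) h6).symm
      rw [h7]
      fin_cases i
      exacts [h0, h1']
    have hw0 : w = 0 := injective_fderiv_ster hε u (by
      change fderiv ℝ p u w = fderiv ℝ p u 0
      rw [hzero, map_zero])
    have := congrArg (fun x : RR 1 => x 0) hw0
    simp [hw] at this
  intro x
  obtain ⟨ε, hε, h1, -⟩ := exists_ster_eq x.2
  rcases hε with rfl | rfl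
  · exact ⟨_, isChart_ster one_sq, mem_range_ster one_sq h1, key _⟩
  · exact ⟨_, isChart_ster neg_one_sq', mem_range_ster neg_one_sq' h1, key _⟩

end Spheres

/-! ### Charts of the Stiefel manifold -/

section StiefelCharts

/-- The isometry from `ℝ^d` onto the tangent space of the sphere at `ster a`. -/
def frame {d : ℕ} (ε : ℝ) (a c : RR d) : RR (d + 1) :=
  pt (ε * (conf a * inner ℝ c a)) (c - (conf a * inner ℝ c a) • a)

theorem contDiff_frame {d : ℕ} (ε : ℝ) :
    ContDiff ℝ ∞ fun z : RR d × RR d => frame ε z.1 z.2 := by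
  have h : ContDiff ℝ ∞ fun z : RR d × RR d => conf z.1 * inner ℝ z.2 z.1 :=
    (contDiff_conf.comp contDiff_fst).mul (contDiff_snd.inner ℝ contDiff_fst)
  exact contDiff_pt.comp ((contDiff_snd.sub (h.smul contDiff_fst)).prodMk (contDiff_const.mul h))

theorem norm_frame_eq {d : ℕ} {ε : ℝ} (hε : ε ^ 2 = 1) (a c : RR d) : ‖frame ε a c‖ = ‖c‖ := by
  have h1 := norm_pt_sq (ε * (conf a * inner ℝ c a)) (c - (conf a * inner ℝ c a) • a)
  rw [norm_sub_sq_real, inner_smul_right, norm_smul, mul_pow _ ‖a‖, Real.norm_eq_abs, sq_abs] at h1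
  have h2 := conf_mul a
  have h3 : ‖frame ε a c‖ ^ 2 = ‖c‖ ^ 2 := by
    refine h1.trans ?_
    linear_combination (conf a * inner ℝ c a) ^ 2 * hε + conf a * inner ℝ c a ^ 2 * h2
  exact (sq_eq_sq₀ (norm_nonneg _) (norm_nonneg _)).1 h3

theorem inner_frame_ster {d : ℕ} {ε : ℝ} (hε : ε ^ 2 = 1) (a c : RR d) :
    inner ℝ (frame ε a c) (ster hε a).1 = 0 := by
  refine (inner_pt _ _ _ _).trans ?_
  rw [inner_smul_right, inner_sub_left, inner_smul_left, real_inner_self_eq_norm_sq]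
  have h2 := conf_mul a
  simp only [conj_trivial]
  linear_combination (conf a * inner ℝ c a * (1 - conf a)) * hε - conf a * inner ℝ c a * h2

/-- The inverse of `frame`, as a function of the tangent vector `x` at the point `y`. -/
def frameInv {d : ℕ} (ε : ℝ) (x y : RR (d + 1)) : RR d := tl x + (ε * x 0) • sterInv ε y

theorem frameInv_frame {d : ℕ} {ε : ℝ} (hε : ε ^ 2 = 1) (a c : RR d) :
    frameInv ε (frame ε a c) (ster hε a).1 = c := by
  rw [frameInv, sterInv_ster]
  change c - (conf a * inner ℝ c a) • a + (ε * (ε * (conf a * inner ℝ c a))) • a = c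
  rw [← mul_assoc, ← sq, hε, one_mul, sub_add_cancel]

theorem frame_frameInv {d : ℕ} {ε : ℝ} (hε : ε ^ 2 = 1) {x y : RR (d + 1)} (hy : ‖y‖ = 1)
    (hxy : inner ℝ x y = 0) (h : 1 - ε * y 0 ≠ 0) :
    frame ε (sterInv ε y) (frameInv ε x y) = x := by
  have h1 : inner ℝ (tl x) (sterInv ε y) = (1 - ε * y 0)⁻¹ * (-(x 0 * y 0)) := by
    have h2 := inner_pt (x 0) (y 0) (tl x) (tl y)
    rw [pt_tl, pt_tl, hxy] at h2
    rw [sterInv, inner_smul_right]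
    congr 1
    linarith
  have h2 : conf (sterInv ε y) * inner ℝ (frameInv ε x y) (sterInv ε y) = ε * x 0 := by
    rw [conf_sterInv hε hy h, frameInv, inner_add_left, h1, inner_smul_left,
      real_inner_self_eq_norm_sq]
    have h3 := norm_sterInv_sq hε hy h
    simp only [conj_trivial]
    field_simp
    linear_combination (ε * x 0) * h3 + x 0 * y 0 * hε
  conv_rhs => rw [pt_eta x]
  rw [frame, h2, frameInv, add_sub_cancel_right, ← mul_assoc, ← sq, hε, one_mul]

theorem norm_frameInv {d : ℕ} {ε : ℝ} (hε : ε ^ 2 = 1) {x y : RR (d + 1)} (hx : ‖x‖ = 1)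
    (hy : ‖y‖ = 1) (hxy : inner ℝ x y = 0) (h : 1 - ε * y 0 ≠ 0) : ‖frameInv ε x y‖ = 1 := by
  rw [← norm_frame_eq hε (sterInv ε y), frame_frameInv hε hy hxy h, hx]

variable {L k : ℕ}

theorem smoothTo_stiefel {n : ℕ} : SmoothTo (Subtype.val : Stiefel n → RR n × RR n) :=
  fun _ _ hp => (IsPlot.contDiff hp.1).prodMk (IsPlot.contDiff hp.2)

/-- The chart of the Stiefel manifold given by stereographic projections of the base `S^(n-1)`
(containing `y`) and of the fibre `S^(n-2)` (containing `x`). -/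
def stChart {ε δ : ℝ} (hε : ε ^ 2 = 1) (hδ : δ ^ 2 = 1) (h : L + 1 + L = k) (u : RR k) :
    Stiefel (L + 2) :=
  ⟨(frame ε (fstL h u) (ster hδ (sndL h u)).1, (ster hε (fstL h u)).1),
    by rw [norm_frame_eq hε, (ster hδ (sndL h u)).2], (ster hε (fstL h u)).2,
    inner_frame_ster hε _ _⟩

theorem contDiff_stChart {ε δ : ℝ} (hε : ε ^ 2 = 1) (hδ : δ ^ 2 = 1) (h : L + 1 + L = k) :
    ContDiff ℝ ∞ fun u => (stChart hε hδ h u).1 :=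
  ((contDiff_frame ε).comp ((fstL h).contDiff.prodMk
    ((contDiff_ster hδ).comp (sndL h).contDiff))).prodMk ((contDiff_ster hε).comp (fstL h).contDiff)

theorem isPlot_stChart {ε δ : ℝ} (hε : ε ^ 2 = 1) (hδ : δ ^ 2 = 1) (h : L + 1 + L = k) :
    IsPlot (stChart hε hδ h) :=
  ⟨(contDiff_fst.comp (contDiff_stChart hε hδ h)).isPlot,
    (contDiff_snd.comp (contDiff_stChart hε hδ h)).isPlot⟩

/-- The inverse of `stChart`. -/
def stInv (ε δ : ℝ) (h : L + 1 + L = k) (z : RR (L + 2) × RR (L + 2)) : RR k :=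
  joinE h (sterInv ε z.2) (sterInv δ (frameInv ε z.1 z.2))

/-- The domain of `stInv`. -/
def stDom (L : ℕ) (ε δ : ℝ) : Set (RR (L + 2) × RR (L + 2)) :=
  {z | 1 - ε * z.2 0 ≠ 0} ∩ {z | 1 - δ * frameInv ε z.1 z.2 0 ≠ 0}

theorem contDiffOn_frameInv (ε : ℝ) :
    ContDiffOn ℝ ∞ (fun z : RR (L + 2) × RR (L + 2) => frameInv ε z.1 z.2)
      {z | 1 - ε * z.2 0 ≠ 0} := by
  have h1 : ContDiff ℝ ∞ fun z : RR (L + 2) × RR (L + 2) => ε * z.1 0 := by fun_prop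
  have h2 : ContDiffOn ℝ ∞ (fun z : RR (L + 2) × RR (L + 2) => sterInv ε z.2)
      {z | 1 - ε * z.2 0 ≠ 0} :=
    (contDiffOn_sterInv ε).comp contDiffOn_snd fun z hz => hz
  exact (contDiff_tl.comp contDiff_fst).contDiffOn.add (h1.contDiffOn.smul h2)

theorem isOpen_stDom (ε δ : ℝ) : IsOpen (stDom L ε δ) := by
  have h1 : IsOpen {z : RR (L + 2) × RR (L + 2) | 1 - ε * z.2 0 ≠ 0} :=
    (isOpen_compl_pole ε).preimage continuous_snd
  exact (contDiffOn_frameInv ε).continuousOn.isOpen_inter_preimage h1 (isOpen_compl_pole δ)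

theorem contDiffOn_stInv (ε δ : ℝ) (h : L + 1 + L = k) :
    ContDiffOn ℝ ∞ (stInv ε δ h) (stDom L ε δ) := by
  refine (contDiff_joinE h).comp_contDiffOn (ContDiffOn.prodMk ?_ ?_)
  · exact (contDiffOn_sterInv ε).comp contDiffOn_snd fun z hz => hz.1
  · exact (contDiffOn_sterInv δ).comp ((contDiffOn_frameInv ε).mono inter_subset_left)
      fun z hz => hz.2

theorem stChart_mem_stDom {ε δ : ℝ} (hε : ε ^ 2 = 1) (hδ : δ ^ 2 = 1) (h : L + 1 + L = k)
    (u : RR k) : (stChart hε hδ h u).1 ∈ stDom L ε δ := by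
  constructor
  · change 1 - ε * (ster hε (fstL h u)).1 0 ≠ 0
    rw [one_sub_ster_zero]
    exact (conf_pos _).ne'
  · change 1 - δ * frameInv ε (frame ε (fstL h u) (ster hδ (sndL h u)).1)
      (ster hε (fstL h u)).1 0 ≠ 0
    rw [frameInv_frame, one_sub_ster_zero]
    exact (conf_pos _).ne'

theorem stInv_stChart {ε δ : ℝ} (hε : ε ^ 2 = 1) (hδ : δ ^ 2 = 1) (h : L + 1 + L = k)
    (u : RR k) : stInv ε δ h (stChart hε hδ h u).1 = u := by
  change joinE h (sterInv ε (ster hε (fstL h u)).1) (sterInv δ (frameInv ε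
    (frame ε (fstL h u) (ster hδ (sndL h u)).1) (ster hε (fstL h u)).1)) = u
  rw [frameInv_frame, sterInv_ster, sterInv_ster, joinE_fstL_sndL]

theorem stChart_stInv {ε δ : ℝ} (hε : ε ^ 2 = 1) (hδ : δ ^ 2 = 1) (h : L + 1 + L = k)
    (z : Stiefel (L + 2)) (hz : z.1 ∈ stDom L ε δ) : stChart hε hδ h (stInv ε δ h z.1) = z := by
  refine Subtype.ext (Prod.ext ?_ ?_)
  · change frame ε (fstL h (stInv ε δ h z.1)) (ster hδ (sndL h (stInv ε δ h z.1))).1 = z.1.1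
    rw [stInv, fstL_joinE, sndL_joinE, ster_sterInv hδ _ hz.2,
      frame_frameInv hε z.2.2.1 z.2.2.2 hz.1]
    exact norm_frameInv hε z.2.1 z.2.2.1 z.2.2.2 hz.1
  · change (ster hε (fstL h (stInv ε δ h z.1))).1 = z.1.2
    rw [stInv, fstL_joinE, ster_sterInv hε z.2.2.1 hz.1]

theorem isChart_stChart {ε δ : ℝ} (hε : ε ^ 2 = 1) (hδ : δ ^ 2 = 1) (h : L + 1 + L = k) :
    IsChart (stChart hε hδ h) :=
  isChart_of_leftInverse smoothTo_stiefel (isPlot_stChart hε hδ h) (isOpen_stDom ε δ)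
    (contDiffOn_stInv ε δ h) (stChart_mem_stDom hε hδ h) (stInv_stChart hε hδ h)
    (stChart_stInv hε hδ h)

theorem injective_fderiv_stChart {ε δ : ℝ} (hε : ε ^ 2 = 1) (hδ : δ ^ 2 = 1) (h : L + 1 + L = k)
    (u : RR k) : Function.Injective (fderiv ℝ (fun u => (stChart hε hδ h u).1) u) :=
  injective_fderiv_of_leftInverse (contDiff_stChart hε hδ h) (isOpen_stDom ε δ)
    (contDiffOn_stInv ε δ h) (stChart_mem_stDom hε hδ h) (stInv_stChart hε hδ h) u

theorem exists_stChart_eq (h : L + 1 + L = k) (z : Stiefel (L + 2)) :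
    ∃ (ε δ : ℝ) (hε : ε ^ 2 = 1) (hδ : δ ^ 2 = 1), (ε = 1 ∨ ε = -1) ∧ (δ = 1 ∨ δ = -1) ∧
      ∃ u, ‖fstL h u‖ ≤ 1 ∧ ‖sndL h u‖ ≤ 1 ∧ stChart hε hδ h u = z := by
  have hsq : ∀ ε : ℝ, ε = 1 ∨ ε = -1 → ε ^ 2 = 1 := by
    rintro ε (rfl | rfl)
    exacts [one_sq, neg_one_sq']
  obtain ⟨ε, hε, h1, h2⟩ := exists_ster_eq z.2.2.1
  obtain ⟨δ, hδ, h3, h4⟩ := exists_ster_eq (norm_frameInv (hsq ε hε) z.2.1 z.2.2.1 z.2.2.2 h1)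
  refine ⟨ε, δ, hsq ε hε, hsq δ hδ, hε, hδ, stInv ε δ h z.1, ?_, ?_, ?_⟩
  · rwa [stInv, fstL_joinE]
  · rwa [stInv, sndL_joinE]
  · exact stChart_stInv _ _ h z ⟨h1, h3⟩

theorem compactlyCovered_stiefel (h : L + 1 + L = k) : CompactlyCovered (Stiefel (L + 2)) := by
  refine ⟨k, {stChart one_sq one_sq h, stChart one_sq neg_one_sq' h, stChart neg_one_sq' one_sq h,
    stChart neg_one_sq' neg_one_sq' h}, (fun z : RR (L + 1) × RR L => joinE h z.1 z.2) ''
      (Metric.closedBall 0 1 ×ˢ Metric.closedBall 0 1), by simp,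
    ((isCompact_closedBall _ _).prod (isCompact_closedBall _ _)).image
      (contDiff_joinE h).continuous, ?_, fun z => ?_⟩
  · rintro q (rfl | rfl | rfl | rfl) <;> exact isPlot_stChart _ _ h
  · obtain ⟨ε, δ, hε, hδ, hε', hδ', u, hu, hu', rfl⟩ := exists_stChart_eq h z
    refine ⟨stChart hε hδ h, ?_, u, ⟨(fstL h u, sndL h u), ⟨by simpa using hu, by simpa using hu'⟩,
      joinE_fstL_sndL h u⟩, rfl⟩
    rcases hε' with rfl | rfl <;> rcases hδ' with rfl | rfl <;> simp

theorem thin_stiefel (h : L + 1 + L = k) : Thin k (univ : Set (Stiefel (L + 2))) := by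
  refine (((thin_range (isPlot_stChart one_sq one_sq h)).union
    (thin_range (isPlot_stChart one_sq neg_one_sq' h))).union
    ((thin_range (isPlot_stChart neg_one_sq' one_sq h)).union
    (thin_range (isPlot_stChart neg_one_sq' neg_one_sq' h)))).mono fun z _ => ?_
  obtain ⟨ε, δ, hε, hδ, hε', hδ', u, -, -, rfl⟩ := exists_stChart_eq h z
  rcases hε' with rfl | rfl <;> rcases hδ' with rfl | rfl
  · exact Or.inl (Or.inl ⟨u, rfl⟩)
  · exact Or.inl (Or.inr ⟨u, rfl⟩)
  · exact Or.inr (Or.inl ⟨u, rfl⟩)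
  · exact Or.inr (Or.inr ⟨u, rfl⟩)

theorem plotSeparated_stiefel (n : ℕ) : PlotSeparated (Stiefel n) :=
  smoothTo_stiefel.plotSeparated Subtype.val_injective

theorem norm_pt_one_zero {m : ℕ} : ‖(pt 1 0 : RR (m + 1))‖ = 1 := by
  have := norm_pt_sq 1 (0 : RR m)
  rw [norm_zero] at this
  nlinarith [norm_nonneg (pt 1 (0 : RR m))]

/-- The complement of the main chart: frames with `y` the pole, or with `x` the pole of the fibre
over `y`. -/
theorem thin_compl_range_stChart (h : L + 1 + L = k) :
    Thin (L + 1) (range (stChart one_sq one_sq h))ᶜ := by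
  have hpole : ∀ c : Sphere (L + 1), ‖(pt 0 c.1 : RR (L + 2))‖ = 1 := fun c => by
    have h1 := norm_pt_sq 0 c.1
    rw [c.2] at h1
    nlinarith [norm_nonneg (pt 0 c.1)]
  let f : Sphere (L + 1) → Stiefel (L + 2) := fun c => ⟨(pt 0 c.1, pt 1 0), hpole c,
    norm_pt_one_zero, by rw [inner_pt]; simp⟩
  have hf : DSmooth f := by
    intro m p hp
    have hp' : ContDiff ℝ ∞ fun u => (p u).1 := IsPlot.contDiff hp
    exact ⟨(contDiff_pt.comp (hp'.prodMk contDiff_const)).isPlot, isPlot_const⟩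
  let g : RR (L + 1) → Stiefel (L + 2) := fun a => ⟨(frame 1 a (pt 1 0), (ster one_sq a).1),
    by rw [norm_frame_eq one_sq, norm_pt_one_zero], (ster one_sq a).2, inner_frame_ster one_sq _ _⟩
  have hg : IsPlot g := ⟨((contDiff_frame 1).comp (contDiff_id.prodMk contDiff_const)).isPlot,
    (contDiff_ster one_sq).isPlot⟩
  refine ((((thin_sphere L).image hf).of_le (Nat.le_succ L)).union (thin_range hg)).mono
    fun z hz => ?_
  by_cases h1 : 1 - 1 * z.1.2 0 = 0
  · left
    have hy := sphere_eq_pole z.2.2.1 h1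
    have hx0 : z.1.1 0 = 0 := by
      have h2 := z.2.2.2
      rw [hy, pt_eta z.1.1, inner_pt] at h2
      simpa using h2
    have hx : z.1.1 = pt 0 (tl z.1.1) := by
      conv_lhs => rw [pt_eta z.1.1, hx0]
    have hn : ‖tl z.1.1‖ = 1 := by
      have h2 := norm_pt_sq 0 (tl z.1.1)
      rw [← hx, z.2.1] at h2
      nlinarith [norm_nonneg (tl z.1.1)]
    exact ⟨⟨tl z.1.1, hn⟩, trivial, Subtype.ext (Prod.ext hx.symm hy.symm)⟩
  · right
    have h2 : 1 - 1 * frameInv 1 z.1.1 z.1.2 0 = 0 := by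
      by_contra h2
      exact hz ⟨_, stChart_stInv one_sq one_sq h z ⟨h1, h2⟩⟩
    have hc := sphere_eq_pole (norm_frameInv one_sq z.2.1 z.2.2.1 z.2.2.2 h1) h2
    refine ⟨sterInv 1 z.1.2, Subtype.ext (Prod.ext ?_ (ster_sterInv one_sq z.2.2.1 h1))⟩
    change frame 1 (sterInv 1 z.1.2) (pt 1 0) = z.1.1
    rw [← hc, frame_frameInv one_sq z.2.2.1 z.2.2.2 h1]

end StiefelCharts

/-! ### The cylinder over a plot and the orientation of the Stiefel manifold -/

section Cylinder

variable {X Y : Type} [DiffeologicalSpace X] [DiffeologicalSpace Y]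

theorem DForm.val_congr {k m : ℕ} (α : DForm X k) {p q : RR m → X} (hp : IsPlot p) (hq : IsPlot q)
    (h : p = q) (u : RR m) : α.val p hp u = α.val q hq u := by
  subst h
  rfl

theorem coeff_congr {k : ℕ} (α : DForm X k) {p q : RR k → X} (hp : IsPlot p) (hq : IsPlot q)
    (h : p = q) (u : RR k) : coeff α p hp u = coeff α q hq u := by
  subst h
  rfl

theorem hasFDerivAt_pt_comp_tl {m l : ℕ} {g : RR l → RR m} (hg : ContDiff ℝ ∞ g)
    (z : RR (l + 1)) : HasFDerivAt (fun z : RR (l + 1) => pt (z 0) (g (tl z)))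
      (((incl m).comp ((fderiv ℝ g (tl z)).comp (tlL l))) +
        (EuclideanSpace.proj (𝕜 := ℝ) (0 : Fin (l + 1))).smulRight (pt 1 0)) z := by
  have h : (fun z : RR (l + 1) => pt (z 0) (g (tl z))) = fun z =>
      incl m (g (tlL l z)) + (EuclideanSpace.proj (𝕜 := ℝ) (0 : Fin (l + 1))) z •
        (pt 1 0 : RR (m + 1)) := by
    funext z
    ext i
    refine Fin.cases ?_ (fun i => ?_) i <;> simp
  rw [h]
  have hg' : HasFDerivAt g (fderiv ℝ g (tl z)) (tlL l z) :=
    (hg.differentiable (by simp)).differentiableAt.hasFDerivAt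
  exact ((incl m).hasFDerivAt.comp z (hg'.comp z (tlL l).hasFDerivAt)).add
    (((EuclideanSpace.proj (𝕜 := ℝ) (0 : Fin (l + 1))).hasFDerivAt).smul_const _)

theorem single_zero_eq_pt {m : ℕ} : (EuclideanSpace.single 0 1 : RR (m + 1)) = pt 1 0 := by
  ext i
  refine Fin.cases ?_ (fun i => ?_) i <;> simp

theorem single_succ_eq_pt {m : ℕ} (i : Fin m) :
    (EuclideanSpace.single i.succ 1 : RR (m + 1)) = pt 0 (EuclideanSpace.single i 1) := by
  ext j
  refine Fin.cases ?_ (fun j => ?_) j <;> simp [PiLp.single_apply]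

theorem contract_basis {k : ℕ} (A : RR (k + 1) [⋀^Fin (k + 1)]→L[ℝ] ℝ) :
    contract rfl A (fun i => EuclideanSpace.single i 1) =
      A fun i => EuclideanSpace.single i 1 := by
  rw [contract_apply]
  refine congrArg A (funext fun i => ?_)
  refine Fin.cases ?_ (fun i => ?_) i
  · exact single_zero_eq_pt.symm
  · exact (single_succ_eq_pt i).symm

/-- The point of the unit circle with angle `2πt`. -/
def angle (t : ℝ) : Sphere 2 :=
  ⟨!₂[Real.cos (2 * Real.pi * t), Real.sin (2 * Real.pi * t)], by
    have h := EuclideanSpace.real_norm_sq_eq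
      (!₂[Real.cos (2 * Real.pi * t), Real.sin (2 * Real.pi * t)] : RR 2)
    rw [Fin.sum_univ_two] at h
    simp only [Matrix.cons_val_zero, Matrix.cons_val_one, Real.cos_sq_add_sin_sq] at h
    nlinarith [norm_nonneg (!₂[Real.cos (2 * Real.pi * t), Real.sin (2 * Real.pi * t)] : RR 2)]⟩

theorem contDiff_angle : ContDiff ℝ ∞ fun t => (angle t).1 := by
  rw [contDiff_euclidean]
  intro i
  fin_cases i
  · change ContDiff ℝ ∞ fun t => Real.cos (2 * Real.pi * t)
    fun_prop
  · change ContDiff ℝ ∞ fun t => Real.sin (2 * Real.pi * t)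
    fun_prop

/-- The cylinder `(t, u) ↦ (angle t, p u)` over a plot `p`. -/
def cyl {m : ℕ} (p : RR m → X) (z : RR (m + 1)) : Sphere 2 × X := (angle (z 0), p (tl z))

theorem isPlot_cyl {m : ℕ} {p : RR m → X} (hp : IsPlot p) : IsPlot (cyl p) := by
  have h : ContDiff ℝ ∞ fun z : RR (m + 1) => (angle (z 0)).1 :=
    contDiff_angle.comp (by fun_prop)
  exact ⟨h.isPlot, isPlot_reparam hp contDiff_tl⟩

/-- The negative of the contraction of a form on `S¹ × X` with `∂_t`, restricted to the slice at
`t = 1/4`. For odd `k` the sign makes the product `quarterSlice β ∧ dθ` a positive multiple of `β`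
on that slice, since `dt` has to be moved past a form of degree `k`. -/
def quarterSlice {k : ℕ} (β : DForm (Sphere 2 × X) (k + 1)) : DForm X k where
  val p hp u := -contract rfl (β.val (cyl p) (isPlot_cyl hp) (pt (1 / 4) u))
  smooth {m} p hp := by
    refine contDiff_alt fun w => ?_
    have h : ∀ u, (-contract rfl (β.val (cyl p) (isPlot_cyl hp) (pt (1 / 4) u))) w =
        -β.val (cyl p) (isPlot_cyl hp) (pt (1 / 4) u) (Fin.cons (pt 1 0) fun i => pt 0 (w i)) :=
      fun u => congrArg Neg.neg (contract_apply rfl _ _)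
    simp only [h]
    exact ((ContinuousAlternatingMap.apply ℝ (RR (m + 1)) ℝ _).contDiff.comp
      ((β.smooth _ (isPlot_cyl hp)).comp
        (contDiff_pt.comp (contDiff_id.prodMk contDiff_const)))).neg
  compat {m l} p hp g hg u := by
    have hG : ContDiff ℝ ∞ fun z : RR (l + 1) => pt (z 0) (g (tl z)) :=
      contDiff_pt.comp ((hg.comp contDiff_tl).prodMk (by fun_prop))
    have hc := β.compat (cyl p) (isPlot_cyl hp) _ hG (pt (1 / 4) u)
    ext w
    change -(contract rfl (β.val (cyl p ∘ fun z : RR (l + 1) => pt (z 0) (g (tl z))) _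
      (pt (1 / 4) u)) w) = -contract rfl (β.val (cyl p) (isPlot_cyl hp) (pt (1 / 4) (g u)))
        (fun i => fderiv ℝ g u (w i))
    rw [hc, (hasFDerivAt_pt_comp_tl hg _).fderiv, contract_apply, contract_apply,
      ContinuousAlternatingMap.compContinuousLinearMap_apply]
    congr 2
    funext i
    refine Fin.cases ?_ (fun i => ?_) i
    · have h0 : tlL l (pt 1 0) = 0 := rfl
      ext r
      refine Fin.cases ?_ (fun r => ?_) r <;> simp [h0]
    · simp

theorem coeff_quarterSlice {k : ℕ} (β : DForm (Sphere 2 × X) (k + 1)) {p : RR k → X}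
    (hp : IsPlot p) (u : RR k) : coeff (quarterSlice β) p hp u =
      -coeff β (cyl p) (isPlot_cyl hp) (pt (1 / 4) u) :=
  congrArg Neg.neg (contract_basis _)

/-- The form `α ∧ dθ` on `S¹ × X`. -/
def wedgeDTheta {k : ℕ} (α : DForm X k) : DForm (Sphere 2 × X) (k + 1) :=
  DForm.wedge rfl (α.pullback Prod.snd dSmooth_snd) (dTheta.pullback Prod.fst dSmooth_fst)

theorem dTheta_val_angle {m : ℕ} (z : RR (m + 1)) (h : IsPlot fun z : RR (m + 1) => angle (z 0)) :
    dTheta.val (fun z : RR (m + 1) => angle (z 0)) h z (fun _ => pt 1 0) = 2 * Real.pi := by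
  have h0 : HasFDerivAt (fun z : RR (m + 1) => 2 * Real.pi * z 0)
      ((2 * Real.pi) • EuclideanSpace.proj (𝕜 := ℝ) (0 : Fin (m + 1))) z :=
    (EuclideanSpace.proj (𝕜 := ℝ) (0 : Fin (m + 1))).hasFDerivAt.const_mul _
  change Real.cos (2 * Real.pi * z 0) *
      fderiv ℝ (fun z : RR (m + 1) => Real.sin (2 * Real.pi * z 0)) z (pt 1 0) -
    Real.sin (2 * Real.pi * z 0) *
      fderiv ℝ (fun z : RR (m + 1) => Real.cos (2 * Real.pi * z 0)) z (pt 1 0) = _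
  rw [h0.sin.fderiv, h0.cos.fderiv]
  have h1 : EuclideanSpace.proj (𝕜 := ℝ) (0 : Fin (m + 1)) (pt 1 0 : RR (m + 1)) = 1 := rfl
  simp only [_root_.smul_apply, h1, smul_eq_mul]
  linear_combination (2 * Real.pi) * Real.cos_sq_add_sin_sq (2 * Real.pi * z 0)

theorem coeff_wedgeDTheta {k : ℕ} (α : DForm X k) {p : RR k → X} (hp : IsPlot p)
    (z : RR (k + 1)) : coeff (wedgeDTheta α) (cyl p) (isPlot_cyl hp) z =
      (-1) ^ k * (coeff α p hp (tl z) * (2 * Real.pi)) := by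
  have h1 : (α.pullback Prod.snd dSmooth_snd).val (cyl p) (isPlot_cyl hp) z =
      (α.val p hp (tl z)).compContinuousLinearMap (tlL k) := by
    have h := α.compat p hp tl contDiff_tl z
    rw [show fderiv ℝ (tl : RR (k + 1) → RR k) z = tlL k from (tlL k).fderiv] at h
    exact h
  rw [coeff, ← contract_basis]
  change contract rfl (DForm.wedgeAlt _ ((α.pullback Prod.snd dSmooth_snd).val (cyl p)
    (isPlot_cyl hp) z) _) _ = _
  rw [h1, contract_wedgeAlt (l := 0) rfl]
  change (-1 : ℝ) ^ k * DForm.wedgeAlt _ _ _ _ = _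
  rw [wedgeAlt_eq_mul]
  · congr 2
    rw [contract_apply]
    refine Eq.trans ?_ (dTheta_val_angle z (isPlot_cyl hp).1)
    refine congrArg (dTheta.val (fun z : RR (k + 1) => angle (z 0)) _ z) (funext fun i => ?_)
    fin_cases i
    rfl
  · rintro x ⟨i, r, hx⟩
    exact r.elim0

end Cylinder

/-! ### Signs -/

section Signs

theorem sign_eq_of_continuousOn {s : Set ℝ} (hs : IsPreconnected s) {f : ℝ → ℝ}
    (hf : ContinuousOn f s) (hne : ∀ t ∈ s, f t ≠ 0) {a b : ℝ} (ha : a ∈ s) (hb : b ∈ s) :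
    SignType.sign (f a) = SignType.sign (f b) := by
  have key : ∀ {a b : ℝ}, a ∈ s → b ∈ s → 0 < f a → f b < 0 → False := by
    intro a b ha hb h1 h2
    obtain ⟨c, hc, hc0⟩ := hs.intermediate_value hb ha hf ⟨h2.le, h1.le⟩
    exact hne c hc hc0
  rcases lt_or_gt_of_ne (hne a ha) with h1 | h1 <;> rcases lt_or_gt_of_ne (hne b hb) with h2 | h2
  · rw [sign_neg h1, sign_neg h2]
  · exact (key hb ha h2 h1).elim
  · exact (key ha hb h1 h2).elim
  · rw [sign_pos h1, sign_pos h2]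

/-- In even dimension, multiplication with `e^{iπs}` for a complex structure is a path of isometries
from the identity to the antipodal map. -/
theorem exists_rotation {n : ℕ} (hn : Even n) : ∃ R : ℝ → (RR n →L[ℝ] RR n), ContDiff ℝ ∞ R ∧
    (∀ s x, ‖R s x‖ = ‖x‖) ∧ (∀ x, R 0 x = x) ∧ ∀ x, R 1 x = -x := by
  obtain ⟨r, rfl⟩ := hn
  let E := EuclideanSpace ℂ (Fin r)
  let _ : InnerProductSpace ℝ E := InnerProductSpace.complexToReal
  have : FiniteDimensional ℝ E := FiniteDimensional.complexToReal E
  have hE : Module.finrank ℝ E = r + r := by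
    rw [finrank_real_of_complex, finrank_euclideanSpace, Fintype.card_fin, two_mul]
  let T : E ≃ₗᵢ[ℝ] RR (r + r) := ((stdOrthonormalBasis ℝ E).reindex (finCongr hE)).repr
  let J : E →L[ℝ] E := LinearMap.toContinuousLinearMap
    { toFun := fun z => Complex.I • z
      map_add' := fun x y => smul_add _ _ _
      map_smul' := fun c x => smul_comm _ _ _ }
  let J' : RR (r + r) →L[ℝ] RR (r + r) :=
    (T.toContinuousLinearEquiv : E →L[ℝ] RR (r + r)).comp
      (J.comp (T.symm.toContinuousLinearEquiv : RR (r + r) →L[ℝ] E))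
  refine ⟨fun s => Real.cos (Real.pi * s) • ContinuousLinearMap.id ℝ _ +
    Real.sin (Real.pi * s) • J', ?_, fun s x => ?_, fun x => ?_, fun x => ?_⟩
  · have h1 : ContDiff ℝ ∞ fun s : ℝ => Real.cos (Real.pi * s) := by fun_prop
    have h2 : ContDiff ℝ ∞ fun s : ℝ => Real.sin (Real.pi * s) := by fun_prop
    exact (h1.smul contDiff_const).add (h2.smul contDiff_const)
  · have h : (Real.cos (Real.pi * s) • ContinuousLinearMap.id ℝ _ +
        Real.sin (Real.pi * s) • J' : RR (r + r) →L[ℝ] RR (r + r)) x =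
        T (((Real.cos (Real.pi * s) : ℂ) + Real.sin (Real.pi * s) * Complex.I) • T.symm x) := by
      rw [add_smul, mul_smul, map_add]
      have h1 : ∀ (c : ℝ) (z : E), (c : ℂ) • z = c • z := fun c z => rfl
      rw [h1, h1, map_smul, map_smul, T.apply_symm_apply]
      rfl
    rw [h, T.norm_map, norm_smul, T.symm.norm_map, Complex.ofReal_cos, Complex.ofReal_sin,
      ← Complex.exp_mul_I]
    rw [Complex.norm_exp_ofReal_mul_I, one_mul]
  · simp
  · simp

end Signs

/-! ### Products of volume forms -/

section ProductForms

variable {M N : Type} [DiffeologicalSpace M] [DiffeologicalSpace N]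

/-- The exterior product of forms on the factors is a volume form on `M × N`. -/
theorem IsVolumeForm.prod {a b c : ℕ} (h : a + b = c) {α : DForm M a} {β : DForm N b}
    (hα : IsVolumeForm α) (hβ : IsVolumeForm β) :
    IsVolumeForm (DForm.wedge h (α.pullback (Prod.fst : M × N → M) dSmooth_fst)
      (β.pullback (Prod.snd : M × N → N) dSmooth_snd)) := by
  rintro ⟨x, y⟩
  obtain ⟨φ, hφ, ⟨u, rfl⟩, hne⟩ := hα x
  obtain ⟨ψ, hψ, ⟨v, rfl⟩, hne'⟩ := hβ y
  refine ⟨_, hφ.prodMk hψ (fstL h) (sndL h) (fun z => joinE h z.1 z.2) (contDiff_joinE h)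
    (fun z => fstL_joinE h _ _) (fun z => sndL_joinE h _ _) (joinE_fstL_sndL h),
    ⟨joinE h u v, by simp⟩, fun w => ?_⟩
  rw [coeff_wedge_pullback h α β dSmooth_fst dSmooth_snd _ hφ.isPlot hψ.isPlot rfl rfl]
  exact mul_ne_zero (hne _) (hne' _)

theorem isVolumeForm_wedgeDTheta {k : ℕ} {α : DForm M k} (hα : IsVolumeForm α) :
    IsVolumeForm (wedgeDTheta α) := by
  rintro ⟨y, x⟩
  obtain ⟨φ, hφ, ⟨u, rfl⟩, hne⟩ := hα x
  obtain ⟨ψ, hψ, ⟨v, rfl⟩, hne'⟩ := isVolumeForm_dTheta y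
  have hJ : ContDiff ℝ ∞ fun z : RR 1 × RR k => joinE (rfl : k + 1 = k + 1) z.2 z.1 :=
    (contDiff_joinE rfl).comp (contDiff_snd.prodMk contDiff_fst)
  refine ⟨_, hψ.prodMk hφ (sndL rfl) (fstL rfl) (fun z => joinE rfl z.2 z.1) hJ
    (fun z => sndL_joinE rfl _ _) (fun z => fstL_joinE rfl _ _) (joinE_fstL_sndL rfl),
    ⟨joinE rfl u v, by simp⟩, fun w => ?_⟩
  rw [wedgeDTheta, coeff_wedge_pullback rfl α dTheta dSmooth_snd dSmooth_fst _ hφ.isPlot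
    hψ.isPlot rfl rfl]
  exact mul_ne_zero (hne _) (hne' _)

/-- The form `pr₁^*α ∧ pr₂^*α` on `M × M`. -/
def sqForm {a c : ℕ} (h : a + a = c) (α : DForm M a) : DForm (M × M) c :=
  DForm.wedge h (α.pullback Prod.fst dSmooth_fst) (α.pullback Prod.snd dSmooth_snd)

/-- Forms in plots that differ by an affine reparametrisation. -/
theorem compat_affine {k m l : ℕ} (α : DForm M k) {p : RR m → M} (hp : IsPlot p)
    (T : RR l →L[ℝ] RR m) (c : RR m) {q : RR l → M} (hq : IsPlot q)
    (hpq : ∀ u, q u = p (T u + c)) (u : RR l) :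
    α.val q hq u = (α.val p hp (T u + c)).compContinuousLinearMap T := by
  obtain rfl : q = p ∘ fun u => T u + c := funext hpq
  rw [α.compat p hp (fun u => T u + c) (T.contDiff.add contDiff_const) u]
  congr 1
  rw [fderiv_add_const, T.fderiv]

end ProductForms

/-! ### The Gauss map along a chart of the Stiefel manifold -/

section GaussMap

variable {n k : ℕ}

theorem smoothTo_spheres :
    SmoothTo (E := RR n × RR n) fun w : Sphere n × Sphere n => (w.1.1, w.2.1) :=
  fun m p hp => by
    have h1 : ContDiff ℝ ∞ fun u => (p u).1.1 := IsPlot.contDiff hp.1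
    have h2 : ContDiff ℝ ∞ fun u => (p u).2.1 := IsPlot.contDiff hp.2
    exact h1.prodMk h2

theorem plotSeparated_spheres : PlotSeparated (Sphere n × Sphere n) :=
  (plotSeparated_sphere n).prod (plotSeparated_sphere n)

/-- Off the zeros of `sin`, the map `(t, x, y) ↦ (y, T (sin t x + cos t y))` is an immersion for
every linear isomorphism `T`: if `dy = 0`, then `dx` is orthogonal to `y`. -/
theorem injective_fderiv_gauss {x y : RR k → RR n} (hx : ContDiff ℝ ∞ x) (hy : ContDiff ℝ ∞ y)
    (hyy : ∀ u, ‖y u‖ = 1) (hxy : ∀ u, inner ℝ (x u) (y u) = 0) (T : RR n →L[ℝ] RR n)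
    (hT : Function.Injective T) (z : RR (k + 1)) (hz : Real.sin (2 * Real.pi * z 0) ≠ 0)
    (hinj : Function.Injective (fderiv ℝ (fun u => (x u, y u)) (tl z))) :
    Function.Injective (fderiv ℝ (fun z : RR (k + 1) => (y (tl z),
      T (Real.sin (2 * Real.pi * z 0) • x (tl z) +
        Real.cos (2 * Real.pi * z 0) • y (tl z)))) z) := by
  set X := fderiv ℝ x (tl z)
  set Y := fderiv ℝ y (tl z)
  have hX : HasFDerivAt x X (tl z) := (hx.differentiable (by simp)).differentiableAt.hasFDerivAt
  have hY : HasFDerivAt y Y (tl z) := (hy.differentiable (by simp)).differentiableAt.hasFDerivAt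
  have hX' : HasFDerivAt (fun z : RR (k + 1) => x (tl z)) (X.comp (tlL k)) z :=
    HasFDerivAt.comp (f := tl) z hX (tlL k).hasFDerivAt
  have hY' : HasFDerivAt (fun z : RR (k + 1) => y (tl z)) (Y.comp (tlL k)) z :=
    HasFDerivAt.comp (f := tl) z hY (tlL k).hasFDerivAt
  have h0 : HasFDerivAt (fun z : RR (k + 1) => 2 * Real.pi * z 0)
      ((2 * Real.pi) • EuclideanSpace.proj (𝕜 := ℝ) (0 : Fin (k + 1))) z :=
    (EuclideanSpace.proj (𝕜 := ℝ) (0 : Fin (k + 1))).hasFDerivAt.const_mul _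
  have hD := hY'.prodMk (T.hasFDerivAt.comp z ((h0.sin.smul hX').add (h0.cos.smul hY')))
  rw [(hX.prodMk hY).fderiv] at hinj
  refine (congrArg (fun S : RR (k + 1) →L[ℝ] RR n × RR n => Function.Injective S)
    (HasFDerivAt.fderiv hD)).mpr ?_
  refine (injective_iff_map_eq_zero _).2 fun w hw => ?_
  have h1 : Y (tl w) = 0 := congrArg Prod.fst hw
  have h2 : T (Real.sin (2 * Real.pi * z 0) • X (tl w) +
      (Real.cos (2 * Real.pi * z 0) * (2 * Real.pi * w 0)) • x (tl z) +
      (Real.cos (2 * Real.pi * z 0) • Y (tl w) +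
      (-Real.sin (2 * Real.pi * z 0) * (2 * Real.pi * w 0)) • y (tl z))) = 0 :=
    congrArg Prod.snd hw
  rw [h1, smul_zero, zero_add] at h2
  have h3 := (injective_iff_map_eq_zero _).1 hT _ h2
  have h4 : inner ℝ (X (tl w)) (y (tl z)) = 0 := by
    have h5 := hX.inner ℝ hY
    have h6 : HasFDerivAt (fun u => inner ℝ (x u) (y u)) (0 : RR k →L[ℝ] ℝ) (tl z) := by
      rw [funext hxy]
      exact hasFDerivAt_const _ _
    have h7 := congrArg (fun S : RR k →L[ℝ] ℝ => S (tl w)) (h5.unique h6)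
    simp only [ContinuousLinearMap.comp_apply, ContinuousLinearMap.prod_apply,
      fderivInnerCLM_apply, h1, inner_zero_right, zero_add] at h7
    exact h7
  have h5 := congrArg (fun v => inner ℝ v (y (tl z))) h3
  simp only [inner_add_left, inner_smul_left, h4, hxy, real_inner_self_eq_norm_sq, hyy,
    inner_zero_left, conj_trivial] at h5
  have hw0 : w 0 = 0 := by
    have h6 : Real.sin (2 * Real.pi * z 0) * (2 * Real.pi) * w 0 = 0 := by linarith
    exact (mul_eq_zero.1 h6).resolve_left (mul_ne_zero hz (by positivity))
  rw [hw0] at h3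
  have h6 : X (tl w) = 0 := by
    simpa [hz] using h3
  have h7 : tl w = 0 := (injective_iff_map_eq_zero _).1 hinj _ (Prod.ext h6 h1)
  rw [pt_eta w, hw0, h7]
  exact (incl k).map_zero

theorem coeff_gauss_ne_zero {τ : DForm (Sphere n × Sphere n) (k + 1)} (hτ : IsVolumeForm τ)
    {ψ : RR k → Stiefel n} (hψ : IsPlot ψ)
    (hinj : ∀ u, Function.Injective (fderiv ℝ (fun u => (ψ u).1) u)) (z : RR (k + 1))
    (hz : Real.sin (2 * Real.pi * z 0) ≠ 0) :
    coeff (τ.pullback gaussMap dSmooth_gaussMap) (cyl ψ) (isPlot_cyl hψ) z ≠ 0 :=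
  hτ.coeff_ne_zero (ψ := gaussMap ∘ cyl ψ) smoothTo_spheres _
    (injective_fderiv_gauss (IsPlot.contDiff hψ.1) (IsPlot.contDiff hψ.2)
      (fun u => (ψ u).2.2.1) (fun u => (ψ u).2.2.2) (ContinuousLinearMap.id ℝ _)
      Function.injective_id z hz (hinj _))

/-- The coefficients of a volume form along the Gauss map have the same sign at `t` and at
`t + 1/2`, provided that `n` is even: the two values of `sin t x + cos t y` are antipodal, and are
joined by a path of isometries. -/
theorem sign_coeff_gauss_add_half (hn : Even n) {τ : DForm (Sphere n × Sphere n) (k + 1)}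
    (hτ : IsVolumeForm τ) {ψ : RR k → Stiefel n} (hψ : IsPlot ψ)
    (hinj : ∀ u, Function.Injective (fderiv ℝ (fun u => (ψ u).1) u)) (z : RR (k + 1))
    (hz : Real.sin (2 * Real.pi * z 0) ≠ 0) :
    SignType.sign (coeff (τ.pullback gaussMap dSmooth_gaussMap) (cyl ψ) (isPlot_cyl hψ)
      (z + pt (1 / 2) 0)) =
    SignType.sign (coeff (τ.pullback gaussMap dSmooth_gaussMap) (cyl ψ) (isPlot_cyl hψ) z) := by
  obtain ⟨R, hR, hnorm, hR0, hR1⟩ := exists_rotation hn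
  have hΓ : IsPlot (gaussMap ∘ cyl ψ) := dSmooth_gaussMap _ _ (isPlot_cyl hψ)
  -- the first of the `k + 2` parameters runs through the path from the identity to the
  -- antipodal map
  let Q : RR (k + 2) → Sphere n × Sphere n := fun y => ((gaussMap (cyl ψ (tl y))).1,
    ⟨R (y 0) (gaussMap (cyl ψ (tl y))).2.1, by rw [hnorm, (gaussMap (cyl ψ (tl y))).2.2]⟩)
  have hQ : IsPlot Q := by
    have h0 : ContDiff ℝ ∞ fun z => (gaussMap (cyl ψ z)).2.1 := IsPlot.contDiff hΓ.2
    have h1 : ContDiff ℝ ∞ fun y : RR (k + 2) => (gaussMap (cyl ψ (tl y))).2.1 :=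
      h0.comp contDiff_tl
    have h2 : ContDiff ℝ ∞ fun y : RR (k + 2) => R (y 0) := hR.comp (by fun_prop)
    exact ⟨isPlot_reparam hΓ.1 contDiff_tl, (h2.clm_apply h1).isPlot⟩
  have hslice : ∀ s : ℝ, ContDiff ℝ ∞ fun z : RR (k + 1) => pt s z := fun s =>
    contDiff_pt.comp (contDiff_id.prodMk contDiff_const)
  have hQs : ∀ s, IsPlot fun z => Q (pt s z) := fun s => isPlot_reparam hQ (hslice s)
  have hval : ∀ s, coeff τ _ (hQs s) z =
      τ.val Q hQ (pt s z) fun i => pt 0 (EuclideanSpace.single i 1) := by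
    intro s
    have h := τ.compat Q hQ _ (hslice s) z
    rw [(hasFDerivAt_pt s z).fderiv] at h
    exact congrArg (fun a => a fun i => EuclideanSpace.single i 1) h
  have hcont : Continuous fun s => coeff τ _ (hQs s) z := by
    simp only [hval]
    exact (((ContinuousAlternatingMap.apply ℝ (RR (k + 2)) ℝ _).contDiff.comp
      ((τ.smooth Q hQ).comp (contDiff_pt.comp (contDiff_const.prodMk contDiff_id))))).continuous
  have hne : ∀ s, coeff τ _ (hQs s) z ≠ 0 := fun s =>
    hτ.coeff_ne_zero smoothTo_spheres _
      (injective_fderiv_gauss (IsPlot.contDiff hψ.1) (IsPlot.contDiff hψ.2)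
        (fun u => (ψ u).2.2.1) (fun u => (ψ u).2.2.2) (R s)
        ((injective_iff_map_eq_zero _).2 fun x hx => by
          rw [← norm_eq_zero, ← hnorm s, hx, norm_zero]) z hz (hinj _))
  have hsign := sign_eq_of_continuousOn isPreconnected_univ hcont.continuousOn
    (fun s _ => hne s) (mem_univ 1) (mem_univ 0)
  have h0 : coeff τ _ (hQs 0) z = coeff τ _ hΓ z :=
    coeff_congr τ (hQs 0) hΓ (funext fun z => Prod.ext rfl (Subtype.ext (hR0 _))) z
  have h1 : coeff τ _ (hQs 1) z = coeff τ _ hΓ (z + pt (1 / 2) 0) := by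
    have hmul : ∀ t : ℝ, 2 * Real.pi * (t + 1 / 2) = 2 * Real.pi * t + Real.pi := fun t => by ring
    have h := compat_affine τ hΓ (ContinuousLinearMap.id ℝ _) (pt (1 / 2) 0) (hQs 1) (fun z => by
      have htl : tl (z + pt (1 / 2) 0) = tl z := by
        ext i
        simp [tl]
      refine Prod.ext (Subtype.ext ?_) (Subtype.ext ?_)
      · change (ψ (tl z)).1.2 = (ψ (tl (z + pt (1 / 2) 0))).1.2
        rw [htl]
      · refine (hR1 _).trans ?_
        change -(Real.sin (2 * Real.pi * z 0) • (ψ (tl z)).1.1 +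
          Real.cos (2 * Real.pi * z 0) • (ψ (tl z)).1.2) =
          Real.sin (2 * Real.pi * (z 0 + 1 / 2)) • (ψ (tl (z + pt (1 / 2) 0))).1.1 +
          Real.cos (2 * Real.pi * (z 0 + 1 / 2)) • (ψ (tl (z + pt (1 / 2) 0))).1.2
        rw [htl, hmul, Real.sin_add_pi, Real.cos_add_pi, neg_smul, neg_smul, neg_add]) z
    exact congrArg (fun a => a fun i => EuclideanSpace.single i 1) h
  rw [h0, h1] at hsign
  exact hsign

/-- The orientation `σ` of the Stiefel manifold obtained from the orientation of `S^(n-1) × S^(n-1)`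
by contracting `f^*τ` with `-∂_t` at `t = 1/4` is such that `f` preserves orientations at every
point where `sin` does not vanish. -/
theorem sign_coeff_wedgeDTheta (hn : Even n) (hk : Odd k)
    {τ : DForm (Sphere n × Sphere n) (k + 1)}
    (hτ : IsVolumeForm τ) {ψ : RR k → Stiefel n} (hψ : IsPlot ψ)
    (hinj : ∀ u, Function.Injective (fderiv ℝ (fun u => (ψ u).1) u)) (z : RR (k + 1))
    (h0 : z 0 ∈ Ioo (0 : ℝ) 1) (hz : Real.sin (2 * Real.pi * z 0) ≠ 0) :
    SignType.sign (coeff (wedgeDTheta (quarterSlice (τ.pullback gaussMap dSmooth_gaussMap)))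
      (cyl ψ) (isPlot_cyl hψ) z) =
    SignType.sign (coeff (τ.pullback gaussMap dSmooth_gaussMap) (cyl ψ) (isPlot_cyl hψ) z) := by
  set J : RR (k + 1) → ℝ :=
    coeff (τ.pullback gaussMap dSmooth_gaussMap) (cyl ψ) (isPlot_cyl hψ) with hJ
  have hcont : Continuous J :=
    (contDiff_coeff _ _ _).continuous
  have hfirst : ∀ t ∈ Ioo (0 : ℝ) (1 / 2), ∀ u,
      SignType.sign (J (pt t u)) = SignType.sign (J (pt (1 / 4) u)) := by
    intro t ht u
    refine sign_eq_of_continuousOn (f := fun t => J (pt t u)) isPreconnected_Ioo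
      (hcont.comp (contDiff_pt.comp (contDiff_const.prodMk contDiff_id)).continuous).continuousOn
      (fun s hs => coeff_gauss_ne_zero hτ hψ hinj _ (Real.sin_pos_of_pos_of_lt_pi ?_ ?_).ne') ht
      ⟨by norm_num, by norm_num⟩
    · have := hs.1
      rw [pt_zero]
      positivity
    · rw [pt_zero]
      nlinarith [Real.pi_pos, hs.2]
  have hall : SignType.sign (J z) = SignType.sign (J (pt (1 / 4) (tl z))) := by
    rcases lt_trichotomy (z 0) (1 / 2) with h | h | h
    · rw [← hfirst (z 0) ⟨h0.1, h⟩, pt_tl]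
    · refine absurd ?_ hz
      rw [h, show 2 * Real.pi * (1 / 2) = Real.pi by ring, Real.sin_pi]
    · rw [← hfirst (z 0 - 1 / 2) ⟨by linarith, by linarith [h0.2]⟩]
      have hz' : z = pt (z 0 - 1 / 2) (tl z) + pt (1 / 2) 0 := by
        ext i
        refine Fin.cases ?_ (fun i => ?_) i <;> simp [tl]
      conv_lhs => rw [hz']
      refine sign_coeff_gauss_add_half hn hτ hψ hinj _ ?_
      rw [pt_zero, mul_sub, show 2 * Real.pi * (1 / 2) = Real.pi by ring, Real.sin_sub_pi]
      exact neg_ne_zero.2 hz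
  rw [hall, coeff_wedgeDTheta _ hψ, coeff_quarterSlice, hk.neg_one_pow, ← hJ]
  rw [show -1 * (-J (pt (1 / 4) (tl z)) * (2 * Real.pi)) = 2 * Real.pi * J (pt (1 / 4) (tl z)) by
    ring, sign_mul, sign_pos (by positivity), one_mul]

end GaussMap

/-! ### The degree of the Gauss map -/

section Degree

variable {M : Type} [DiffeologicalSpace M]

/-- An injective plot on an open set computes integrals if the complement of its image is covered by
plots of lower dimension. -/
theorem OrientedPartition.integral_eq_of_thin {k : ℕ} {τ : DForm M (k + 1)}
    (P : OrientedPartition τ) (α : DForm M (k + 1)) {s : Set (RR (k + 1))} (hs : IsOpen s)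
    {ψ : RR (k + 1) → M} (hψ : IsPlot ψ) (hinj : InjOn ψ s) (hthin : Thin k (ψ '' s)ᶜ) :
    IntegrableOn (fun u => (SignType.sign (coeff τ ψ hψ u) : ℝ) * coeff α ψ hψ u) s ∧
      P.integral α = ∫ u in s, (SignType.sign (coeff τ ψ hψ u) : ℝ) * coeff α ψ hψ u := by
  refine P.integral_eq α hs hψ hinj fun i => ?_
  have h0 := hthin.volume_preimage_eq_zero (P.isChart i)
  filter_upwards [compl_mem_ae_iff.2 h0] with u hu hu'
  exact (hu hu').elim

theorem exists_angle {c s : ℝ} (h : c ^ 2 + s ^ 2 = 1) (hs : s ≠ 0) :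
    ∃ t ∈ Ioo (0 : ℝ) 1, Real.cos (2 * Real.pi * t) = c ∧ Real.sin (2 * Real.pi * t) = s := by
  have hc1 : -1 ≤ c := by nlinarith [sq_nonneg s]
  have hc2 : c ≤ 1 := by nlinarith [sq_nonneg s]
  have hcos := Real.cos_arccos hc1 hc2
  have hsin : Real.sin (Real.arccos c) = |s| := by
    rw [Real.sin_arccos, show 1 - c ^ 2 = s ^ 2 by linarith, Real.sqrt_sq_eq_abs]
  have hpi := Real.pi_pos
  have h2 : Real.arccos c ≤ Real.pi := Real.arccos_le_pi c
  have h1 : 0 < Real.arccos c := by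
    refine (Real.arccos_nonneg c).lt_of_ne fun h0 => ?_
    rw [← h0, Real.sin_zero] at hsin
    exact hs (abs_eq_zero.1 hsin.symm)
  have ht : Real.arccos c / (2 * Real.pi) ∈ Ioo (0 : ℝ) 1 :=
    ⟨by positivity, by rw [div_lt_one (by positivity)]; linarith⟩
  rcases lt_or_gt_of_ne hs with h0 | h0
  · refine ⟨1 - Real.arccos c / (2 * Real.pi), ⟨by linarith [ht.2], by linarith [ht.1]⟩, ?_⟩
    rw [mul_sub, mul_one, mul_div_cancel₀ _ (by positivity), Real.cos_two_pi_sub,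
      Real.sin_two_pi_sub, hcos, hsin, abs_of_neg h0, neg_neg]
    exact ⟨rfl, rfl⟩
  · refine ⟨_, ht, ?_⟩
    rw [mul_div_cancel₀ _ (by positivity), hcos, hsin, abs_of_pos h0]
    exact ⟨rfl, rfl⟩

theorem angle_injOn : InjOn angle (Ioo (0 : ℝ) 1) := by
  intro s hs t ht h
  have hcos : Real.cos (2 * Real.pi * s) = Real.cos (2 * Real.pi * t) :=
    congrArg (fun x : Sphere 2 => x.1 0) h
  have hsin : Real.sin (2 * Real.pi * s) = Real.sin (2 * Real.pi * t) :=
    congrArg (fun x : Sphere 2 => x.1 1) h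
  obtain ⟨k, hk⟩ := Real.Angle.angle_eq_iff_two_pi_dvd_sub.1 (Real.Angle.cos_sin_inj hcos hsin)
  have hk' : s - t = k := by
    have : (2 * Real.pi) * (s - t) = (2 * Real.pi) * k := by linarith
    exact mul_left_cancel₀ (by positivity) this
  have h1 : (k : ℝ) < 1 := by linarith [hs.2, ht.1]
  have h2 : (-1 : ℝ) < k := by linarith [hs.1, ht.2]
  have h3 : k = 0 := by
    have h1' : k < 1 := by exact_mod_cast h1
    have h2' : -1 < k := by exact_mod_cast h2
    omega
  rw [h3, Int.cast_zero] at hk'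
  linarith

/-- The parameters `(t, u)` with `0 < t < 1` and `δ sin t > 0` (with `t` replaced by `2πt`). -/
def halfCyl (k : ℕ) (δ : ℝ) : Set (RR (k + 1)) :=
  {z | z 0 ∈ Ioo (0 : ℝ) 1 ∧ 0 < δ * Real.sin (2 * Real.pi * z 0)}

theorem isOpen_halfCyl (k : ℕ) (δ : ℝ) : IsOpen (halfCyl k δ) :=
  (isOpen_Ioo.preimage (by fun_prop : Continuous fun z : RR (k + 1) => z 0)).inter
    (isOpen_lt continuous_const
      (by fun_prop : Continuous fun z : RR (k + 1) => δ * Real.sin (2 * Real.pi * z 0)))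

theorem cyl_injOn {k n : ℕ} {ψ : RR k → Stiefel n} (hψ : Function.Injective ψ) :
    InjOn (cyl ψ) {z : RR (k + 1) | z 0 ∈ Ioo (0 : ℝ) 1} := by
  intro z hz w hw h
  have h0 := angle_injOn hz hw (congrArg Prod.fst h)
  have h1 := hψ (congrArg Prod.snd h)
  rw [pt_eta z, pt_eta w, h0, h1]

variable {L k : ℕ}

/-- Over each half of the circle, `f` is injective: `y` and `sin t x + cos t y` determine `cos t`,
hence `sin t`, and then `x`. -/
theorem gauss_injOn {n : ℕ} {ψ : RR k → Stiefel n} (hψ : Function.Injective ψ) {δ : ℝ}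
    (hδ : δ ^ 2 = 1) : InjOn (gaussMap ∘ cyl ψ) (halfCyl k δ) := by
  intro z hz w hw h
  have hy : (ψ (tl z)).1.2 = (ψ (tl w)).1.2 := congrArg (fun x => x.1.1) h
  have hx : Real.sin (2 * Real.pi * z 0) • (ψ (tl z)).1.1 +
      Real.cos (2 * Real.pi * z 0) • (ψ (tl z)).1.2 =
      Real.sin (2 * Real.pi * w 0) • (ψ (tl w)).1.1 +
      Real.cos (2 * Real.pi * w 0) • (ψ (tl w)).1.2 := congrArg (fun x => x.2.1) h
  have hcos : Real.cos (2 * Real.pi * z 0) = Real.cos (2 * Real.pi * w 0) := by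
    have h1 := congrArg (fun v => inner ℝ v (ψ (tl z)).1.2) hx
    simp only [inner_add_left, inner_smul_left, (ψ (tl z)).2.2.2, conj_trivial] at h1
    rw [real_inner_self_eq_norm_sq, hy, (ψ (tl w)).2.2.2, real_inner_self_eq_norm_sq,
      (ψ (tl w)).2.2.1] at h1
    linarith
  have hsin : Real.sin (2 * Real.pi * z 0) = Real.sin (2 * Real.pi * w 0) := by
    have h1 := Real.sin_sq_add_cos_sq (2 * Real.pi * z 0)
    have h2 := Real.sin_sq_add_cos_sq (2 * Real.pi * w 0)
    rw [hcos] at h1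
    have h3 : (δ * Real.sin (2 * Real.pi * z 0)) ^ 2 = (δ * Real.sin (2 * Real.pi * w 0)) ^ 2 := by
      rw [mul_pow, mul_pow, hδ]
      linarith
    have h4 := (sq_eq_sq₀ hz.2.le hw.2.le).1 h3
    refine mul_left_cancel₀ (a := δ) ?_ h4
    rintro rfl
    norm_num at hδ
  refine cyl_injOn hψ hz.1 hw.1 (Prod.ext (Subtype.ext ?_) (Subtype.ext (Prod.ext ?_ hy)))
  · ext i
    fin_cases i
    exacts [hcos, hsin]
  · rw [hcos, hsin, hy, add_left_inj] at hx
    refine smul_right_injective (RR n) (r := Real.sin (2 * Real.pi * w 0)) (fun h0 => ?_) hx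
    have := hw.2
    rw [h0, mul_zero] at this
    exact lt_irrefl _ this

/-- Over each half of the circle, `f` covers all pairs `(y, w)` with `w ≠ ± y`. -/
theorem thin_compl_gauss (h : L + 1 + L = k) (hL : 1 ≤ L) {δ : ℝ} (hδ : δ ^ 2 = 1) :
    Thin k (gaussMap ∘ cyl (stChart one_sq one_sq h) '' halfCyl k δ)ᶜ := by
  have h1 : Thin (1 + (L + 1)) (gaussMap '' ((univ : Set (Sphere 2)) ×ˢ
      (range (stChart one_sq one_sq h))ᶜ)) :=
    ((thin_sphere 1).prod (thin_compl_range_stChart h)).image dSmooth_gaussMap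
  -- the diagonal and the antidiagonal
  have hdiag : ∀ c : ℝ, c ^ 2 = 1 → Thin (L + 1)
      {x : Sphere (L + 2) × Sphere (L + 2) | x.2.1 = c • x.1.1} := by
    intro c hc
    have hc' : ∀ y : Sphere (L + 2), ‖c • y.1‖ = 1 := fun y => by
      rw [norm_smul, y.2, mul_one, Real.norm_eq_abs, ← Real.sqrt_sq_eq_abs, hc, Real.sqrt_one]
    let g : Sphere (L + 2) → Sphere (L + 2) × Sphere (L + 2) := fun y => (y, ⟨c • y.1, hc' y⟩)
    have hg : DSmooth g := by
      intro m p hp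
      have hp' : ContDiff ℝ ∞ fun u => (p u).1 := IsPlot.contDiff hp
      have hc : ContDiff ℝ ∞ fun u => c • (p u).1 := hp'.const_smul c
      exact ⟨hp, hc.isPlot⟩
    exact ((thin_sphere (L + 1)).image hg).mono fun x hx =>
      ⟨x.1, trivial, Prod.ext rfl (Subtype.ext hx.symm)⟩
  refine ((h1.of_le (by omega)).union (((hdiag 1 one_sq).union
    (hdiag (-1) neg_one_sq')).of_le (by omega))).mono fun x hx => ?_
  set c : ℝ := inner ℝ x.2.1 x.1.1 with hc
  have hnorm : ‖x.2.1 - c • x.1.1‖ ^ 2 = 1 - c ^ 2 := by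
    rw [norm_sub_sq_real, inner_smul_right, norm_smul, mul_pow, x.1.2, x.2.2, Real.norm_eq_abs,
      sq_abs, ← hc]
    ring
  by_cases h0 : 1 - c ^ 2 = 0
  · right
    have h2 : x.2.1 = c • x.1.1 := by
      rw [h0] at hnorm
      exact sub_eq_zero.1 (norm_eq_zero.1 (pow_eq_zero_iff two_ne_zero |>.1 hnorm))
    have h3 : (c - 1) * (c + 1) = 0 := by linarith
    rcases mul_eq_zero.1 h3 with h4 | h4
    · left
      rw [mem_ofPred_eq, h2, show c = 1 by linarith]
    · right
      rw [mem_ofPred_eq, h2, show c = -1 by linarith]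
  · left
    set r : ℝ := ‖x.2.1 - c • x.1.1‖ with hr
    have hr0 : 0 < r := by
      refine (norm_nonneg _).lt_of_ne fun h2 => h0 ?_
      rw [← hnorm, hr, ← h2]
      norm_num
    have hδ0 : δ ≠ 0 := by
      rintro rfl
      norm_num at hδ
    obtain ⟨t, ht, hcos, hsin⟩ := exists_angle (c := c) (s := δ * r)
      (by rw [mul_pow, hδ]; linarith) (mul_ne_zero hδ0 hr0.ne')
    let v : Stiefel (L + 2) := ⟨((δ * r⁻¹) • (x.2.1 - c • x.1.1), x.1.1), by
      rw [norm_smul, ← hr, norm_mul, Real.norm_eq_abs δ, ← Real.sqrt_sq_eq_abs, hδ, Real.sqrt_one,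
        one_mul, norm_inv, Real.norm_of_nonneg hr0.le, inv_mul_cancel₀ hr0.ne'], x.1.2, by
      rw [inner_smul_left, inner_sub_left, inner_smul_left, real_inner_self_eq_norm_sq, x.1.2,
        ← hc]
      simp⟩
    have hv : gaussMap (angle t, v) = x := by
      refine Prod.ext rfl (Subtype.ext ?_)
      change Real.sin (2 * Real.pi * t) • ((δ * r⁻¹) • (x.2.1 - c • x.1.1)) +
        Real.cos (2 * Real.pi * t) • x.1.1 = x.2.1
      rw [hsin, hcos, smul_smul, show δ * r * (δ * r⁻¹) = δ ^ 2 * (r * r⁻¹) by ring, hδ,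
        mul_inv_cancel₀ hr0.ne', one_mul, one_smul, sub_add_cancel]
    refine ⟨(angle t, v), ⟨trivial, ?_⟩, hv⟩
    rintro ⟨u, hu⟩
    refine hx ⟨pt t u, ⟨ht, ?_⟩, ?_⟩
    · rw [pt_zero, hsin, ← mul_assoc, ← sq, hδ, one_mul]
      exact hr0
    · rw [← hv]
      exact congrArg (fun z => gaussMap (angle t, z)) hu

/-- The main chart of the Stiefel manifold and the angle give coordinates on `S¹ × V` outside of the
slices at the zeros of `sin` and of the product of `S¹` with the complement of the chart. -/
theorem thin_compl_cyl (h : L + 1 + L = k) (hL : 1 ≤ L) :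
    Thin k (cyl (stChart one_sq one_sq h) '' (halfCyl k 1 ∪ halfCyl k (-1)))ᶜ := by
  have h1 : Thin (1 + (L + 1)) ((univ : Set (Sphere 2)) ×ˢ (range (stChart one_sq one_sq h))ᶜ) :=
    (thin_sphere 1).prod (thin_compl_range_stChart h)
  have hpole : ∀ c : ℝ, c ^ 2 = 1 → ‖(pt c 0 : RR 2)‖ = 1 := fun c hc => by
    have h2 := norm_pt_sq c (0 : RR 1)
    rw [norm_zero, hc] at h2
    nlinarith [norm_nonneg (pt c (0 : RR 1))]
  have h2 : Thin (0 + k) (({⟨pt 1 0, hpole 1 one_sq⟩} ∪ {⟨pt (-1) 0, hpole (-1) neg_one_sq'⟩} :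
      Set (Sphere 2)) ×ˢ (univ : Set (Stiefel (L + 2)))) :=
    ((thin_singleton _).union (thin_singleton _)).prod (thin_stiefel h)
  refine ((h1.of_le (by omega)).union (h2.of_le (by omega))).mono fun x hx => ?_
  have hnorm : x.1.1 0 ^ 2 + x.1.1 1 ^ 2 = 1 := by
    have h := EuclideanSpace.real_norm_sq_eq x.1.1
    rw [x.1.2, Fin.sum_univ_two] at h
    linarith
  by_cases h0 : x.1.1 1 = 0
  · right
    have h3 : ∀ c : ℝ, ∀ hc : c ^ 2 = 1, x.1.1 0 = c → x.1 = ⟨pt c 0, hpole c hc⟩ := by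
      intro c hc hxc
      refine Subtype.ext ?_
      ext i
      fin_cases i
      exacts [hxc, h0]
    rw [h0] at hnorm
    have h4 : (x.1.1 0 - 1) * (x.1.1 0 + 1) = 0 := by linarith
    refine ⟨?_, trivial⟩
    rcases mul_eq_zero.1 h4 with h5 | h5
    · exact Or.inl (h3 1 one_sq (by linarith))
    · exact Or.inr (h3 (-1) neg_one_sq' (by linarith))
  · left
    refine ⟨trivial, ?_⟩
    rintro ⟨u, hu⟩
    obtain ⟨t, ht, hcos, hsin⟩ := exists_angle hnorm h0
    refine hx ⟨pt t u, ?_, Prod.ext (Subtype.ext ?_) hu⟩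
    · rcases lt_or_gt_of_ne h0 with h5 | h5
      · exact Or.inr ⟨ht, by rw [pt_zero, hsin]; linarith⟩
      · exact Or.inl ⟨ht, by rw [pt_zero, hsin]; linarith⟩
    · ext i
      fin_cases i
      exacts [hcos, hsin]

theorem isVolumeForm_quarterSlice (h : L + 1 + L = k)
    {τ : DForm (Sphere (L + 2) × Sphere (L + 2)) (k + 1)} (hτ : IsVolumeForm τ) :
    IsVolumeForm (quarterSlice (τ.pullback gaussMap dSmooth_gaussMap)) := by
  intro z
  obtain ⟨ε, δ, hε, hδ, -, -, u, -, -, rfl⟩ := exists_stChart_eq h z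
  refine ⟨_, isChart_stChart hε hδ h, ⟨u, rfl⟩, fun u => ?_⟩
  rw [coeff_quarterSlice _ (isPlot_stChart hε hδ h)]
  refine neg_ne_zero.2 (coeff_gauss_ne_zero hτ (isPlot_stChart hε hδ h)
    (injective_fderiv_stChart hε hδ h) _ ?_)
  rw [pt_zero, show 2 * Real.pi * (1 / 4) = Real.pi / 2 by ring, Real.sin_pi_div_two]
  exact one_ne_zero

theorem disjoint_halfCyl (k : ℕ) : Disjoint (halfCyl k 1) (halfCyl k (-1)) :=
  Set.disjoint_left.2 fun z h1 h2 => by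
    have h3 := h1.2
    have h4 := h2.2
    linarith

theorem plotSeparated_cylinder (n : ℕ) : PlotSeparated (Sphere 2 × Stiefel n) :=
  (plotSeparated_sphere 2).prod (plotSeparated_stiefel n)

/-- Integrals over `S¹ × V` in the coordinates given by the angle and the main chart of `V`. -/
theorem integral_cylinder_eq (h : L + 1 + L = k) (hL : 1 ≤ L)
    {τ : DForm (Sphere 2 × Stiefel (L + 2)) (k + 1)}
    (P : OrientedPartition τ) (α : DForm (Sphere 2 × Stiefel (L + 2)) (k + 1)) :
    IntegrableOn (fun z =>
      (SignType.sign (coeff τ _ (isPlot_cyl (isPlot_stChart one_sq one_sq h)) z) : ℝ) *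
        coeff α _ (isPlot_cyl (isPlot_stChart one_sq one_sq h)) z)
      (halfCyl k 1 ∪ halfCyl k (-1)) ∧
    P.integral α = ∫ z in halfCyl k 1 ∪ halfCyl k (-1),
      (SignType.sign (coeff τ _ (isPlot_cyl (isPlot_stChart one_sq one_sq h)) z) : ℝ) *
        coeff α _ (isPlot_cyl (isPlot_stChart one_sq one_sq h)) z :=
  P.integral_eq_of_thin α ((isOpen_halfCyl k 1).union (isOpen_halfCyl k (-1))) _
    ((cyl_injOn (isChart_stChart one_sq one_sq h).injective).mono (by
      rintro z (hz | hz)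
      exacts [hz.1, hz.1])) (thin_compl_cyl h hL)

/-- Each half of the circle contributes the integral over `S^(n-1) × S^(n-1)` to the integral of a
pull-back along `f`. -/
theorem hasDegree_gaussMap (h : L + 1 + L = k) (hL : 1 ≤ L) (hLe : Even L)
    {τ : DForm (Sphere (L + 2) × Sphere (L + 2)) (k + 1)} (hτ : IsVolumeForm τ) :
    HasDegree (wedgeDTheta (quarterSlice (τ.pullback gaussMap dSmooth_gaussMap))) τ gaussMap
      dSmooth_gaussMap 2 := by
  intro β I hI
  obtain ⟨P, rfl⟩ := hasIntegral_iff.1 hI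
  have hσ := isVolumeForm_wedgeDTheta (isVolumeForm_quarterSlice h hτ)
  obtain ⟨P'⟩ := hσ.exists_orientedPartition (plotSeparated_cylinder _)
    ((compactlyCovered_sphere 1).prod (compactlyCovered_stiefel h))
  refine hasIntegral_iff.2 ⟨P', ?_⟩
  obtain ⟨hint, heq⟩ := integral_cylinder_eq h hL P' (β.pullback gaussMap dSmooth_gaussMap)
  have hψ := isChart_stChart one_sq one_sq h
  have hhalf : ∀ δ : ℝ, δ ^ 2 = 1 → ∫ z in halfCyl k δ, (SignType.sign (coeff (wedgeDTheta
      (quarterSlice (τ.pullback gaussMap dSmooth_gaussMap))) _ (isPlot_cyl hψ.isPlot) z) : ℝ) *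
        coeff (β.pullback gaussMap dSmooth_gaussMap) _ (isPlot_cyl hψ.isPlot) z =
      P.integral β := by
    intro δ hδ
    rw [(P.integral_eq_of_thin β (isOpen_halfCyl k δ) (dSmooth_gaussMap _ _ (isPlot_cyl hψ.isPlot))
      (gauss_injOn hψ.injective hδ) (thin_compl_gauss h hL hδ)).2]
    refine setIntegral_congr_fun (isOpen_halfCyl k δ).measurableSet fun z hz => ?_
    have hk : Odd k := ⟨L, by omega⟩
    have hs := sign_coeff_wedgeDTheta (by simpa [Nat.even_add] using hLe) hk hτ hψ.isPlot
      (injective_fderiv_stChart one_sq one_sq h) z hz.1 (fun h0 => by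
        have := hz.2
        rw [h0, mul_zero] at this
        exact lt_irrefl _ this)
    simp only [hs]
    rfl
  rw [heq, setIntegral_union (disjoint_halfCyl k) (isOpen_halfCyl k (-1)).measurableSet
    hint.left_of_union hint.right_of_union]
  rw [hhalf 1 one_sq, hhalf (-1) neg_one_sq']
  push_cast
  ring

end Degree

/-! ### The form `v P₁(v)` on a loop space -/

section LoopForm

variable {X : Type} [DiffeologicalSpace X]

/-- The map `(t, u) ↦ (p u 0, p u t)` given by a plot `p` of the loop space. -/
def endPair {m : ℕ} (p : RR m → Loop X) (z : RR (m + 1)) : X × X := (ev0 (p (tl z)), total p z)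

theorem isPlot_endPair {m : ℕ} {p : RR m → Loop X} (hp : IsPlot p) : IsPlot (endPair p) :=
  ⟨isPlot_reparam (hp.dSmooth_comp dSmooth_ev0) contDiff_tl, isPlot_total hp⟩

/-- The wedge product with a fixed alternating form. -/
def wedgeLeft {m j l k : ℕ} (h : j + l = k) (a : RR m [⋀^Fin j]→L[ℝ] ℝ) :
    (RR m [⋀^Fin l]→L[ℝ] ℝ) →L[ℝ] (RR m [⋀^Fin k]→L[ℝ] ℝ) :=
  have := finiteDimensional_alt m l
  LinearMap.toContinuousLinearMap
    { toFun := fun b => DForm.wedgeAlt h a b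
      map_add' := fun b b' => by
        ext w
        simp only [DForm.wedgeAlt_apply, ContinuousAlternatingMap.add_apply, mul_add,
          Finset.sum_add_distrib]
      map_smul' := fun c b => by
        ext w
        simp only [DForm.wedgeAlt_apply, ContinuousAlternatingMap.smul_apply, smul_eq_mul,
          Finset.mul_sum, RingHom.id_apply]
        exact Finset.sum_congr rfl fun _ _ => by ring }

/-- The form `v P₁(v)` is, up to sign, the integral over the fibre of the pull-back of `v × v` along
`(t, γ) ↦ (γ 0, γ t)`. -/
theorem val_wedge_P1 {l k : ℕ} (h : l + 1 + l = k) (h' : l + 1 + (l + 1) = k + 1)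
    (v : DForm X (l + 1)) {m : ℕ} (p : RR m → Loop X) (hp : IsPlot p) (u : RR m) :
    (DForm.wedge h (v.pullback ev0 dSmooth_ev0) (P1 rfl v)).val p hp u =
      ((-1) ^ (l + 1) : ℝ) • ∫ t in (0 : ℝ)..1,
        contract rfl ((sqForm h' v).val (endPair p) (isPlot_endPair hp) (pt t u)) := by
  have hint : IntervalIntegrable (fun t : ℝ =>
      contract rfl (v.val (total p) (isPlot_total hp) (pt t u))) volume 0 1 :=
    ((contDiff_total rfl v p hp).continuous.comp
      (by fun_prop : Continuous fun t : ℝ => (u, t))).intervalIntegrable _ _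
  change wedgeLeft h ((v.pullback ev0 dSmooth_ev0).val p hp u) (∫ t in (0 : ℝ)..1,
    contract rfl (v.val (total p) (isPlot_total hp) (pt t u))) = _
  rw [← ContinuousLinearMap.intervalIntegral_comp_comm _ hint, ← intervalIntegral.integral_smul]
  refine intervalIntegral.integral_congr fun t _ => ?_
  have h1 := compat_affine v (hp.dSmooth_comp dSmooth_ev0) (tlL m) 0 (isPlot_endPair hp).1
    (fun z => by rw [add_zero]; rfl) (pt t u)
  rw [add_zero] at h1
  change DForm.wedgeAlt h _ _ = ((-1) ^ (l + 1) : ℝ) • contract rfl (DForm.wedgeAlt h'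
    (v.val (fun z => (endPair p z).1) (isPlot_endPair hp).1 (pt t u))
    (v.val (total p) (isPlot_total hp) (pt t u)))
  rw [h1, contract_wedgeAlt h h', smul_smul, ← mul_pow]
  simp only [mul_neg, mul_one, neg_neg, one_pow, one_smul]
  rfl

/-- `v P₁(v)` is closed, since `v × v` is a form of top degree and `γ 1 = γ 0`. -/
theorem isClosed_wedge_P1 {l k : ℕ} (h : l + 1 + l = k)
    (hX : ∀ x : X × X, ∃ φ : RR (k + 1) → X × X, IsChart φ ∧ x ∈ range φ) (v : DForm X (l + 1)) :
    (DForm.wedge h (v.pullback ev0 dSmooth_ev0) (P1 rfl v)).IsClosed := by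
  intro m p hp u
  have h' : l + 1 + (l + 1) = k + 1 := by omega
  have hF := isPlot_endPair hp
  change extDeriv ((DForm.wedge h (v.pullback ev0 dSmooth_ev0) (P1 rfl v)).val p hp) u = 0
  rw [show (DForm.wedge h (v.pullback ev0 dSmooth_ev0) (P1 rfl v)).val p hp = fun u =>
    ((-1) ^ (l + 1) : ℝ) • ∫ t in (0 : ℝ)..1,
      contract rfl ((sqForm h' v).val (endPair p) hF (pt t u))
    from funext (val_wedge_P1 h h' v p hp)]
  refine (extDeriv_smul _ _).trans ?_
  rw [extDeriv_integral_contract_eq_zero ((sqForm h' v).smooth _ hF)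
    (fun z => DForm.isClosed_of_top hX (sqForm h' v) _ hF z), smul_zero]
  intro u w
  -- the restrictions to both ends are pull-backs along the same map `u ↦ (p u 0, p u 1)`
  have hend : ∀ s : ℝ, ∀ hq : IsPlot fun u => endPair p (pt s u),
      (sqForm h' v).val (endPair p) hF (pt s u) (fun i => pt 0 (w i)) =
        (sqForm h' v).val _ hq u w := by
    intro s hq
    have h1 := compat_affine (sqForm h' v) hF (incl m) (pt s 0) hq (fun u => congrArg _ (by
      ext i
      refine Fin.cases ?_ (fun i => ?_) i <;> simp)) u
    rw [show incl m u + pt s 0 = pt s u by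
      ext i
      refine Fin.cases ?_ (fun i => ?_) i <;> simp] at h1
    exact (congrArg (fun a => a w) h1).symm
  have hq : ∀ s : ℝ, IsPlot fun u => endPair p (pt s u) := fun s =>
    isPlot_reparam hF (contDiff_pt.comp (contDiff_id.prodMk contDiff_const))
  rw [hend 1 (hq 1), hend 0 (hq 0)]
  refine congrArg (fun a => a w) (DForm.val_congr (sqForm h' v) (hq 1) (hq 0)
    (funext fun u => Prod.ext rfl ?_) u)
  have h1 := (p u).periodic 0
  rw [zero_add] at h1
  exact h1

end LoopForm

/-! ### Coordinates and product measures -/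

section Fubini

theorem measurePreserving_zero_tl (k : ℕ) :
    MeasurePreserving (fun z : RR (k + 1) => (z 0, tl z)) := by
  have h1 := PiLp.volume_preserving_ofLp (Fin (k + 1))
  have h2 := volume_preserving_piFinSuccAbove (fun _ : Fin (k + 1) => ℝ) 0
  have h3 := (MeasurePreserving.id (volume : Measure ℝ)).prod (PiLp.volume_preserving_toLp (Fin k))
  exact h3.comp (h2.comp h1)

theorem measurePreserving_fstL_sndL {a b c : ℕ} (h : a + b = c) :
    MeasurePreserving (fun z : RR c => (fstL h z, sndL h z)) := by
  subst h
  have h1 := PiLp.volume_preserving_ofLp (Fin (a + b))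
  have h2 := volume_preserving_arrowCongr' (finSumFinEquiv (m := a) (n := b)).symm
    (MeasurableEquiv.refl ℝ) (MeasurePreserving.id volume)
  have h3 := volume_measurePreserving_sumPiEquivProdPi fun _ : Fin a ⊕ Fin b => ℝ
  have h4 := (PiLp.volume_preserving_toLp (Fin a)).prod (PiLp.volume_preserving_toLp (Fin b))
  exact h4.comp (h3.comp (h2.comp h1))

end Fubini

/-! ### The integrals of `v × v` and of `c^*ω` -/

section MainIntegral

variable {L j : ℕ}

theorem exists_chart_spheres (hW : L + 1 + (L + 1) = j + 1)
    (x : Sphere (L + 2) × Sphere (L + 2)) :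
    ∃ φ : RR (j + 1) → Sphere (L + 2) × Sphere (L + 2), IsChart φ ∧ x ∈ range φ := by
  have h : ∀ y : Sphere (L + 2), ∃ φ : RR (L + 1) → Sphere (L + 2), IsChart φ ∧ y ∈ range φ := by
    intro y
    obtain ⟨ε, hε, h1, -⟩ := exists_ster_eq y.2
    rcases hε with rfl | rfl
    exacts [⟨_, isChart_ster one_sq, mem_range_ster one_sq h1⟩,
      ⟨_, isChart_ster neg_one_sq', mem_range_ster neg_one_sq' h1⟩]
  obtain ⟨φ, hφ, u, hu⟩ := h x.1
  obtain ⟨ψ, hψ, v, hv⟩ := h x.2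
  exact ⟨_, hφ.prodMk hψ (fstL hW) (sndL hW) (fun z => joinE hW z.1 z.2) (contDiff_joinE hW)
    (fun z => fstL_joinE hW _ _) (fun z => sndL_joinE hW _ _) (joinE_fstL_sndL hW),
    joinE hW u v, by simp [hu, hv]⟩

/-- Fubini for the product of two spheres. -/
theorem integral_sqForm (hW : L + 1 + (L + 1) = j + 1) {τ : DForm (Sphere (L + 2)) (L + 1)}
    (v : DForm (Sphere (L + 2)) (L + 1)) (P : OrientedPartition τ)
    (Q : OrientedPartition (sqForm hW τ)) : Q.integral (sqForm hW v) = P.integral v ^ 2 := by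
  have hφ : IsChart (ster one_sq : RR (L + 1) → Sphere (L + 2)) := isChart_ster one_sq
  have hψ := hφ.prodMk hφ (fstL hW) (sndL hW) (fun z => joinE hW z.1 z.2) (contDiff_joinE hW)
    (fun z => fstL_joinE hW _ _) (fun z => sndL_joinE hW _ _) (joinE_fstL_sndL hW)
  have h1 : Thin (L + 1) (univ : Set (Sphere (L + 2))) := thin_sphere (L + 1)
  have h0 := thin_compl_range_ster (L + 1)
  have hthin : Thin j ((fun u => ((ster one_sq (fstL hW u) : Sphere (L + 2)),
      (ster one_sq (sndL hW u) : Sphere (L + 2)))) '' univ)ᶜ := by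
    refine (((h0.prod h1).of_le (by omega)).union ((h1.prod h0).of_le (by omega))).mono
      fun x hx => ?_
    by_cases hx1 : x.1 ∈ range (ster one_sq : RR (L + 1) → Sphere (L + 2))
    · refine Or.inr ⟨trivial, fun hx2 => hx ?_⟩
      obtain ⟨u, hu⟩ := hx1
      obtain ⟨w, hw⟩ := hx2
      exact ⟨joinE hW u w, trivial, by simp [hu, hw]⟩
    · exact Or.inl ⟨hx1, trivial⟩
  rw [(Q.integral_eq_of_thin (sqForm hW v) isOpen_univ hψ.isPlot hψ.injective.injOn hthin).2,
    (P.integral_eq_of_thin v isOpen_univ hφ.isPlot hφ.injective.injOn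
      (by rw [image_univ]; exact h0.of_le (Nat.zero_le L))).2, setIntegral_univ, setIntegral_univ]
  set g : RR (L + 1) → ℝ := fun u => (SignType.sign (coeff τ (ster one_sq) hφ.isPlot u) : ℝ) *
    coeff v (ster one_sq) hφ.isPlot u with hg
  have hprod := integral_prod_mul (μ := (volume : Measure (RR (L + 1))))
    (ν := (volume : Measure (RR (L + 1)))) g g
  have hemb : MeasurableEmbedding (fun z : RR (j + 1) => (fstL hW z, sndL hW z)) :=
    ((fstL hW).continuous.prodMk (sndL hW).continuous).measurableEmbedding fun z w hzw => by
      have hz : fstL hW z = fstL hW w := congrArg Prod.fst hzw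
      have hz' : sndL hW z = sndL hW w := congrArg Prod.snd hzw
      rw [← joinE_fstL_sndL hW z, ← joinE_fstL_sndL hW w, hz, hz']
  have hmp := (measurePreserving_fstL_sndL hW).integral_comp hemb
    fun z : RR (L + 1) × RR (L + 1) => g z.1 * g z.2
  rw [sq, ← hprod]
  refine Eq.trans (integral_congr_ae (Filter.Eventually.of_forall fun u => ?_)) hmp
  have hc : ∀ α : DForm (Sphere (L + 2)) (L + 1), coeff (sqForm hW α) _ hψ.isPlot u =
      coeff α (ster one_sq) hφ.isPlot (fstL hW u) * coeff α (ster one_sq) hφ.isPlot (sndL hW u) :=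
    fun α => coeff_wedge_pullback hW α α dSmooth_fst dSmooth_snd _ hφ.isPlot hφ.isPlot rfl rfl u
  simp only [hc, sign_mul, hg, SignType.coe_mul]
  ring

/-- The two halves of the circle make up the unit interval, up to the zeros of `sin`. -/
theorem ae_eq_Ioc_halves : ({t : ℝ | t ∈ Ioo (0 : ℝ) 1 ∧ 0 < 1 * Real.sin (2 * Real.pi * t)} ∪
    {t : ℝ | t ∈ Ioo (0 : ℝ) 1 ∧ 0 < -1 * Real.sin (2 * Real.pi * t)} : Set ℝ) =ᵐ[volume]
      Ioc (0 : ℝ) 1 := by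
  have hnull : ∀ᵐ t : ℝ, t ∉ ({1 / 2, 1} : Set ℝ) :=
    compl_mem_ae_iff.2 ((Set.toFinite _).measure_zero volume)
  filter_upwards [hnull] with t ht
  refine propext ⟨?_, fun h => ?_⟩
  · rintro (h | h)
    exacts [⟨h.1.1, h.1.2.le⟩, ⟨h.1.1, h.1.2.le⟩]
  · have h1 : t < 1 := h.2.lt_of_ne fun h0 => ht (Or.inr h0)
    have hpi := Real.pi_pos
    rcases lt_or_gt_of_ne (fun h0 => ht (Or.inl h0) : t ≠ 1 / 2) with h2 | h2
    · refine Or.inl ⟨⟨h.1, h1⟩, ?_⟩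
      rw [one_mul]
      exact Real.sin_pos_of_pos_of_lt_pi (mul_pos (by positivity) h.1) (by nlinarith)
    · refine Or.inr ⟨⟨h.1, h1⟩, ?_⟩
      have h3 : Real.sin (2 * Real.pi * t - Real.pi) = -Real.sin (2 * Real.pi * t) :=
        Real.sin_sub_pi _
      rw [neg_one_mul, ← h3]
      exact Real.sin_pos_of_pos_of_lt_pi (by nlinarith) (by nlinarith)

/-- Fubini for the cylinder: integrals over both halves, in the coordinates `(t, u)`. -/
theorem setIntegral_halves_eq {k : ℕ} {f : RR (k + 1) → ℝ}
    (hf : IntegrableOn f (halfCyl k 1 ∪ halfCyl k (-1))) :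
    ∫ z in halfCyl k 1 ∪ halfCyl k (-1), f z = ∫ u, ∫ t in (0 : ℝ)..1, f (pt t u) := by
  set T : Set ℝ := {t : ℝ | t ∈ Ioo (0 : ℝ) 1 ∧ 0 < 1 * Real.sin (2 * Real.pi * t)} ∪
    {t : ℝ | t ∈ Ioo (0 : ℝ) 1 ∧ 0 < -1 * Real.sin (2 * Real.pi * t)} with hT
  have hemb : MeasurableEmbedding (fun z : RR (k + 1) => (z 0, tl z)) :=
    ((by fun_prop : Continuous fun z : RR (k + 1) => z 0).prodMk
      contDiff_tl.continuous).measurableEmbedding fun z w hzw => by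
        have hz : z 0 = w 0 := congrArg Prod.fst hzw
        have hz' : tl z = tl w := congrArg Prod.snd hzw
        rw [pt_eta z, pt_eta w, hz, hz']
  have hpre : halfCyl k 1 ∪ halfCyl k (-1) =
      (fun z : RR (k + 1) => (z 0, tl z)) ⁻¹' (T ×ˢ (univ : Set (RR k))) := by
    ext z
    exact ⟨fun h => ⟨h, trivial⟩, fun h => h.1⟩
  have hf' : f = (fun x : ℝ × RR k => f (pt x.1 x.2)) ∘ fun z : RR (k + 1) => (z 0, tl z) := by
    funext z
    rw [Function.comp_apply, pt_tl]
  have hmp := measurePreserving_zero_tl k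
  have hint : IntegrableOn (fun x : ℝ × RR k => f (pt x.1 x.2)) (T ×ˢ univ) := by
    rw [hpre, hf'] at hf
    exact (hmp.integrableOn_comp_preimage hemb).1 hf
  have h1 := hmp.setIntegral_preimage_emb hemb (fun x : ℝ × RR k => f (pt x.1 x.2)) (T ×ˢ univ)
  rw [← hpre] at h1
  have h2 : (volume : Measure (ℝ × RR k)).restrict (T ×ˢ univ) =
      (volume.restrict T).prod volume := by
    conv_rhs => rw [← Measure.restrict_univ (μ := (volume : Measure (RR k)))]
    exact (Measure.prod_restrict T univ).symm
  have h3 : (volume : Measure ℝ).restrict T = volume.restrict (Ioc 0 1) :=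
    Measure.restrict_congr_set ae_eq_Ioc_halves
  rw [IntegrableOn, h2, h3] at hint
  rw [h2, h3, integral_prod_symm _ hint] at h1
  simp only [pt_tl] at h1
  rw [h1]
  simp only [intervalIntegral.integral_of_le zero_le_one]

theorem endPair_circle {n : ℕ} {m : ℕ} (p : RR m → Stiefel n) :
    endPair (normDeriv ∘ inclImb ∘ stiefelCycle ∘ p) = gaussMap ∘ cyl p := by
  have key : ∀ (z : Stiefel n) (t : ℝ), ((normDeriv (inclImb (stiefelCycle z))).toFun t).1 =
      Real.sin (2 * Real.pi * t) • z.1.1 + Real.cos (2 * Real.pi * t) • z.1.2 := by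
    intro z t
    change ‖deriv (circleMap z) t‖⁻¹ • deriv (circleMap z) t = _
    rw [deriv_circleMap, norm_smul, norm_frame z (Real.sin_sq_add_cos_sq _), mul_one,
      Real.norm_of_nonneg (by positivity), smul_smul, inv_mul_cancel₀ (by positivity), one_smul]
  funext z
  refine Prod.ext (Subtype.ext ?_) (Subtype.ext (key _ _))
  refine (key _ _).trans ?_
  rw [mul_zero, Real.sin_zero, Real.cos_zero, zero_smul, one_smul, zero_add]
  rfl

/-- The form `ω` on the space of imbeddings into `ℝ^n`, with `n = L + 2`: the restriction of
`D^*(v P₁(v))`. The degree `2n - 3 = 2L + 1` is written as `j + 1`. -/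
def circleForm (hV : L + 1 + L = j + 1) (v : DForm (Sphere (L + 2)) (L + 1)) :
    DForm (Imb (L + 2)) (j + 1) :=
  ((DForm.wedge hV (v.pullback ev0 dSmooth_ev0) (P1 rfl v)).pullback normDeriv
    dSmooth_normDeriv).pullback inclImb dSmooth_inclImb

theorem coeff_circleForm (hV : L + 1 + L = j + 1) (hW : L + 1 + (L + 1) = j + 2)
    (hLe : Even L) (v : DForm (Sphere (L + 2)) (L + 1)) {ψ : RR (j + 1) → Stiefel (L + 2)}
    (hψ : IsPlot ψ) (u : RR (j + 1)) :
    coeff ((circleForm hV v).pullback stiefelCycle dSmooth_stiefelCycle) ψ hψ u =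
      -∫ t in (0 : ℝ)..1, coeff ((sqForm hW v).pullback gaussMap dSmooth_gaussMap) (cyl ψ)
        (isPlot_cyl hψ) (pt t u) := by
  have hp : IsPlot (normDeriv ∘ inclImb ∘ stiefelCycle ∘ ψ) :=
    ((hψ.dSmooth_comp dSmooth_stiefelCycle).dSmooth_comp dSmooth_inclImb).dSmooth_comp
      dSmooth_normDeriv
  have h1 := val_wedge_P1 hV hW v _ hp u
  have hcont : ContDiff ℝ ∞ fun t : ℝ => contract rfl
      ((sqForm hW v).val _ (isPlot_endPair hp) (pt t u)) := by
    refine contDiff_alt fun w => ?_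
    simp only [contract_apply]
    exact (ContinuousAlternatingMap.apply ℝ (RR (j + 2)) ℝ _).contDiff.comp
      (((sqForm hW v).smooth _ _).comp (contDiff_pt.comp (contDiff_const.prodMk contDiff_id)))
  have h2 := ContinuousLinearMap.intervalIntegral_comp_comm
    (ContinuousAlternatingMap.apply ℝ (RR (j + 1)) ℝ fun i => EuclideanSpace.single i 1)
    (hcont.continuous.intervalIntegrable (μ := volume) 0 1)
  rw [hLe.add_one.neg_one_pow] at h1
  refine (congrArg (fun a => a fun i => EuclideanSpace.single i 1) h1).trans ?_
  refine (neg_one_mul _).trans ?_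
  refine congrArg Neg.neg (h2.symm.trans (intervalIntegral.integral_congr fun t _ => ?_))
  refine (contract_basis ((sqForm hW v).val _ (isPlot_endPair hp) (pt t u))).trans ?_
  exact coeff_congr (sqForm hW v) (isPlot_endPair hp) (dSmooth_gaussMap _ _ (isPlot_cyl hψ))
    (endPair_circle ψ) (pt t u)

/-- Integrating `f^*(v × v)` first along the circle and then over the Stiefel manifold gives the
integral of `c^*ω`. -/
theorem integral_circleForm (hV : L + 1 + L = j + 1) (hW : L + 1 + (L + 1) = j + 2)
    (hL : 1 ≤ L) (hLe : Even L) (v : DForm (Sphere (L + 2)) (L + 1))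
    {σ : DForm (Stiefel (L + 2)) (j + 1)} (P : OrientedPartition σ)
    (Q : OrientedPartition (wedgeDTheta σ)) :
    P.integral ((circleForm hV v).pullback stiefelCycle dSmooth_stiefelCycle) =
      Q.integral ((sqForm hW v).pullback gaussMap dSmooth_gaussMap) := by
  have hψ := isChart_stChart one_sq one_sq hV
  obtain ⟨hint, heq⟩ := integral_cylinder_eq hV hL Q
    ((sqForm hW v).pullback gaussMap dSmooth_gaussMap)
  rw [heq, setIntegral_halves_eq hint, (P.integral_eq_of_thin _ isOpen_univ hψ.isPlot
    hψ.injective.injOn (by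
      rw [image_univ]
      exact (thin_compl_range_stChart hV).of_le (by omega))).2, setIntegral_univ]
  refine integral_congr_ae (Filter.Eventually.of_forall fun u => ?_)
  have hodd : Odd (j + 1) := ⟨L, by omega⟩
  have hsign : ∀ t : ℝ, SignType.sign (coeff (wedgeDTheta σ) (cyl (stChart one_sq one_sq hV))
      (isPlot_cyl hψ.isPlot) (pt t u)) =
      -SignType.sign (coeff σ (stChart one_sq one_sq hV) hψ.isPlot u) := by
    intro t
    rw [coeff_wedgeDTheta σ hψ.isPlot, hodd.neg_one_pow, tl_pt, neg_one_mul, Left.sign_neg,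
      sign_mul, sign_pos (by positivity : (0 : ℝ) < 2 * Real.pi), mul_one]
  simp only [hsign, intervalIntegral.integral_const_mul]
  rw [coeff_circleForm hV hW hLe v hψ.isPlot]
  simp

theorem isClosed_circleForm (hV : L + 1 + L = j + 1) (v : DForm (Sphere (L + 2)) (L + 1)) :
    (circleForm hV v).IsClosed := fun p hp u =>
  isClosed_wedge_P1 hV (exists_chart_spheres (by omega)) v (normDeriv ∘ inclImb ∘ p)
    ((hp.dSmooth_comp dSmooth_inclImb).dSmooth_comp dSmooth_normDeriv) u

/-- The properties of `ω` for `n = L + 2`. The contraction of `f^*(τ × τ)` with `-∂_t` at the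
quarter turn serves as the orientation of the Stiefel manifold. -/
theorem circleForm_properties (hV : L + 1 + L = j + 1) (hW : L + 1 + (L + 1) = j + 2)
    (hL : 1 ≤ L) (hLe : Even L) (τ v : DForm (Sphere (L + 2)) (L + 1)) (hτ : IsVolumeForm τ)
    (hv : HasIntegral τ v 1) :
    (circleForm hV v).IsClosed ∧ ¬ (circleForm hV v).IsExact ∧
      ∃ σ : DForm (Stiefel (L + 2)) (j + 1), IsVolumeForm σ ∧
        HasDegree (wedgeDTheta σ) (sqForm hW τ) gaussMap dSmooth_gaussMap 2 ∧
        HasIntegral σ ((circleForm hV v).pullback stiefelCycle dSmooth_stiefelCycle) 2 := by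
  have hτ2 : IsVolumeForm (sqForm hW τ) := hτ.prod hW hτ
  set σ := quarterSlice ((sqForm hW τ).pullback gaussMap dSmooth_gaussMap)
  have hσ : IsVolumeForm σ := isVolumeForm_quarterSlice hV hτ2
  have hdeg : HasDegree (wedgeDTheta σ) (sqForm hW τ) gaussMap dSmooth_gaussMap 2 :=
    hasDegree_gaussMap hV hL hLe hτ2
  obtain ⟨P, hP⟩ := hasIntegral_iff.1 hv
  obtain ⟨Q⟩ := hτ2.exists_orientedPartition plotSeparated_spheres
    ((compactlyCovered_sphere (L + 1)).prod (compactlyCovered_sphere (L + 1)))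
  obtain ⟨R⟩ := hσ.exists_orientedPartition (plotSeparated_stiefel _) (compactlyCovered_stiefel hV)
  obtain ⟨S, hS⟩ := hasIntegral_iff.1 (hdeg _ _ (hasIntegral_iff.2 ⟨Q, rfl⟩))
  have hint : R.integral ((circleForm hV v).pullback stiefelCycle dSmooth_stiefelCycle) = 2 := by
    rw [integral_circleForm hV hW hL hLe v R S, ← hS, integral_sqForm hW v P Q, ← hP]
    norm_num
  refine ⟨isClosed_circleForm hV v, ?_, σ, hσ, hdeg, hasIntegral_iff.2 ⟨R, hint.symm⟩⟩
  rintro ⟨i, h, η, hη⟩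
  obtain rfl : i = j := by omega
  have h0 := R.integral_d_eq_zero (plotSeparated_stiefel _)
    (η.pullback stiefelCycle dSmooth_stiefelCycle)
  have h1 : R.integral ((circleForm hV v).pullback stiefelCycle dSmooth_stiefelCycle) =
      R.integral (η.pullback stiefelCycle dSmooth_stiefelCycle).d := by
    refine Finset.sum_congr rfl fun r _ =>
      integral_congr_ae (Filter.Eventually.of_forall fun u => ?_)
    exact congrArg _ (hη _ (dSmooth_stiefelCycle _ _ (R.isChart r).isPlot) u _)
  rw [h0, hint] at h1
  norm_num at h1

end MainIntegral

end

end ImbCoh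

theorem mainTheorem10 (n : ℕ) (hn : 3 < n) (heven : Even n)
    (τ v : DForm (Sphere n) (n - 1)) (hτ : IsVolumeForm τ) (hv : HasIntegral τ v 1) :
    (imbForm hn v).IsClosed ∧ ¬ (imbForm hn v).IsExact ∧
      ∃ σ : DForm (Stiefel n) (2 * n - 3), IsVolumeForm σ ∧
        HasDegree (orientCircleStiefel hn σ) (orientSpheres hn τ) gaussMap dSmooth_gaussMap
          (1 + (-1) ^ n) ∧
        (1 + (-1) ^ n : ℤ) = 2 ∧
        HasIntegral σ ((imbForm hn v).pullback stiefelCycle dSmooth_stiefelCycle) 2 := by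
  have h2 : (1 + (-1) ^ n : ℤ) = 2 := by
    rw [heven.neg_one_pow]
    norm_num
  rw [h2]
  obtain ⟨L, rfl⟩ : ∃ L, n = L + 2 := ⟨n - 2, by omega⟩
  -- the degrees `n - 1` and `2 * n - 3` reduce to `L + 1` and `2 * L + 1` by definition
  obtain ⟨hclosed, hexact, σ, hσ, hdeg, hint⟩ := circleForm_properties (L := L) (j := 2 * L)
    (by omega) (by omega) (by omega) (by simpa [Nat.even_add] using heven) τ v hτ hv
  exact ⟨hclosed, hexact, σ, hσ, hdeg, rfl, hint⟩
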